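/- **Setting.** Let $d\ge 1$, and for $n\in\mathbb N$ let $q_1(n),\dots,q_d(n)$ be positive integers, each tending to infinity as $n\to\infty$. Put $N(n)=q_1(n)+\cdots+q_d(n)$ and assume $q_k(n)/N(n)\to\rho_k>0$ for every $k$. Regard $N(n)\times N(n)$ complex matrices as $d\times d$ block matrices whose $(k,l)$ block has size $q_k(n)\times q_l(n)$. For a $q_k(n)\times q_l(n)$ matrix $M$ let $\widetilde M$ be the $N(n)\times N(n)$ matrix with $(k,l)$ block $M$ and all other blocks zero, and let $p_k(n)=\widetilde{I_{q_k(n)}}$. *Rectangular probability spaces.* A $(\rho_1,\dots,\rho_d)$-rectangular probability space is a complex unital $*$-algebra $\mathcal A$ with nonzero self-adjoint, pairwise orthogonal projections $p_1,\dots,p_d$ of sum $1$, and on each $p_k\mathcal Ap_k$ a tracial state $\varphi_k$ (linear, $\varphi_k(p_k)=1$, $\varphi_k(x^*x)\ge0$, $\varphi_k(xy)=\varphi_k(yx)$), such that $\rho_k\varphi_k(xy)=\rho_l\varphi_l(yx)$ for $x\in p_k\mathcal Ap_l$, $y\in p_l\mathcal Ap_k$. Let $\mathcal D=\operatorname{span}(p_1,\dots,p_d)\cong\mathbb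 C^d$ and $\operatorname E(x)=\sum_k\varphi_k(p_kxp_k)\,p_k$. The $N(n)\times N(n)$ matrices, with the $p_k(n)$ and the normalized traces $\frac1{q_k(n)}\operatorname{Tr}$ of the diagonal blocks, form such a space for the ratios $q_k(n)/N(n)$; write $\operatorname E_n$ for its $\operatorname E$. Random matrices $a_j(n)$ ($j\in J$) of size $N(n)\times N(n)$ converge in $\mathcal D$-distribution in probability to elements $a_j$ of $\mathcal A$ if, for every polynomial $P$ in the noncommuting variables $X_j,X_j^*$ with coefficients in $\mathcal D$, $\operatorname E_n(P(a_j(n),a_j(n)^*))\to\operatorname E(P(a_j,a_j^*))$ in probability in $\mathbb C^d$. *Freeness.* Subsets $(S_\alpha)$ of $\mathcal A$ are free with amalgamation over $\mathcal D$ if there are $*$-subalgebras $\mathcal B_\alpha\supseteq\mathcal D\cup S_\alpha$ such that $\operatorname E(x_1\cdots x_m)=0$ whenever $m\geq 1$, $\alpha_1\ne\alpha_2\neq\cdots\ne\alpha_m$, $x_i\in\mathcal B_{\alpha_i}$ and $\operatorname E(x_i)=0$ for all $i$. **Hypotheses.** For $n,s\in\mathbb N$ and $k,l\in\{1,\dots,d\}$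 let $R(s,k,l,n)$ be a $q_k(n)\times q_l(n)$ random matrix such that, for each $n$, the family $(R(s,k,l,n))_{s,k,l}$ is independent, and such that: - for $k\ne l$, $R(s,k,l,n)$ is bi-unitarily invariant (its law is invariant under left and right multiplication by unitary matrices), and its singular law (the uniform distribution on its $\min(q_k(n),q_l(n))$ singular values) converges in probability, for the weak topology, to a deterministic probability measure as $n\to\infty$; - for $s$ odd, $R(s,k,k,n)$ is a uniform (Haar distributed) unitary matrix; - for $s$ even, $R(s,k,k,n)$ is Hermitian and unitarily invariant (its law is invariant under unitary conjugation), and its spectral law (the uniform distribution on its eigenvalues) converges in probability, for the weak topology, to a deterministic probability measure as $n\to\infty$. Let also $(C(i,n))_{i\in I}$ be, for each $n$, a family of deterministic diagonal matrices (entries off the positions $(r,r)$ vanish), $C(i,n)$ of size $q_{k_i}(n)\times q_{l_i}(n)$ with $k_i,l_i\in\{1,\dots,d\}$ not depending on $n$. Suppose that this family contains $I_{q_1(n)},\dots,I_{q_d(n)}$ and is stable under products $C(i,n)C(j,n)$ with $l_i=k_j$ and under adjoints, the index in $I$ and the block type of each identity, product and adjoint not depending on $n$. Suppose that for each $i$ with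 $k_i=l_i$ the normalized trace of $C(i,n)$ has a finite limit as $n\to\infty$. Suppose finally that the operator norms of all $R(s,k,l,n)$ (almost surely) and $C(i,n)$ are bounded by one constant independent of $n,s,k,l,i$. **Conclusion.** There are a $(\rho_1,\dots,\rho_d)$-rectangular probability space $\mathcal A$ and elements $a(s,k,l)\in p_k\mathcal Ap_l$ ($s\in\mathbb N$, $k,l\in\{1,\dots,d\}$), $c(i)\in p_{k_i}\mathcal Ap_{l_i}$ ($i\in I$) such that the family $(\widetilde R(s,k,l,n))_{s,k,l}\cup(\widetilde C(i,n))_{i\in I}$ converges in $\mathcal D$-distribution in probability to $(a(s,k,l))_{s,k,l}\cup(c(i))_{i\in I}$ as $n\to\infty$, and the family of subsets consisting of the singletons $\{a(s,k,l)\}$, one for each $(s,k,l)$, and of the set $\{c(i): i\in I\}$ is free with amalgamation over $\mathcal D$. -/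

import Mathlib

open MeasureTheory ProbabilityTheory Filter Topology

universe u

/-! ### Rectangular probability spaces -/

/-- A `ρ`-rectangular probability space: a `*`-algebra `A` with nonzero, pairwise orthogonal
self-adjoint projections `p 1, …, p d` of sum `1`, and a tracial state on each corner
`p k A p k`. A linear functional on the corner `p k A p k` is represented by the functional
`φ k` on `A` obtained by precomposing it with the compression `x ↦ p k * x * p k`. -/
structure RectProbSpace {d : ℕ} (ρ : Fin d → ℝ) (A : Type u)
    [Ring A] [StarRing A] [Algebra ℂ A] [StarModule ℂ A] where
  p : Fin d → A
  p_ne_zero : ∀ k, p k ≠ 0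
  p_star : ∀ k, star (p k) = p k
  p_mul_self : ∀ k, p k * p k = p k
  p_orthogonal : ∀ k l, k ≠ l → p k * p l = 0
  p_sum : ∑ k, p k = 1
  φ : Fin d → A →ₗ[ℂ] ℂ
  φ_compress : ∀ k x, φ k (p k * x * p k) = φ k x
  φ_unit : ∀ k, φ k (p k) = 1
  φ_nonneg : ∀ k x, p k * x * p k = x →
    0 ≤ (φ k (star x * x)).re ∧ (φ k (star x * x)).im = 0
  φ_tracial : ∀ k x y, p k * x * p k = x → p k * y * p k = y → φ k (x * y) = φ k (y * x)
  φ_swap : ∀ k l x y, p k * x * p l = x → p l * y * p k = y →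
    (ρ k : ℂ) * φ k (x * y) = (ρ l : ℂ) * φ l (y * x)

/-- Noncommutative polynomials in the variables `X j, X j ^*` (`j : J`) with coefficients in the
diagonal algebra: polynomials in the `X j` (`Sum.inr (Sum.inl j)`), the `X j ^*`
(`Sum.inr (Sum.inr j)`) and the coefficients `p k` (`Sum.inl k`). The relations between the
coefficients are not imposed; they hold after every evaluation. -/
abbrev DPolynomial (d : ℕ) (J : Type*) := FreeAlgebra ℂ (Fin d ⊕ (J ⊕ J))

namespace RectProbSpace

variable {d : ℕ} {ρ : Fin d → ℝ} {A : Type u}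
  [Ring A] [StarRing A] [Algebra ℂ A] [StarModule ℂ A]

/-- The corner `p k A p l`; the union of the corners is the set of simple elements. -/
def corner (X : RectProbSpace ρ A) (k l : Fin d) : Set A := {x | X.p k * x * X.p l = x}

theorem sum_smul_mul_sum_smul (X : RectProbSpace ρ A) (z w : Fin d → ℂ) :
    (∑ k, z k • X.p k) * (∑ k, w k • X.p k) = ∑ k, (z k * w k) • X.p k := by
  rw [Finset.sum_mul_sum]
  refine Finset.sum_congr rfl fun k _ => ?_
  rw [Finset.sum_eq_single k]
  · rw [smul_mul_smul_comm, X.p_mul_self]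
  · intro l _ hl
    rw [smul_mul_smul_comm, X.p_orthogonal k l (Ne.symm hl), smul_zero]
  · simp

/-- The diagonal algebra `𝒟`, the linear span of the projections `p k`. -/
def diag (X : RectProbSpace ρ A) : StarSubalgebra ℂ A where
  carrier := {x | ∃ z : Fin d → ℂ, x = ∑ k, z k • X.p k}
  mul_mem' := by
    rintro _ _ ⟨z, rfl⟩ ⟨w, rfl⟩
    exact ⟨fun k => z k * w k, X.sum_smul_mul_sum_smul z w⟩
  add_mem' := by
    rintro _ _ ⟨z, rfl⟩ ⟨w, rfl⟩
    exact ⟨fun k => z k + w k, by simp only [add_smul, Finset.sum_add_distrib]⟩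
  algebraMap_mem' := by
    intro c
    exact ⟨fun _ => c, by rw [← Finset.smul_sum, X.p_sum, Algebra.algebraMap_eq_smul_one]⟩
  star_mem' := by
    rintro _ ⟨z, rfl⟩
    exact ⟨fun k => star (z k), by simp [star_sum, star_smul, X.p_star]⟩

/-- The conditional expectation `E x = ∑ k, φ k (x k k) • p k` onto the diagonal algebra. -/
noncomputable def condExp (X : RectProbSpace ρ A) : A →ₗ[ℂ] A :=
  ∑ k, (X.φ k).smulRight (X.p k)

/-- Evaluation of a polynomial with coefficients in the diagonal algebra at a family `a`. -/
noncomputable def eval (X : RectProbSpace ρ A) {J : Type*} (a : J → A) :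
    DPolynomial d J →ₐ[ℂ] A :=
  FreeAlgebra.lift ℂ (Sum.elim X.p (Sum.elim a fun j => star (a j)))

/-- The `𝒟`-distribution of a family `a`, the map `P ↦ E (P (a, a^*))`. The diagonal algebra is
identified with `ℂ ^ d`, so that `E x` is the vector of the `φ k (x k k)`. -/
noncomputable def dDistribution (X : RectProbSpace ρ A) {J : Type*} (a : J → A)
    (P : DPolynomial d J) : Fin d → ℂ :=
  fun k => X.φ k (X.eval a P)

end RectProbSpace

/-! ### Freeness with amalgamation -/

section Freeness

variable {B : Type u} [Ring B] [StarRing B] [Algebra ℂ B] [StarModule ℂ B]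

/-- Freeness, with respect to a conditional expectation `E`, of a family of `*`-subalgebras:
`E (x 0 * ⋯ * x m) = 0` whenever consecutive `x i` belong to different subalgebras of the family
and `E (x i) = 0` for all `i`. -/
def SubalgebrasFree (E : B → B) {ι : Type*} (T : ι → StarSubalgebra ℂ B) : Prop :=
  ∀ (m : ℕ) (α : Fin (m + 1) → ι) (x : Fin (m + 1) → B),
    (∀ i : Fin m, α i.castSucc ≠ α i.succ) → (∀ i, x i ∈ T (α i)) → (∀ i, E (x i) = 0) →
      E (List.ofFn x).prod = 0

/-- A family of subsets is free with amalgamation over `C` if the subsets are contained in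
`*`-subalgebras containing `C` that are free with amalgamation over `C`. -/
def FreeWithAmalgamation (C : StarSubalgebra ℂ B) (E : B → B) {ι : Type*} (S : ι → Set B) :
    Prop :=
  ∃ T : ι → StarSubalgebra ℂ B,
    (∀ α, C ≤ T α) ∧ (∀ α, S α ⊆ (T α : Set B)) ∧ SubalgebrasFree E T

end Freeness

/-! ### Block matrices -/

/-- Index set of the square matrices of size `q 1 + ⋯ + q d`, seen as `d × d` block matrices. -/
abbrev BlockIndex {d : ℕ} (q : Fin d → ℕ) := Σ k : Fin d, Fin (q k)

/-- Square matrices of size `q 1 + ⋯ + q d`, seen as `d × d` block matrices. -/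
abbrev BlockMatrix {d : ℕ} (q : Fin d → ℕ) := Matrix (BlockIndex q) (BlockIndex q) ℂ

/-- The extension of a `q k × q l` matrix `M`: the block matrix whose `(k, l)` block is `M`,
all other blocks being zero. -/
noncomputable def blockExt {d : ℕ} {q : Fin d → ℕ} {k l : Fin d}
    (M : Matrix (Fin (q k)) (Fin (q l)) ℂ) : BlockMatrix q :=
  ∑ i, ∑ j, Matrix.single ⟨k, i⟩ ⟨l, j⟩ (M i j)

/-- The projection `p k`, the extension of the identity matrix of size `q k`. -/
noncomputable def blockProj {d : ℕ} (q : Fin d → ℕ) (k : Fin d) : BlockMatrix q :=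
  Matrix.diagonal fun x => if x.1 = k then 1 else 0

/-- The normalized trace of the `k`-th diagonal block. -/
noncomputable def blockTrace {d : ℕ} (q : Fin d → ℕ) (k : Fin d) : BlockMatrix q →ₗ[ℂ] ℂ :=
  (q k : ℂ)⁻¹ • ∑ i : Fin (q k), Matrix.entryLinearMap ℂ ℂ ⟨k, i⟩ ⟨k, i⟩

theorem blockProj_mul_mul {d : ℕ} (q : Fin d → ℕ) (k l : Fin d) (x : BlockMatrix q)
    (a b : BlockIndex q) : (blockProj q k * x * blockProj q l) a b =
      if a.1 = k ∧ b.1 = l then x a b else 0 := by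
  rw [blockProj, blockProj, Matrix.mul_diagonal, Matrix.diagonal_mul]
  split_ifs <;> simp_all

theorem blockTrace_apply {d : ℕ} (q : Fin d → ℕ) (k : Fin d) (x : BlockMatrix q) :
    blockTrace q k x = (q k : ℂ)⁻¹ * ∑ i, x ⟨k, i⟩ ⟨k, i⟩ := by
  simp [blockTrace]

/-- For `x` in the `(k, l)` corner and `y` in the `(l, k)` corner. -/
theorem blockTrace_mul {d : ℕ} (q : Fin d → ℕ) (k l : Fin d) (x y : BlockMatrix q)
    (hx : blockProj q k * x * blockProj q l = x) :
    blockTrace q k (x * y) = (q k : ℂ)⁻¹ * ∑ i, ∑ j, x ⟨k, i⟩ ⟨l, j⟩ * y ⟨l, j⟩ ⟨k, i⟩ := by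
  rw [blockTrace_apply]
  congr 1
  refine Finset.sum_congr rfl fun i _ => ?_
  rw [Matrix.mul_apply, Fintype.sum_sigma, Finset.sum_eq_single l]
  · intro m _ hm
    refine Finset.sum_eq_zero fun j _ => ?_
    rw [← hx, blockProj_mul_mul]
    simp [hm]
  · simp

/-- Block matrices with the normalized traces of the diagonal blocks form a rectangular
probability space, for the ratios of the sizes of the blocks to the total size. -/
noncomputable def blockMatrixSpace {d : ℕ} (q : Fin d → ℕ) (hq : ∀ k, 0 < q k) :
    RectProbSpace (fun k => (q k : ℝ) / ((∑ l, q l : ℕ) : ℝ)) (BlockMatrix q) where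
  p := blockProj q
  p_ne_zero k h := by
    have := congrFun (congrFun h ⟨k, ⟨0, hq k⟩⟩) ⟨k, ⟨0, hq k⟩⟩
    simp [blockProj] at this
  p_star k := by
    rw [blockProj, Matrix.star_eq_conjTranspose, Matrix.diagonal_conjTranspose]
    congr 1
    ext x
    simp only [Pi.star_apply]
    split_ifs <;> simp
  p_mul_self k := by
    simp [blockProj, Matrix.diagonal_mul_diagonal]
  p_orthogonal k l h := by
    rw [blockProj, blockProj, Matrix.diagonal_mul_diagonal, ← Matrix.diagonal_zero]
    congr 1
    ext x
    by_cases hx : x.1 = k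
    · simp [hx, h]
    · simp [hx]
  p_sum := by
    ext a b
    rw [Matrix.sum_apply]
    by_cases h : a = b
    · subst h
      simp [blockProj]
    · simp [blockProj, h]
  φ := blockTrace q
  φ_compress k x := by
    simp [blockTrace_apply, blockProj_mul_mul]
  φ_unit k := by
    have : (q k : ℂ) ≠ 0 := by exact_mod_cast (hq k).ne'
    simp [blockTrace_apply, blockProj, this]
  φ_nonneg k x hx := by
    have hs : blockProj q k * star x * blockProj q k = star x := by
      ext a b
      rw [blockProj_mul_mul, Matrix.star_apply]
      have := congrFun (congrFun hx b) a
      rw [blockProj_mul_mul] at this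
      by_cases h : b.1 = k ∧ a.1 = k
      · rw [if_pos h.symm]
      · rw [if_neg h] at this
        rw [if_neg fun h' => h h'.symm, ← this, star_zero]
    have : blockTrace q k (star x * x) =
        (((q k : ℝ)⁻¹ * ∑ i, ∑ j, Complex.normSq (x ⟨k, j⟩ ⟨k, i⟩) : ℝ) : ℂ) := by
      rw [blockTrace_mul q k k _ _ hs]
      push_cast
      congr 1
      refine Finset.sum_congr rfl fun i _ => Finset.sum_congr rfl fun j _ => ?_
      rw [Matrix.star_apply]
      exact Complex.normSq_eq_conj_mul_self.symm
    rw [this]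
    refine ⟨?_, Complex.ofReal_im _⟩
    rw [Complex.ofReal_re]
    exact mul_nonneg (by positivity)
      (Finset.sum_nonneg fun i _ => Finset.sum_nonneg fun j _ => Complex.normSq_nonneg _)
  φ_tracial k x y hx hy := by
    rw [blockTrace_mul q k k x y hx, blockTrace_mul q k k y x hy, Finset.sum_comm]
    simp only [mul_comm]
  φ_swap k l x y hx hy := by
    rw [blockTrace_mul q k l x y hx, blockTrace_mul q l k y x hy, Finset.sum_comm]
    have h1 : (q k : ℂ) ≠ 0 := by exact_mod_cast (hq k).ne'
    have h2 : (q l : ℂ) ≠ 0 := by exact_mod_cast (hq l).ne'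
    simp only [mul_comm (x _ _)]
    push_cast
    field_simp

/-! ### Random matrices -/

noncomputable instance matrixMeasurableSpace {m n : Type*} : MeasurableSpace (Matrix m n ℂ) :=
  inferInstanceAs (MeasurableSpace (m → n → ℂ))

/-- The operator norm of a matrix for the canonical hermitian norms. -/
noncomputable def opNorm {p q : ℕ} (M : Matrix (Fin p) (Fin q) ℂ) : ℝ :=
  ‖LinearMap.toContinuousLinearMap (Matrix.toEuclideanLin M)‖

/-- The uniform distribution on `x 0, …, x (m - 1)`. -/
noncomputable def empiricalLaw {m : ℕ} (x : Fin m → ℝ) : Measure ℝ :=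
  (m : ENNReal)⁻¹ • ∑ i, Measure.dirac (x i)

/-- The singular law of a `p × q` matrix, the uniform distribution on its `min p q` singular
values. -/
noncomputable def singularLaw {p q : ℕ} (M : Matrix (Fin p) (Fin q) ℂ) : Measure ℝ :=
  empiricalLaw fun i : Fin (min p q) => (Matrix.toEuclideanLin M).singularValues i

open Classical in
/-- The spectral law of a hermitian matrix, the uniform distribution on its eigenvalues. It is
only used for hermitian matrices. -/
noncomputable def spectralLaw {p : ℕ} (M : Matrix (Fin p) (Fin p) ℂ) : Measure ℝ :=
  if h : M.IsHermitian then empiricalLaw h.eigenvalues else 0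

section Invariance

variable {Ω : Type*} [MeasurableSpace Ω] (P : Measure Ω) {p q : ℕ}

/-- The law of `R` is invariant under the left and right actions of the unitary groups. -/
def BiUnitarilyInvariant (R : Ω → Matrix (Fin p) (Fin q) ℂ) : Prop :=
  ∀ U ∈ Matrix.unitaryGroup (Fin p) ℂ, ∀ V ∈ Matrix.unitaryGroup (Fin q) ℂ,
    P.map (fun ω => U * R ω * V) = P.map R

/-- The law of `R` is invariant under unitary conjugation. -/
def UnitarilyInvariant (R : Ω → Matrix (Fin p) (Fin p) ℂ) : Prop :=
  ∀ U ∈ Matrix.unitaryGroup (Fin p) ℂ, P.map (fun ω => U * R ω * star U) = P.map R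

/-- `R` is a uniform random unitary matrix: it is almost surely unitary, and its law is
invariant under left multiplication by unitary matrices (so it is the Haar probability
measure). -/
def UniformUnitary (R : Ω → Matrix (Fin p) (Fin p) ℂ) : Prop :=
  (∀ᵐ ω ∂P, R ω ∈ Matrix.unitaryGroup (Fin p) ℂ) ∧
    ∀ U ∈ Matrix.unitaryGroup (Fin p) ℂ, P.map (fun ω => U * R ω) = P.map R

end Invariance

section Convergence

variable {Ω : ℕ → Type*} [∀ n, MeasurableSpace (Ω n)] (P : ∀ n, Measure (Ω n))

/-- Convergence in probability to a constant of random variables `Y n`, where `Y n` is defined on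
a probability space that may depend on `n`. -/
def TendstoInProb {E : Type*} [PseudoMetricSpace E] (Y : ∀ n, Ω n → E) (y : E) : Prop :=
  ∀ ε : ℝ, 0 < ε → Tendsto (fun n => P n {ω | ε ≤ dist (Y n ω) y}) atTop (𝓝 0)

/-- The random measures `μ n` converge in probability, for the weak topology, to a deterministic
probability measure. -/
def ConvergesToDeterministicLaw (μ : ∀ n, Ω n → Measure ℝ) : Prop :=
  ∃ ν : Measure ℝ, IsProbabilityMeasure ν ∧ ∀ f : BoundedContinuousFunction ℝ ℝ,
    TendstoInProb P (fun n ω => ∫ x, f x ∂(μ n ω)) (∫ x, f x ∂ν)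

end Convergence

/-- The rectangular `p × q` matrix `M` is diagonal. -/
def IsRectDiagonal {p q : ℕ} (M : Matrix (Fin p) (Fin q) ℂ) : Prop :=
  ∀ (i : Fin p) (j : Fin q), (i : ℕ) ≠ (j : ℕ) → M i j = 0

/-! ### Asymptotic freeness from the liberation equations -/

section AsymptoticFreeness

variable {𝔄 Z κ : Type*} [Ring 𝔄] [Algebra ℂ 𝔄] {d : ℕ}

/-! A matrix depending on the random family is viewed as a field on configurations, i.e. pairs of a
size and a value of the whole family. Convergence in probability is then convergence along one
filter, `configFilter`. The normalized trace of a field is a scalar field, so the theorem becomes a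
statement about limits of `τ (p k * x)` for a trace `τ` with values in functions.

Freeness comes from invariance. Conjugating the matrix of one index `t` by a block diagonal unitary
preserves the joint law (`RandomBlocks.map_conj`). Suppose that the derivative of `x` in a block
diagonal antihermitian direction `X` is `∑ a * X * b`, and let `Z = ∑ τ (p k * a) * τ (p k * b)`.
Differentiating the constant expectation of `f * x i j` and summing over suitable directions and
entries gives the Schwinger–Dyson equation `N² E[f Z] + E[τ (p k * g * p k * x)] = 0`, where `g` is
the gradient of the scalar field `f` (`HasFlowDeriv.integral_eq`). Taking for `f` the conjugate of
`Z` gives `E|Z|² = O(N⁻²)`, hence `Z → 0` in probability (`HasFlowDeriv.tendsto_tensorTrace`).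
Variance and expectation are thus controlled at once, and no separate concentration inequality is
needed. On a word in the algebras generated by the several matrices, the tensor `∑ a ⊗ b` is the
value of the liberation derivation: `x ↦ 1 ⊗ x - x ⊗ 1` on the algebra of index `t`, zero on the
others.

These equations force asymptotic freeness (`AsymptoticTrace.Alternating.centered_prod`), by
induction on the length of an alternating centered word `w`. If both ends of `w` lie in the same
algebra, traciality merges them and shortens the word. Otherwise one end, and only that one, has
some index `t`. In the liberation equation for `t`, every term is a product of traces of strictly
shorter words, except one term `± τ (p k) * τ (p k * w)`; since `τ (p k)` has a nonzero limit, `τ (p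
k * w) → 0`.

The same reduction shows that the algebra generated by all the matrices is spanned by the
projections and the alternating centered words. Joint convergence therefore follows from convergence
on each algebra separately (`AsymptoticTrace.convergent_of_mem_adjoin`). Those marginals are
computed directly: moments of the spectral and singular laws, a Schwinger–Dyson argument for left
multiplication in the Haar case, and the assumed limits of traces for the deterministic family.

The limit space is the algebra of fields generated by the matrices, with `φ k` the limit of the
block traces. Faithfulness is not required, so no quotient is taken, and the axioms pass to the
limit from those of block matrices. -/

/-- A tracial map `τ` with values in functions on `Z`, such that the functions `τ (p k)` tend to
the nonzero numbers `ρ k` along the filter `F`, where the `p k` are orthogonal idempotents of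
sum `1`. -/
structure AsymptoticTrace (p : Fin d → 𝔄) (τ : 𝔄 →ₗ[ℂ] Z → ℂ) (F : Filter Z)
    (ρ : Fin d → ℂ) : Prop where
  idem : ∀ k, p k * p k = p k
  orth : ∀ k l, k ≠ l → p k * p l = 0
  sum_eq_one : ∑ k, p k = 1
  trace_comm : ∀ x y, τ (x * y) = τ (y * x)
  tendsto : ∀ k, Tendsto (τ (p k)) F (𝓝 (ρ k))
  ne_zero : ∀ k, ρ k ≠ 0

/-- The expectation of `x` on the diagonal tends to zero. -/
def AsymptoticallyCentered (p : Fin d → 𝔄) (τ : 𝔄 →ₗ[ℂ] Z → ℂ) (F : Filter Z) (x : 𝔄) : Prop :=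
  ∀ k, Tendsto (τ (p k * x)) F (𝓝 0)

/-- The expectation of `x` on the diagonal converges. -/
def AsymptoticallyConvergent (p : Fin d → 𝔄) (τ : 𝔄 →ₗ[ℂ] Z → ℂ) (F : Filter Z) (x : 𝔄) : Prop :=
  ∀ k, ∃ c, Tendsto (τ (p k * x)) F (𝓝 c)

open Classical in
/-- The terms `(a, b)` of `∑ a ⊗ b`, the value at the product of `l` of the derivation which is
the commutator with `1 ⊗ 1` on the factors of index `t` and vanishes on the other factors. -/
noncomputable def liberationTerms (t : κ) : List (Option κ × 𝔄) → List (𝔄 × 𝔄)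
  | [] => []
  | y :: l => (if y.1 = some t then [(1, y.2 * (l.map Prod.snd).prod),
        (-y.2, (l.map Prod.snd).prod)] else []) ++
      (liberationTerms t l).map fun ab => (y.2 * ab.1, ab.2)

/-- Evaluation of a list of tensors. -/
noncomputable def tensorTrace (p : Fin d → 𝔄) (τ : 𝔄 →ₗ[ℂ] Z → ℂ) (k : Fin d)
    (L : List (𝔄 × 𝔄)) : Z → ℂ :=
  (L.map fun ab => τ (p k * ab.1) * τ (p k * ab.2)).sum

theorem tensorTrace_append (p : Fin d → 𝔄) (τ : 𝔄 →ₗ[ℂ] Z → ℂ) (k : Fin d)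
    (L L' : List (𝔄 × 𝔄)) :
    tensorTrace p τ k (L ++ L') = tensorTrace p τ k L + tensorTrace p τ k L' := by
  simp [tensorTrace]

namespace AsymptoticTrace

variable {p : Fin d → 𝔄} {τ : 𝔄 →ₗ[ℂ] Z → ℂ} {F : Filter Z} {ρ : Fin d → ℂ}

theorem tendsto_tensorTrace_of_eq_nil (k : Fin d) :
    Tendsto (tensorTrace p τ k []) F (𝓝 0) :=
  tendsto_const_nhds

-- A term of the derivation that falls strictly inside `w` cuts it into two proper pieces, each of
-- trace tending to zero. The exception is `-w ⊗ 1`, produced by the last letter when its index is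
-- `t`; the added summand compensates exactly that term.
open Classical in
theorem tendsto_tensorTrace_tail (t : κ) (k : Fin d) (w : List (Option κ × 𝔄))
    (hw : ∀ u v, u ++ v = w → u ≠ [] → v ≠ [] →
      Tendsto (τ (p k * (u.map Prod.snd).prod)) F (𝓝 0) ∧
      Tendsto (τ (p k * (v.map Prod.snd).prod)) F (𝓝 0)) :
    ∀ (suf pre : List (Option κ × 𝔄)), pre ++ suf = w → pre ≠ [] → (hs : suf ≠ []) →
      Tendsto (tensorTrace p τ k ((liberationTerms t suf).map
          fun ab => ((pre.map Prod.snd).prod * ab.1, ab.2)) +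
        (if (suf.getLast hs).1 = some t then
          τ (p k * (w.map Prod.snd).prod) * τ (p k) else 0)) F (𝓝 0) := by
  intro suf
  induction suf with
  | nil => intro _ _ _ hs; exact absurd rfl hs
  | cons y l ih =>
    intro pre hpre hne _
    have h0 := hw pre (y :: l) hpre hne (by simp)
    rcases eq_or_ne l [] with rfl | hl
    · have hprod : (w.map Prod.snd).prod = (pre.map Prod.snd).prod * y.2 := by
        rw [← hpre]; simp
      by_cases hy : y.1 = some t
      · have := h0.1.mul h0.2
        rw [mul_zero] at this
        refine this.congr fun z => ?_
        simp [liberationTerms, hy, tensorTrace, hprod]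
      · have : Tendsto (fun _ : Z => (0 : ℂ)) F (𝓝 0) := tendsto_const_nhds
        refine this.congr fun z => ?_
        simp [liberationTerms, hy, tensorTrace]
    · have h1 := hw (pre ++ [y]) l (by rw [← hpre]; simp) (by simp) hl
      have h2 := ih (pre ++ [y]) (by rw [← hpre]; simp) (by simp) hl
      -- The letter `y` contributes the cut just before it and, with a minus sign, the cut just
      -- after it.
      have h3 : Tendsto (tensorTrace p τ k ((if y.1 = some t then
          [(1, y.2 * (l.map Prod.snd).prod), (-y.2, (l.map Prod.snd).prod)] else []).map
            fun ab => ((pre.map Prod.snd).prod * ab.1, ab.2))) F (𝓝 0) := by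
        by_cases hy : y.1 = some t
        · have := (h0.1.mul h0.2).sub (h1.1.mul h1.2)
          rw [mul_zero, sub_zero] at this
          refine this.congr fun z => ?_
          simp [hy, tensorTrace]
          ring
        · simp only [if_neg hy, List.map_nil]
          exact tendsto_tensorTrace_of_eq_nil k
      have h4 := h3.add h2
      rw [add_zero] at h4
      have h5 : (pre ++ [y]).map Prod.snd = pre.map Prod.snd ++ [y.2] := by simp
      refine h4.congr fun z => ?_
      rw [List.getLast_cons hl, liberationTerms, List.map_append (l₂ := (liberationTerms t l).map _),
        tensorTrace_append, List.map_map, h5, List.prod_append, List.prod_singleton]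
      simp only [Pi.add_apply, Function.comp_def, mul_assoc, add_assoc]

/-! ### Centering with respect to the diagonal algebra -/

section Centered

variable (h : AsymptoticTrace p τ F ρ)
include h

theorem centered_proj_mul {x : 𝔄} (hx : AsymptoticallyCentered p τ F x) (j : Fin d) :
    AsymptoticallyCentered p τ F (p j * x) := by
  intro k
  rcases eq_or_ne k j with rfl | hkj
  · rw [← mul_assoc, h.idem]; exact hx k
  · rw [← mul_assoc, h.orth k j hkj, zero_mul, map_zero]
    exact tendsto_const_nhds

theorem apply_eq_sum (x : 𝔄) : τ x = ∑ k, τ (p k * x) := by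
  rw [← map_sum, ← Finset.sum_mul, h.sum_eq_one, one_mul]

theorem tendsto_of_centered {x : 𝔄} (hx : AsymptoticallyCentered p τ F x) :
    Tendsto (τ x) F (𝓝 0) := by
  rw [h.apply_eq_sum x]
  have : Tendsto (fun z => ∑ k, τ (p k * x) z) F (𝓝 (∑ _k : Fin d, 0)) :=
    tendsto_finsetSum _ fun k _ => hx k
  rw [Finset.sum_const_zero] at this
  exact this.congr fun z => (Finset.sum_apply z _ _).symm

theorem proj_mul_sum_smul (k : Fin d) (c : Fin d → ℂ) : p k * ∑ j, c j • p j = c k • p k := by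
  rw [Finset.mul_sum, Finset.sum_eq_single k]
  · rw [mul_smul_comm, h.idem]
  · intro j _ hj
    rw [mul_smul_comm, h.orth k j hj.symm, smul_zero]
  · simp

/-- Since `τ (p k) → ρ k ≠ 0`, the limit of `τ (p k * x)` divided by `ρ k` is the coefficient of `p
k` to be removed. -/
theorem exists_centered_sub {x : 𝔄} (hx : AsymptoticallyConvergent p τ F x) :
    ∃ c : Fin d → ℂ, AsymptoticallyCentered p τ F (x - ∑ j, c j • p j) := by
  choose c hc using hx
  refine ⟨fun j => c j / ρ j, fun k => ?_⟩
  rw [mul_sub, h.proj_mul_sum_smul, map_sub, map_smul]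
  have := (hc k).sub ((h.tendsto k).const_mul (c k / ρ k))
  rw [div_mul_cancel₀ _ (h.ne_zero k), sub_self] at this
  exact this

end Centered

/-- Lists of asymptotically centered elements of the algebras `T α`, consecutive elements being
taken in different algebras. -/
def Alternating (p : Fin d → 𝔄) (τ : 𝔄 →ₗ[ℂ] Z → ℂ) (F : Filter Z)
    (T : Option κ → Subalgebra ℂ 𝔄) (l : List (Option κ × 𝔄)) : Prop :=
  (∀ y ∈ l, y.2 ∈ T y.1 ∧ AsymptoticallyCentered p τ F y.2) ∧
    l.IsChain fun y z => y.1 ≠ z.1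

variable {T : Option κ → Subalgebra ℂ 𝔄}

theorem Alternating.of_append {u v : List (Option κ × 𝔄)} (hl : Alternating p τ F T (u ++ v)) :
    Alternating p τ F T u ∧ Alternating p τ F T v := by
  have := List.isChain_append.1 hl.2
  exact ⟨⟨fun y hy => hl.1 y (List.mem_append_left _ hy), this.1⟩,
    ⟨fun y hy => hl.1 y (List.mem_append_right _ hy), this.2.1⟩⟩

theorem Alternating.tail {y : Option κ × 𝔄} {l : List (Option κ × 𝔄)}
    (hl : Alternating p τ F T (y :: l)) : Alternating p τ F T l :=
  (Alternating.of_append (u := [y]) hl).2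

/-- Replacing the first element by another element of the same algebra. -/
theorem Alternating.replace {y : Option κ × 𝔄} {l : List (Option κ × 𝔄)}
    (hl : Alternating p τ F T (y :: l)) {x : 𝔄} (hx : x ∈ T y.1)
    (hx' : AsymptoticallyCentered p τ F x) : Alternating p τ F T ((y.1, x) :: l) := by
  refine ⟨fun z hz => ?_, ?_⟩
  · rcases List.mem_cons.1 hz with rfl | hz
    · exact ⟨hx, hx'⟩
    · exact hl.1 z (List.mem_cons_of_mem _ hz)
  · have := hl.2
    rw [List.isChain_cons] at this ⊢
    exact this

/-! ### Vanishing of alternating moments, and convergence on the generated algebra -/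

section Main

variable (h : AsymptoticTrace p τ F ρ) (hp : ∀ α k, p k ∈ T α)
  (hconv : ∀ α, ∀ x ∈ T α, AsymptoticallyConvergent p τ F x)
include h hp

theorem Alternating.proj_mul {y : Option κ × 𝔄} {l : List (Option κ × 𝔄)}
    (hl : Alternating p τ F T (y :: l)) (j : Fin d) :
    Alternating p τ F T ((y.1, p j * y.2) :: l) :=
  hl.replace (mul_mem (hp _ j) (hl.1 y (by simp)).1)
    (h.centered_proj_mul (hl.1 y (by simp)).2 j)

include hconv

/-- An alternating product of asymptotically centered elements is asymptotically centered. -/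
theorem Alternating.centered_prod
    (hlib : ∀ t k (l : List (Option κ × 𝔄)), (∀ y ∈ l, y.2 ∈ T y.1) →
      Tendsto (tensorTrace p τ k (liberationTerms t l)) F (𝓝 0)) :
    ∀ (m : ℕ) (l : List (Option κ × 𝔄)), l.length ≤ m → l ≠ [] → Alternating p τ F T l →
      AsymptoticallyCentered p τ F (l.map Prod.snd).prod := by
  classical
  intro m
  induction m with
  | zero =>
    intro l hl hne
    exact absurd (List.length_eq_zero_iff.1 (Nat.le_zero.1 hl)) hne
  | succ m ih =>
    intro l hlen hne hl k
    obtain ⟨y, s, rfl⟩ := List.exists_cons_of_ne_nil hne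
    rcases eq_or_ne s [] with rfl | hs
    · simpa using (hl.1 y (by simp)).2 k
    have hsub : ∀ u v, u ++ v = y :: s → u ≠ [] → v ≠ [] →
        Tendsto (τ (p k * (u.map Prod.snd).prod)) F (𝓝 0) ∧
        Tendsto (τ (p k * (v.map Prod.snd).prod)) F (𝓝 0) := by
      intro u v huv hu hv
      have h1 := List.length_pos_iff.2 hu
      have h2 := List.length_pos_iff.2 hv
      have h3 := congrArg List.length huv
      rw [List.length_append] at h3
      rw [← huv] at hl
      exact ⟨ih u (by omega) hu hl.of_append.1 k, ih v (by omega) hv hl.of_append.2 k⟩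
    by_cases hends : y.1 = (s.getLast hs).1
    · -- both ends in the same algebra: rotate
      obtain ⟨mid, z, rfl⟩ : ∃ mid z, s = mid ++ [z] :=
        ⟨s.dropLast, s.getLast hs, (List.dropLast_append_getLast hs).symm⟩
      simp only [List.getLast_append_singleton] at hends
      have hmid : mid ≠ [] := by
        rintro rfl
        have := hl.2
        simp only [List.nil_append, List.isChain_cons_cons] at this
        exact this.1 hends
      have hy := hl.1 y (by simp)
      have hz := hl.1 z (by simp)
      have hlm : Alternating p τ F T (y :: mid) :=
        (Alternating.of_append (u := y :: mid) (v := [z]) hl).1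
      have hw : z.2 * p k * y.2 ∈ T y.1 :=
        mul_mem (mul_mem (hends ▸ hz.1) (hp _ k)) hy.1
      obtain ⟨c, hc⟩ := h.exists_centered_sub (hconv _ _ hw)
      have hlen' : mid.length + 1 ≤ m := by simpa using hlen
      have h1 := h.tendsto_of_centered (ih _ (by simpa using hlen') (by simp)
        (hlm.replace (sub_mem hw (sum_mem fun j _ =>
          (T y.1).smul_mem (hp _ j) (c j))) hc))
      -- Centering the merged letter leaves a correction in the diagonal algebra times `mid`, which
      -- is itself a shorter nonempty alternating word.
      have h2 : Tendsto (fun x => ∑ j, c j * τ (p j * (mid.map Prod.snd).prod) x) F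
          (𝓝 (∑ j, c j * 0)) :=
        tendsto_finsetSum _ fun j _ => (ih mid (by omega) hmid hlm.tail j).const_mul (c j)
      have h3 := h1.add h2
      simp only [mul_zero, Finset.sum_const_zero, add_zero] at h3
      refine h3.congr fun x => ?_
      have e1 : τ (p k * ((y :: (mid ++ [z])).map Prod.snd).prod) =
          τ ((z.2 * p k * y.2) * (mid.map Prod.snd).prod) := by
        have : p k * ((y :: (mid ++ [z])).map Prod.snd).prod =
            (p k * y.2 * (mid.map Prod.snd).prod) * z.2 := by
          simp [mul_assoc]
        rw [this, h.trace_comm]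
        simp only [mul_assoc]
      rw [e1]
      simp only [List.map_cons, List.prod_cons, sub_mul, map_sub, Finset.sum_mul, map_sum,
        smul_mul_assoc, map_smul, Pi.sub_apply, Finset.sum_apply, Pi.smul_apply, smul_eq_mul]
      ring
    · obtain ⟨t, ht⟩ : ∃ t, y.1 = some t ∨ (s.getLast hs).1 = some t := by
        rcases hy : y.1 with _ | t
        · rcases hz : (s.getLast hs).1 with _ | t
          · exact absurd (hy.trans hz.symm) hends
          · exact ⟨t, Or.inr rfl⟩
        · exact ⟨t, Or.inl rfl⟩
      have h1 := tendsto_tensorTrace_tail t k (y :: s) hsub s [y] rfl (by simp) hs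
      have h2 := hlib t k (y :: s) fun x hx => (hl.1 x hx).1
      have h3 := hsub [y] s rfl (by simp) hs
      simp only [List.map_cons, List.map_nil, List.prod_cons, List.prod_nil, mul_one] at h1 h3
      have hA : Tendsto (fun x => τ (p k) x * τ (p k * ((y :: s).map Prod.snd).prod) x) F
          (𝓝 0) := by
        by_cases hy : y.1 = some t
        · have hlast : (s.getLast hs).1 ≠ some t := fun h' => hends (hy.trans h'.symm)
          rw [if_neg hlast, add_zero] at h1
          have h4 := (h2.sub h1).add (h3.1.mul h3.2)
          rw [mul_zero, add_zero, sub_zero] at h4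
          refine h4.congr fun x => ?_
          rw [liberationTerms, tensorTrace_append, if_pos hy]
          simp [tensorTrace]
        · have hlast : (s.getLast hs).1 = some t := ht.resolve_left hy
          rw [if_pos hlast] at h1
          have h4 := h1.sub h2
          rw [sub_zero] at h4
          refine h4.congr fun x => ?_
          rw [liberationTerms, tensorTrace_append, if_neg hy]
          simp [tensorTrace, mul_comm (τ (p k) x)]
      have h5 := hA.div (h.tendsto k) (h.ne_zero k)
      rw [zero_div] at h5
      refine h5.congr' ?_
      filter_upwards [(h.tendsto k).eventually_ne (h.ne_zero k)] with x hx
      exact mul_div_cancel_left₀ _ hx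

-- A projection is absorbed by the first letter without destroying centering or alternation; for the
-- empty word it remains as a generator of the span.
omit hconv in
theorem proj_mul_prod_mem_span (j : Fin d) {l : List (Option κ × 𝔄)}
    (hl : Alternating p τ F T l) :
    p j * (l.map Prod.snd).prod ∈ Submodule.span ℂ (Set.range p ∪
      {x | ∃ l, l ≠ [] ∧ Alternating p τ F T l ∧ x = (l.map Prod.snd).prod}) := by
  rcases l with _ | ⟨y, l⟩
  · exact Submodule.subset_span (Or.inl ⟨j, by simp⟩)
  · exact Submodule.subset_span (Or.inr ⟨_, by simp, hl.proj_mul h hp j, by simp [mul_assoc]⟩)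

/-- Normal form reduction: a new letter is merged with the first one if they lie in the same
algebra, and put in front of it otherwise. Centering the new first letter splits off terms `p j`
times an alternating word, which `proj_mul_prod_mem_span` handles. -/
theorem mul_mem_span {α : Option κ} {y v : 𝔄} (hy : y ∈ T α)
    (hv : v ∈ Submodule.span ℂ (Set.range p ∪
      {x | ∃ l, l ≠ [] ∧ Alternating p τ F T l ∧ x = (l.map Prod.snd).prod})) :
    y * v ∈ Submodule.span ℂ (Set.range p ∪
      {x | ∃ l, l ≠ [] ∧ Alternating p τ F T l ∧ x = (l.map Prod.snd).prod}) := by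
  classical
  set V := Submodule.span ℂ (Set.range p ∪
      {x | ∃ l, l ≠ [] ∧ Alternating p τ F T l ∧ x = (l.map Prod.snd).prod}) with hV
  -- an element of `T α` can be put in front of a list which remains alternating
  have key : ∀ (β : Option κ) (w : 𝔄), w ∈ T β → ∀ l : List (Option κ × 𝔄),
      Alternating p τ F T l → (∀ z ∈ l.head?, β ≠ z.1) → w * (l.map Prod.snd).prod ∈ V := by
    intro β w hw l hl hβ
    obtain ⟨c, hc⟩ := h.exists_centered_sub (hconv β w hw)
    have e : w * (l.map Prod.snd).prod = (w - ∑ j, c j • p j) * (l.map Prod.snd).prod +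
        ∑ j, c j • (p j * (l.map Prod.snd).prod) := by
      rw [sub_mul, Finset.sum_mul]
      simp only [smul_mul_assoc, sub_add_cancel]
    rw [e]
    refine add_mem (Submodule.subset_span (Or.inr ⟨(β, w - ∑ j, c j • p j) :: l, by simp,
      ⟨fun z hz => ?_, List.isChain_cons.2 ⟨hβ, hl.2⟩⟩, by simp⟩))
      (sum_mem fun j _ => V.smul_mem _ (proj_mul_prod_mem_span h hp j hl))
    rcases List.mem_cons.1 hz with rfl | hz
    · exact ⟨sub_mem hw (sum_mem fun j _ => (T β).smul_mem (hp _ j) (c j)), hc⟩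
    · exact hl.1 z hz
  have nil : Alternating p τ F T [] := ⟨by simp, List.IsChain.nil⟩
  induction hv using Submodule.span_induction with
  | zero => simp
  | add a b _ _ ha hb => rw [mul_add]; exact add_mem ha hb
  | smul c a _ ha => rw [mul_smul_comm]; exact V.smul_mem c ha
  | mem v hv =>
    rcases hv with ⟨j, rfl⟩ | ⟨l, hne, hl, rfl⟩
    · have := key α (y * p j) (mul_mem hy (hp _ j)) [] nil (by simp)
      simpa using this
    · obtain ⟨z, l, rfl⟩ := List.exists_cons_of_ne_nil hne
      by_cases hz : α = z.1
      · have hz' := hl.2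
        rw [List.isChain_cons] at hz'
        have := key α (y * z.2) (mul_mem hy (hz ▸ (hl.1 z (by simp)).1)) l hl.tail
          (by rw [hz]; exact hz'.1)
        simpa [mul_assoc] using this
      · exact key α y hy _ hl (by simpa using hz)

/-- Convergence on the algebra generated by the `T α`. -/
theorem convergent_of_mem_adjoin
    (hlib : ∀ t k (l : List (Option κ × 𝔄)), (∀ y ∈ l, y.2 ∈ T y.1) →
      Tendsto (tensorTrace p τ k (liberationTerms t l)) F (𝓝 0))
    {x : 𝔄} (hx : x ∈ Algebra.adjoin ℂ (⋃ α, (T α : Set 𝔄))) :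
    AsymptoticallyConvergent p τ F x := by
  have hV : x ∈ Submodule.span ℂ (Set.range p ∪
      {x | ∃ l, l ≠ [] ∧ Alternating p τ F T l ∧ x = (l.map Prod.snd).prod}) := by
    -- Stability of the span under left multiplication suffices: it is applied to `1 = ∑ k, p k` at
    -- the end.
    have hmul : ∀ v ∈ Submodule.span ℂ (Set.range p ∪
        {x | ∃ l, l ≠ [] ∧ Alternating p τ F T l ∧ x = (l.map Prod.snd).prod}),
        x * v ∈ Submodule.span ℂ (Set.range p ∪
        {x | ∃ l, l ≠ [] ∧ Alternating p τ F T l ∧ x = (l.map Prod.snd).prod}) := by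
      induction hx using Algebra.adjoin_induction with
      | mem y hy =>
        obtain ⟨α, hα⟩ := Set.mem_iUnion.1 hy
        exact fun v hv => mul_mem_span h hp hconv hα hv
      | algebraMap r =>
        intro v hv
        rw [← Algebra.smul_def]
        exact Submodule.smul_mem _ _ hv
      | add a b _ _ ha hb =>
        intro v hv
        rw [add_mul]
        exact add_mem (ha v hv) (hb v hv)
      | mul a b _ _ ha hb =>
        intro v hv
        rw [mul_assoc]
        exact ha _ (hb v hv)
    have := hmul 1 (by
      rw [← h.sum_eq_one]
      exact sum_mem fun k _ => Submodule.subset_span (Or.inl ⟨k, rfl⟩))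
    rwa [mul_one] at this
  clear hx
  induction hV using Submodule.span_induction with
  | zero => exact fun k => ⟨0, by rw [mul_zero, map_zero]; exact tendsto_const_nhds⟩
  | add a b _ _ ha hb =>
    intro k
    obtain ⟨c, hc⟩ := ha k
    obtain ⟨c', hc'⟩ := hb k
    exact ⟨c + c', by rw [mul_add, map_add]; exact hc.add hc'⟩
  | smul r a _ ha =>
    intro k
    obtain ⟨c, hc⟩ := ha k
    exact ⟨r * c, by rw [mul_smul_comm, map_smul]; exact hc.const_mul r⟩
  | mem v hv =>
    intro k
    rcases hv with ⟨j, rfl⟩ | ⟨l, hne, hl, rfl⟩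
    · rcases eq_or_ne k j with rfl | hkj
      · exact ⟨ρ k, by rw [h.idem]; exact h.tendsto k⟩
      · exact ⟨0, by rw [h.orth k j hkj, map_zero]; exact tendsto_const_nhds⟩
    · exact ⟨0, Alternating.centered_prod h hp hconv hlib _ l le_rfl hne hl k⟩

end Main

end AsymptoticTrace

end AsymptoticFreeness

/-! ### Sequences of random block matrices -/

/-- Indices of the random matrices: `(s, k, l)` is the index of the matrix `R s k l`. -/
abbrev RandomIndex (d : ℕ) := ℕ × Fin d × Fin d

/-- A size `n`, and a value at the size `n` of the family of random matrices. -/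
structure Config {d : ℕ} (q : ℕ → Fin d → ℕ) : Type u where
  size : ℕ
  val : RandomIndex d → BlockMatrix (q size)

/-- Sequences of block matrices depending on the family of random matrices. -/
abbrev MatrixField {d : ℕ} (q : ℕ → Fin d → ℕ) : Type u :=
  (z : Config.{u} q) → BlockMatrix (q z.size)

section MatrixField

variable {d : ℕ} {q : ℕ → Fin d → ℕ}

/-- The projections onto the blocks. -/
noncomputable def fieldProj (q : ℕ → Fin d → ℕ) (k : Fin d) : MatrixField.{u} q :=
  fun z => blockProj (q z.size) k

/-- The normalized trace of the whole matrix. -/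
noncomputable def fieldTrace (q : ℕ → Fin d → ℕ) : MatrixField.{u} q →ₗ[ℂ] Config.{u} q → ℂ where
  toFun x z := ((∑ l, q z.size l : ℕ) : ℂ)⁻¹ * Matrix.trace (x z)
  map_add' x y := by ext z; simp [mul_add]
  map_smul' c x := by ext z; simp; ring

theorem fieldTrace_apply (x : MatrixField.{u} q) (z : Config.{u} q) :
    fieldTrace q x z = ((∑ l, q z.size l : ℕ) : ℂ)⁻¹ * Matrix.trace (x z) := rfl

theorem fieldTrace_mul_comm (x y : MatrixField.{u} q) :
    fieldTrace q (x * y) = fieldTrace q (y * x) := by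
  ext z
  rw [fieldTrace_apply, fieldTrace_apply, Pi.mul_apply, Matrix.trace_mul_comm, Pi.mul_apply]

theorem trace_blockProj_mul (r : Fin d → ℕ) (k : Fin d) (x : BlockMatrix r) :
    Matrix.trace (blockProj r k * x) = ∑ i, x ⟨k, i⟩ ⟨k, i⟩ := by
  rw [Matrix.trace, Fintype.sum_sigma, Finset.sum_eq_single k]
  · simp [blockProj, Matrix.diagonal_mul]
  · intro l _ hl
    simp [blockProj, Matrix.diagonal_mul, hl]
  · simp

theorem trace_blockProj_mul_eq_blockTrace {r : Fin d → ℕ} (hr : ∀ k, 0 < r k) (k : Fin d)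
    (x : BlockMatrix r) :
    Matrix.trace (blockProj r k * x) = r k * blockTrace r k x := by
  have : (r k : ℂ) ≠ 0 := by exact_mod_cast (hr k).ne'
  rw [trace_blockProj_mul, blockTrace_apply, mul_inv_cancel_left₀ this]

/-- The trace of a diagonal block in terms of its normalization. -/
theorem fieldTrace_proj_mul (hq : ∀ n k, 0 < q n k) (k : Fin d) (x : MatrixField.{u} q)
    (z : Config.{u} q) :
    fieldTrace q (fieldProj q k * x) z =
      ((q z.size k / (∑ l, q z.size l : ℕ) : ℝ) : ℂ) * blockTrace (q z.size) k (x z) := by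
  rw [fieldTrace_apply, Pi.mul_apply, fieldProj, trace_blockProj_mul_eq_blockTrace (hq _)]
  push_cast
  ring

theorem fieldProj_mul_self (hq : ∀ n k, 0 < q n k) (k : Fin d) :
    fieldProj.{u} q k * fieldProj q k = fieldProj q k :=
  funext fun z => (blockMatrixSpace (q z.size) (hq _)).p_mul_self k

theorem fieldProj_orthogonal (hq : ∀ n k, 0 < q n k) (k l : Fin d) (h : k ≠ l) :
    fieldProj.{u} q k * fieldProj q l = 0 :=
  funext fun z => (blockMatrixSpace (q z.size) (hq _)).p_orthogonal k l h

theorem fieldProj_sum (hq : ∀ n k, 0 < q n k) : ∑ k, fieldProj.{u} q k = 1 :=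
  funext fun z => by
    rw [Finset.sum_apply]
    exact (blockMatrixSpace (q z.size) (hq _)).p_sum

theorem fieldProj_star (hq : ∀ n k, 0 < q n k) (k : Fin d) :
    star (fieldProj.{u} q k) = fieldProj q k :=
  funext fun z => (blockMatrixSpace (q z.size) (hq _)).p_star k

end MatrixField

/-! ### Convergence in probability as convergence along a filter -/

section ConfigFilter

variable {d : ℕ} {q : ℕ → Fin d → ℕ} {Ω : ℕ → Type*} [∀ n, MeasurableSpace (Ω n)]
  (P : ∀ n, Measure (Ω n)) (Y : ∀ n, Ω n → RandomIndex d → BlockMatrix (q n))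

/-- The sets of configurations which contain the configuration `(n, Y n ω)` with a probability
tending to `1`. -/
def configFilter : Filter (Config.{u} q) where
  sets := {S | Tendsto (fun n => P n {ω | (⟨n, Y n ω⟩ : Config.{u} q) ∉ S}) atTop (𝓝 0)}
  univ_sets := by simp
  sets_of_superset {S T} hS hST :=
    tendsto_of_tendsto_of_tendsto_of_le_of_le tendsto_const_nhds hS (fun _ => zero_le)
      fun n => measure_mono fun ω hω hω' => hω (hST hω')
  inter_sets {S T} hS hT := by
    have := hS.add hT
    rw [add_zero] at this
    refine tendsto_of_tendsto_of_tendsto_of_le_of_le tendsto_const_nhds this (fun _ => zero_le)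
      fun n => (measure_mono fun ω hω => ?_).trans (measure_union_le _ _)
    by_contra h
    simp only [Set.mem_union, Set.mem_ofPred_eq, not_or, not_not] at h
    exact hω h

theorem mem_configFilter {S : Set (Config.{u} q)} : S ∈ configFilter P Y ↔
    Tendsto (fun n => P n {ω | (⟨n, Y n ω⟩ : Config.{u} q) ∉ S}) atTop (𝓝 0) := Iff.rfl

/-- The event that `f` is at distance at least `ε` from `y` is the complement of a neighbourhood
event. This dictionary gives sums, products and quotients of limits in probability from the usual
calculus of `Tendsto`. -/
theorem tendsto_configFilter {E : Type*} [PseudoMetricSpace E] {f : Config.{u} q → E} {y : E} :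
    Tendsto f (configFilter P Y) (𝓝 y) ↔
      TendstoInProb P (fun n ω => f ⟨n, Y n ω⟩) y := by
  rw [Metric.tendsto_nhds]
  refine forall₂_congr fun ε _ => ?_
  rw [Filter.Eventually, mem_configFilter]
  simp only [Set.mem_ofPred_eq, not_lt]

/-- Used to turn almost sure hermiticity, unitarity and norm bounds into statements along the
filter. -/
theorem eventually_configFilter_of_ae {S : Config.{u} q → Prop}
    (h : ∀ n, ∀ᵐ ω ∂P n, S ⟨n, Y n ω⟩) : ∀ᶠ z in configFilter P Y, S z := by
  rw [Filter.Eventually, mem_configFilter]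
  have : ∀ n, P n {ω | (⟨n, Y n ω⟩ : Config.{u} q) ∉ {z | S z}} = 0 := fun n => h n
  simp only [this]
  exact tendsto_const_nhds

/-- Needed for uniqueness of limits, on which the linearity of the limit traces rests. -/
theorem configFilter_neBot [∀ n, IsProbabilityMeasure (P n)] :
    (configFilter.{u} P Y).NeBot := by
  refine ⟨fun h => ?_⟩
  have : (∅ : Set (Config.{u} q)) ∈ configFilter P Y := by rw [h]; trivial
  rw [mem_configFilter] at this
  simp only [Set.mem_empty_iff_false, not_false_eq_true, Set.ofPred_true, measure_univ] at this
  exact one_ne_zero (tendsto_nhds_unique tendsto_const_nhds this)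

theorem tendsto_size_configFilter :
    Tendsto (Config.size : Config.{u} q → ℕ) (configFilter P Y) atTop := by
  refine tendsto_atTop.2 fun m => ?_
  rw [Filter.Eventually, mem_configFilter]
  refine Tendsto.congr' ?_ tendsto_const_nhds
  filter_upwards [eventually_ge_atTop m] with n hn
  simp [hn]

/-- Chebyshev's criterion. -/
theorem tendsto_configFilter_zero_of_sq [∀ n, IsProbabilityMeasure (P n)] {f : Config.{u} q → ℂ} {b : ℕ → ℝ}
    (hint : ∀ n, Integrable (fun ω => ‖f ⟨n, Y n ω⟩‖ ^ 2) (P n))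
    (hb : ∀ n, ∫ ω, ‖f ⟨n, Y n ω⟩‖ ^ 2 ∂P n ≤ b n) (hlim : Tendsto b atTop (𝓝 0)) :
    Tendsto f (configFilter P Y) (𝓝 0) := by
  rw [tendsto_configFilter]
  intro ε hε
  have h1 : Tendsto (fun n => ENNReal.ofReal (b n / ε ^ 2)) atTop (𝓝 0) := by
    have := ENNReal.tendsto_ofReal (hlim.div_const (ε ^ 2))
    rwa [zero_div, ENNReal.ofReal_zero] at this
  refine tendsto_of_tendsto_of_tendsto_of_le_of_le tendsto_const_nhds h1 (fun _ => zero_le)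
    fun n => ?_
  have h2 := mul_meas_ge_le_integral_of_nonneg
    (Eventually.of_forall fun ω => sq_nonneg ‖f ⟨n, Y n ω⟩‖) (hint n) (ε ^ 2)
  have h3 : {ω | ε ≤ dist (f ⟨n, Y n ω⟩) 0} ⊆ {ω | ε ^ 2 ≤ ‖f ⟨n, Y n ω⟩‖ ^ 2} := by
    intro ω hω
    rw [Set.mem_ofPred_eq, dist_zero_right] at hω
    exact pow_le_pow_left₀ hε.le hω 2
  refine (measure_mono h3).trans ((ENNReal.le_ofReal_iff_toReal_le (measure_ne_top _ _)
    (div_nonneg ((integral_nonneg fun ω => sq_nonneg _).trans (hb n)) (sq_nonneg ε))).2 ?_)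
  rw [le_div_iff₀ (by positivity), mul_comm]
  exact h2.trans (hb n)

end ConfigFilter

/-! ### Bounded measurable matrix fields -/

section NiceAlgebra

open scoped Matrix.Norms.L2Operator

theorem Matrix.norm_entry_le_opNorm {m n : Type*} [Fintype m] [Fintype n] [DecidableEq n]
    (x : Matrix m n ℂ) (i : m) (j : n) : ‖x i j‖ ≤ ‖x‖ := by
  have h := Matrix.l2_opNorm_mulVec x (EuclideanSpace.single j 1)
  rw [PiLp.norm_single, norm_one, mul_one] at h
  refine le_trans ?_ ((PiLp.norm_apply_le _ i).trans h)
  simp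

theorem Matrix.norm_one_le_opNorm {n : Type*} [Fintype n] [DecidableEq n] :
    ‖(1 : Matrix n n ℂ)‖ ≤ 1 := by
  rw [← Matrix.diagonal_one, Matrix.l2_opNorm_diagonal]
  exact (pi_norm_le_iff_of_nonneg zero_le_one).2 fun i => by simp

theorem norm_blockProj_le {d : ℕ} (r : Fin d → ℕ) (k : Fin d) : ‖blockProj r k‖ ≤ 1 := by
  rw [blockProj, Matrix.l2_opNorm_diagonal]
  refine (pi_norm_le_iff_of_nonneg zero_le_one).2 fun i => ?_
  split_ifs <;> simp

theorem Matrix.norm_trace_le_opNorm {n : Type*} [Fintype n] [DecidableEq n] (x : Matrix n n ℂ) :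
    ‖Matrix.trace x‖ ≤ Fintype.card n * ‖x‖ := by
  refine (norm_sum_le _ _).trans ((Finset.sum_le_sum fun i _ =>
    Matrix.norm_entry_le_opNorm x i i).trans ?_)
  simp

theorem Matrix.opNorm_mul_of_mem_unitary {n : Type*} [Fintype n] [DecidableEq n]
    {U : Matrix n n ℂ} (hU : U ∈ Matrix.unitaryGroup n ℂ) (x : Matrix n n ℂ) :
    ‖U * x‖ = ‖x‖ :=
  CStarRing.norm_mem_unitary_mul x hU

theorem Matrix.opNorm_mul_of_unitary_mem {n : Type*} [Fintype n] [DecidableEq n]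
    {U : Matrix n n ℂ} (hU : U ∈ Matrix.unitaryGroup n ℂ) (x : Matrix n n ℂ) :
    ‖x * U‖ = ‖x‖ :=
  CStarRing.norm_mul_mem_unitary x hU

variable {d : ℕ} {q : ℕ → Fin d → ℕ}

/-- The configurations whose values are bounded by `K`. -/
def Config.Bounded (K : ℝ) (z : Config.{u} q) : Prop := ∀ t, ‖z.val t‖ ≤ K

/-- Scalar fields which are measurable, and bounded on the bounded configurations. -/
structure NiceScalar (K : ℝ) (f : Config.{u} q → ℂ) : Prop where
  measurable : ∀ n, Measurable fun v => f ⟨n, v⟩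
  bounded : ∃ C, ∀ z : Config.{u} q, z.Bounded K → ‖f z‖ ≤ C

namespace NiceScalar

variable {K : ℝ} {f g : Config.{u} q → ℂ}

theorem add (hf : NiceScalar K f) (hg : NiceScalar K g) : NiceScalar K (f + g) := by
  obtain ⟨C, hC⟩ := hf.bounded
  obtain ⟨D, hD⟩ := hg.bounded
  exact ⟨fun n => (hf.measurable n).add (hg.measurable n),
    C + D, fun z hz => (norm_add_le _ _).trans (add_le_add (hC z hz) (hD z hz))⟩

theorem mul (hf : NiceScalar K f) (hg : NiceScalar K g) : NiceScalar K (f * g) := by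
  obtain ⟨C, hC⟩ := hf.bounded
  obtain ⟨D, hD⟩ := hg.bounded
  exact ⟨fun n => (hf.measurable n).mul (hg.measurable n),
    C * D, fun z hz => (norm_mul_le _ _).trans
      (mul_le_mul (hC z hz) (hD z hz) (norm_nonneg _) ((norm_nonneg _).trans (hC z hz)))⟩

theorem conj (hf : NiceScalar K f) : NiceScalar K (star f) := by
  obtain ⟨C, hC⟩ := hf.bounded
  exact ⟨fun n => Complex.continuous_conj.measurable.comp (hf.measurable n), C, fun z hz => by
    rw [Pi.star_apply, norm_star]; exact hC z hz⟩

end NiceScalar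

/-- Matrix fields which are measurable, and bounded on the bounded configurations. -/
structure Nice (K : ℝ) (x : MatrixField.{u} q) : Prop where
  measurable : ∀ (n : ℕ) (i j : BlockIndex (q n)), Measurable fun v => x ⟨n, v⟩ i j
  bounded : ∃ C, ∀ z : Config.{u} q, z.Bounded K → ‖x z‖ ≤ C

/-- The algebra of nice matrix fields. -/
noncomputable def niceAlgebra (q : ℕ → Fin d → ℕ) (K : ℝ) : StarSubalgebra ℂ (MatrixField.{u} q) where
  carrier := {x | Nice K x}
  mul_mem' := by
    rintro x y ⟨hx, C, hC⟩ ⟨hy, D, hD⟩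
    refine ⟨fun n i j => ?_, C * D, fun z hz => (norm_mul_le _ _).trans
      (mul_le_mul (hC z hz) (hD z hz) (norm_nonneg _) ((norm_nonneg _).trans (hC z hz)))⟩
    have : Measurable fun v => ∑ l : BlockIndex (q n), x ⟨n, v⟩ i l * y ⟨n, v⟩ l j :=
      Finset.measurable_sum _ fun l _ => (hx n i l).mul (hy n l j)
    exact this
  add_mem' := by
    rintro x y ⟨hx, C, hC⟩ ⟨hy, D, hD⟩
    exact ⟨fun n i j => (hx n i j).add (hy n i j), C + D,
      fun z hz => (norm_add_le _ _).trans (add_le_add (hC z hz) (hD z hz))⟩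
  algebraMap_mem' c := by
    refine ⟨fun n i j => (measurable_const : Measurable fun _ =>
      (algebraMap ℂ (BlockMatrix (q n)) c) i j), ‖c‖, fun z _ => ?_⟩
    rw [Pi.algebraMap_apply, Algebra.algebraMap_eq_smul_one, norm_smul]
    exact mul_le_of_le_one_right (norm_nonneg _) Matrix.norm_one_le_opNorm
  star_mem' := by
    rintro x ⟨hx, C, hC⟩
    refine ⟨fun n i j => Complex.continuous_conj.measurable.comp (hx n j i), C, fun z hz => ?_⟩
    rw [Pi.star_apply, norm_star]
    exact hC z hz

theorem fieldProj_mem_niceAlgebra (K : ℝ) (k : Fin d) :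
    fieldProj q k ∈ niceAlgebra.{u} q K :=
  ⟨fun n i j => (measurable_const : Measurable fun _ => blockProj (q n) k i j), 1, fun _ _ => norm_blockProj_le _ k⟩

theorem norm_fieldTrace_le (x : MatrixField.{u} q) (z : Config.{u} q) :
    ‖fieldTrace q x z‖ ≤ ‖x z‖ := by
  rw [fieldTrace_apply, norm_mul, norm_inv, Complex.norm_natCast]
  have h := Matrix.norm_trace_le_opNorm (x z)
  rw [Fintype.card_sigma] at h
  simp only [Fintype.card_fin] at h
  rcases Nat.eq_zero_or_pos (∑ l, q z.size l) with h0 | h0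
  · simp [h0]
  · rw [inv_mul_le_iff₀ (by exact_mod_cast h0)]
    exact h

theorem Nice.fieldTrace {K : ℝ} {x : MatrixField.{u} q} (hx : Nice K x) :
    NiceScalar K (fieldTrace q x) := by
  obtain ⟨C, hC⟩ := hx.bounded
  refine ⟨fun n => ?_, C, fun z hz => (norm_fieldTrace_le x z).trans (hC z hz)⟩
  have : Measurable fun v : RandomIndex d → BlockMatrix (q n) =>
      ((∑ l, q n l : ℕ) : ℂ)⁻¹ * ∑ i : BlockIndex (q n), x ⟨n, v⟩ i i :=
    (Finset.measurable_sum _ fun i _ => hx.measurable n i i).const_mul _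
  exact this

theorem NiceScalar.integrable {K : ℝ} {f : Config.{u} q → ℂ} (hf : NiceScalar K f)
    {n : ℕ} {Ω : Type*} [MeasurableSpace Ω] {P : Measure Ω} [IsFiniteMeasure P]
    {V : Ω → RandomIndex d → BlockMatrix (q n)} (hV : Measurable V)
    (hb : ∀ᵐ ω ∂P, (⟨n, V ω⟩ : Config.{u} q).Bounded K) :
    Integrable (fun ω => f ⟨n, V ω⟩) P := by
  obtain ⟨C, hC⟩ := hf.bounded
  exact Integrable.of_bound ((hf.measurable n).comp hV).aestronglyMeasurable C
    (hb.mono fun ω hω => hC _ hω)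

end NiceAlgebra

/-! ### Schwinger–Dyson equations -/

section SchwingerDyson

open scoped Matrix.Norms.L2Operator

/-- Measurable functions which are bounded on the bounded families. -/
structure NiceFun {ι M : Type*} [MeasurableSpace M] [Norm M] (K : ℝ) (f : (ι → M) → ℂ) :
    Prop where
  measurable : Measurable f
  bounded : ∃ C, ∀ v, (∀ t, ‖v t‖ ≤ K) → ‖f v‖ ≤ C

namespace NiceFun

variable {ι M : Type*} [MeasurableSpace M] [Norm M] {K : ℝ} {f g : (ι → M) → ℂ}

theorem const (c : ℂ) : NiceFun K fun _ : ι → M => c :=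
  ⟨measurable_const, ‖c‖, fun _ _ => le_rfl⟩

theorem add (hf : NiceFun K f) (hg : NiceFun K g) : NiceFun K fun v => f v + g v := by
  obtain ⟨C, hC⟩ := hf.bounded
  obtain ⟨D, hD⟩ := hg.bounded
  exact ⟨hf.measurable.add hg.measurable,
    C + D, fun z hz => (norm_add_le _ _).trans (add_le_add (hC z hz) (hD z hz))⟩

theorem mul (hf : NiceFun K f) (hg : NiceFun K g) : NiceFun K fun v => f v * g v := by
  obtain ⟨C, hC⟩ := hf.bounded
  obtain ⟨D, hD⟩ := hg.bounded
  exact ⟨hf.measurable.mul hg.measurable,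
    C * D, fun z hz => (norm_mul_le _ _).trans
      (mul_le_mul (hC z hz) (hD z hz) (norm_nonneg _) ((norm_nonneg _).trans (hC z hz)))⟩

theorem sum {α : Type*} (s : Finset α) {f : α → (ι → M) → ℂ} (hf : ∀ a ∈ s, NiceFun K (f a)) :
    NiceFun K fun v => ∑ a ∈ s, f a v := by
  classical
  induction s using Finset.induction_on with
  | empty => simpa using const 0
  | insert a s ha ih =>
    simp only [Finset.sum_insert ha]
    exact (hf a (by simp)).add (ih fun b hb => hf b (by simp [hb]))

theorem listSum {α : Type*} (L : List α) {f : α → (ι → M) → ℂ}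
    (hf : ∀ a ∈ L, NiceFun K (f a)) : NiceFun K fun v => (L.map fun a => f a v).sum := by
  induction L with
  | nil => simpa using const 0
  | cons a L ih =>
    simp only [List.map_cons, List.sum_cons]
    exact (hf a (by simp)).add (ih fun b hb => hf b (by simp [hb]))

theorem integrable (hf : NiceFun K f) {Ω : Type*} [MeasurableSpace Ω] {P : Measure Ω}
    [IsFiniteMeasure P] {V : Ω → ι → M} (hV : Measurable V) (hb : ∀ᵐ ω ∂P, ∀ t, ‖V ω t‖ ≤ K) :
    Integrable (fun ω => f (V ω)) P := by
  obtain ⟨C, hC⟩ := hf.bounded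
  exact Integrable.of_bound (hf.measurable.comp hV).aestronglyMeasurable C
    (hb.mono fun ω hω => hC _ hω)

end NiceFun

variable {d : ℕ} {q : ℕ → Fin d → ℕ}

theorem NiceScalar.niceFun {K : ℝ} {f : Config.{u} q → ℂ} (hf : NiceScalar K f) (n : ℕ) :
    NiceFun K fun v => f ⟨n, v⟩ := by
  obtain ⟨C, hC⟩ := hf.bounded
  exact ⟨hf.measurable n, C, fun v hv => hC ⟨n, v⟩ hv⟩

theorem Nice.niceFun {K : ℝ} {x : MatrixField.{u} q} (hx : Nice K x) (n : ℕ)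
    (i j : BlockIndex (q n)) : NiceFun K fun v => (x ⟨n, v⟩ : BlockMatrix (q n)) i j := by
  obtain ⟨C, hC⟩ := hx.bounded
  exact ⟨hx.measurable n i j, C, fun v hv =>
    (Matrix.norm_entry_le_opNorm _ i j).trans (hC ⟨n, v⟩ hv)⟩

/-- Block diagonal unitary matrices. -/
def blockUnitary (r : Fin d → ℕ) : Set (BlockMatrix r) :=
  {U | U ∈ Matrix.unitaryGroup (BlockIndex r) ℂ ∧ ∀ k, Commute U (blockProj r k)}

/-- Block diagonal antihermitian matrices. -/
def blockSkew (r : Fin d → ℕ) : Set (BlockMatrix r) :=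
  {X | star X = -X ∧ ∀ k, Commute X (blockProj r k)}

theorem exp_mem_blockUnitary {r : Fin d → ℕ} {X : BlockMatrix r} (hX : X ∈ blockSkew r) (t : ℝ) :
    NormedSpace.exp (t • X) ∈ blockUnitary r := by
  let _ : NormedAlgebra ℚ (BlockMatrix r) := NormedAlgebra.restrictScalars ℚ ℂ _
  refine ⟨NormedSpace.exp_mem_unitary_of_mem_skewAdjoint (skewAdjoint.smul_mem t hX.1),
    fun k => ?_⟩
  exact (((hX.2 k).smul_left t).exp_left)

variable {Ω : ℕ → Type*} [∀ n, MeasurableSpace (Ω n)]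

/-- An action of the block diagonal unitary matrices on the values of the family of random
matrices, which preserves the law of the family and the bounded families. -/
structure UnitaryFlow (P : ∀ n, Measure (Ω n)) (Y : ∀ n, Ω n → RandomIndex d → BlockMatrix (q n))
    (K : ℝ) where
  act : ∀ n, BlockMatrix (q n) → (RandomIndex d → BlockMatrix (q n)) →
    RandomIndex d → BlockMatrix (q n)
  measurable : ∀ n U, Measurable (act n U)
  map_eq : ∀ n, ∀ U ∈ blockUnitary (q n),
    (P n).map (fun ω => act n U (Y n ω)) = (P n).map (Y n)
  bounded : ∀ n, ∀ U ∈ blockUnitary (q n), ∀ v : RandomIndex d → BlockMatrix (q n),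
    (∀ t, ‖v t‖ ≤ K) → ∀ t, ‖act n U v t‖ ≤ K

variable {P : ∀ n, Measure (Ω n)} {Y : ∀ n, Ω n → RandomIndex d → BlockMatrix (q n)} {K : ℝ}

/-- The orbit of a configuration under a one parameter group. -/
noncomputable abbrev UnitaryFlow.orbit (γ : UnitaryFlow P Y K) {n : ℕ} (X : BlockMatrix (q n))
    (v : RandomIndex d → BlockMatrix (q n)) (t : ℝ) : Config.{u} q :=
  ⟨n, γ.act n (NormedSpace.exp (t • X)) v⟩

/-- Invariance of the law makes the expectation of `f` constant along the orbit. It may be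
differentiated under the integral because `f'` is bounded on bounded families and the flow preserves
these. -/
theorem UnitaryFlow.integral_eq_zero (γ : UnitaryFlow P Y K) {n : ℕ}
    [IsFiniteMeasure (P n)] (hY : Measurable (Y n)) (hb : ∀ᵐ ω ∂P n, ∀ t, ‖Y n ω t‖ ≤ K)
    {X : BlockMatrix (q n)} (hX : X ∈ blockSkew (q n))
    {f f' : (RandomIndex d → BlockMatrix (q n)) → ℂ} (hf : NiceFun K f) (hf' : NiceFun K f')
    (hd : ∀ v (t : ℝ), HasDerivAt (fun s : ℝ => f (γ.act n (NormedSpace.exp (s • X)) v))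
      (f' (γ.act n (NormedSpace.exp (t • X)) v)) t) :
    ∫ ω, f' (Y n ω) ∂P n = 0 := by
  have hmap : ∀ {g : (RandomIndex d → BlockMatrix (q n)) → ℂ}, Measurable g → ∀ t : ℝ,
      ∫ ω, g (γ.act n (NormedSpace.exp (t • X)) (Y n ω)) ∂P n = ∫ ω, g (Y n ω) ∂P n := by
    intro g hg t
    have h1 := integral_map (μ := P n)
      (φ := fun ω => γ.act n (NormedSpace.exp (t • X)) (Y n ω))
      ((γ.measurable n _).comp hY).aemeasurable (f := g) hg.aestronglyMeasurable
    rw [← h1, γ.map_eq n _ (exp_mem_blockUnitary hX t),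
      integral_map hY.aemeasurable hg.aestronglyMeasurable]
  obtain ⟨C, hC⟩ := hf'.bounded
  have hbt : ∀ᵐ ω ∂P n, ∀ t : ℝ, ∀ i, ‖γ.act n (NormedSpace.exp (t • X)) (Y n ω) i‖ ≤ K :=
    hb.mono fun ω hω t => γ.bounded n _ (exp_mem_blockUnitary hX t) _ hω
  have key := hasDerivAt_integral_of_dominated_loc_of_deriv_le (μ := P n) (s := Set.univ)
    (x₀ := (0 : ℝ)) (bound := fun _ => C)
    (F := fun t ω => f (γ.act n (NormedSpace.exp (t • X)) (Y n ω)))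
    (F' := fun t ω => f' (γ.act n (NormedSpace.exp (t • X)) (Y n ω)))
    univ_mem
    (Eventually.of_forall fun t =>
      (hf.measurable.comp ((γ.measurable n _).comp hY)).aestronglyMeasurable)
    (hf.integrable ((γ.measurable n _).comp hY) (hbt.mono fun ω hω => hω 0))
    (hf'.measurable.comp ((γ.measurable n _).comp hY)).aestronglyMeasurable
    (hbt.mono fun ω hω t _ => hC _ (hω t)) (integrable_const C)
    (Eventually.of_forall fun ω t _ => hd (Y n ω) t)
  have h2 := key.2
  simp only [hmap hf.measurable] at h2
  have h3 := h2.unique (hasDerivAt_const (0 : ℝ) _)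
  rw [← h3, hmap hf'.measurable]

/-- The value `∑ a * X * b` of a tensor `∑ a ⊗ b` at `X`. -/
noncomputable def tensorInsert (L : List (MatrixField.{u} q × MatrixField.{u} q)) (z : Config.{u} q)
    (X : BlockMatrix (q z.size)) : BlockMatrix (q z.size) :=
  (L.map fun ab => ab.1 z * X * ab.2 z).sum

/-- The derivative of `x` along the flow, in the direction `X`, is `∑ a * X * b`, where
`∑ a ⊗ b` is the tensor `L`. -/
def HasFlowDeriv (γ : UnitaryFlow P Y K) (x : MatrixField.{u} q)
    (L : List (MatrixField.{u} q × MatrixField.{u} q)) : Prop :=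
  ∀ (n : ℕ), ∀ X ∈ blockSkew (q n), ∀ (v : RandomIndex d → BlockMatrix (q n)) (t : ℝ),
    HasDerivAt (fun s : ℝ => (x (γ.orbit X v s) : BlockMatrix (q n)))
      (tensorInsert L (γ.orbit X v t) X) t

/-- The gradient of the scalar field `f` along the flow is `g`. -/
def HasFlowGradient (γ : UnitaryFlow P Y K) (f : Config.{u} q → ℂ) (g : MatrixField.{u} q) : Prop :=
  ∀ (n : ℕ), ∀ X ∈ blockSkew (q n), ∀ (v : RandomIndex d → BlockMatrix (q n)) (t : ℝ),
    HasDerivAt (fun s : ℝ => f (γ.orbit X v s))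
      (((∑ l, q n l : ℕ) : ℂ)⁻¹ * Matrix.trace (X * (g (γ.orbit X v t) : BlockMatrix (q n)))) t

/-- Nice matrix fields with a nice derivative. -/
def FlowSmooth (γ : UnitaryFlow P Y K) (x : MatrixField.{u} q) : Prop :=
  x ∈ niceAlgebra q K ∧ ∃ L : List (MatrixField.{u} q × MatrixField.{u} q),
    (∀ ab ∈ L, ab.1 ∈ niceAlgebra q K ∧ ab.2 ∈ niceAlgebra q K) ∧ HasFlowDeriv γ x L

/-- Nice scalar fields with a nice gradient. -/
def FlowSmoothScalar (γ : UnitaryFlow P Y K) (f : Config.{u} q → ℂ) : Prop :=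
  NiceScalar K f ∧ ∃ g ∈ niceAlgebra.{u} q K, HasFlowGradient γ f g

theorem tensorInsert_append (L L' : List (MatrixField.{u} q × MatrixField.{u} q))
    (z : Config.{u} q) (X : BlockMatrix (q z.size)) :
    tensorInsert (L ++ L') z X = tensorInsert L z X + tensorInsert L' z X := by
  simp [tensorInsert]

/-- Leibniz rule for the bimodule structure: `y` multiplies the right leg and `x` the left leg. -/
theorem HasFlowDeriv.mul {γ : UnitaryFlow P Y K} {x y : MatrixField.{u} q}
    {L L' : List (MatrixField.{u} q × MatrixField.{u} q)} (hx : HasFlowDeriv γ x L)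
    (hy : HasFlowDeriv γ y L') :
    HasFlowDeriv γ (x * y) ((L.map fun ab => (ab.1, ab.2 * y)) ++
      L'.map fun ab => (x * ab.1, ab.2)) := by
  intro n X hX v t
  refine ((hx n X hX v t).mul (hy n X hX v t)).congr_deriv ?_
  rw [tensorInsert_append]
  congr 1
  · simp [tensorInsert, List.map_map, Function.comp_def, ← List.sum_map_mul_right, mul_assoc]
  · simp [tensorInsert, List.map_map, Function.comp_def, ← List.sum_map_mul_left, mul_assoc]

theorem HasFlowDeriv.const {γ : UnitaryFlow P Y K} {x : MatrixField.{u} q}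
    (hx : ∀ n, ∀ U ∈ blockUnitary (q n), ∀ v, x ⟨n, γ.act n U v⟩ = (x ⟨n, v⟩ : BlockMatrix (q n))) :
    HasFlowDeriv γ x [] := by
  intro n X hX v t
  have : (fun s : ℝ => (x (γ.orbit X v s) : BlockMatrix (q n))) = fun _ => x ⟨n, v⟩ :=
    funext fun s => hx n _ (exp_mem_blockUnitary hX s) v
  rw [this]
  exact hasDerivAt_const t _

theorem hasDerivAt_exp_smul_matrix {m : Type*} [Fintype m] [DecidableEq m] (X : Matrix m m ℂ)
    (t : ℝ) : HasDerivAt (fun s : ℝ => NormedSpace.exp (s • X)) (X * NormedSpace.exp (t • X)) t :=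
  hasDerivAt_exp_smul_const' X t

theorem star_exp_smul_of_skew {m : Type*} [Fintype m] [DecidableEq m] {X : Matrix m m ℂ}
    (hX : star X = -X) (t : ℝ) :
    star (NormedSpace.exp (t • X)) = NormedSpace.exp (t • (-X)) := by
  rw [NormedSpace.star_exp, star_smul, hX]
  simp

theorem hasDerivAt_star_exp_smul_matrix {m : Type*} [Fintype m] [DecidableEq m]
    {X : Matrix m m ℂ} (hX : star X = -X) (t : ℝ) :
    HasDerivAt (fun s : ℝ => star (NormedSpace.exp (s • X)))
      (-(star (NormedSpace.exp (t • X)) * X)) t := by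
  simp only [star_exp_smul_of_skew hX]
  rw [← mul_neg]
  exact hasDerivAt_exp_smul_const (-X) t

/-- The derivative of `exp (s X) * x` is `X` times the current value, that is, the tensor `1 ⊗ x`.
-/
theorem HasFlowDeriv.of_left {γ : UnitaryFlow P Y K} {x : MatrixField.{u} q}
    (hx : ∀ n, ∀ U ∈ blockUnitary (q n), ∀ v,
      x ⟨n, γ.act n U v⟩ = U * (x ⟨n, v⟩ : BlockMatrix (q n))) :
    HasFlowDeriv γ x [(1, x)] := by
  intro n X hX v t
  have h := fun s => hx n _ (exp_mem_blockUnitary hX s) v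
  have h' : (fun s : ℝ => (x (γ.orbit X v s) : BlockMatrix (q n))) =
      fun s => NormedSpace.exp (s • X) * x ⟨n, v⟩ := funext h
  rw [h']
  refine ((hasDerivAt_exp_smul_matrix X t).mul_const _).congr_deriv ?_
  simp [tensorInsert, h, mul_assoc]

/-- The adjoint of `exp (s X)` contributes `-x * X`, because `X` is antihermitian; together the two
factors give the commutator of `X` and `x`. -/
theorem HasFlowDeriv.of_conj {γ : UnitaryFlow P Y K} {x : MatrixField.{u} q}
    (hx : ∀ n, ∀ U ∈ blockUnitary (q n), ∀ v,
      x ⟨n, γ.act n U v⟩ = U * (x ⟨n, v⟩ : BlockMatrix (q n)) * star U) :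
    HasFlowDeriv γ x [(1, x), (-x, 1)] := by
  intro n X hX v t
  have h := fun s => hx n _ (exp_mem_blockUnitary hX s) v
  have h' : (fun s : ℝ => (x (γ.orbit X v s) : BlockMatrix (q n))) =
      fun s => NormedSpace.exp (s • X) * x ⟨n, v⟩ * star (NormedSpace.exp (s • X)) := funext h
  rw [h']
  refine (((hasDerivAt_exp_smul_matrix X t).mul_const _).mul
    (hasDerivAt_star_exp_smul_matrix hX.1 t)).congr_deriv ?_
  simp [tensorInsert, h, mul_assoc]

end SchwingerDyson

/-! ### Gradients of traces and the Schwinger–Dyson estimate -/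

section SchwingerDyson

open scoped Matrix.Norms.L2Operator

variable {d : ℕ} {q : ℕ → Fin d → ℕ} {Ω : ℕ → Type*} [∀ n, MeasurableSpace (Ω n)]
  {P : ∀ n, Measure (Ω n)} {Y : ∀ n, Ω n → RandomIndex d → BlockMatrix (q n)} {K : ℝ}
  {γ : UnitaryFlow P Y K}

theorem FlowSmooth.mul {x y : MatrixField.{u} q} (hx : FlowSmooth γ x) (hy : FlowSmooth γ y) :
    FlowSmooth γ (x * y) := by
  obtain ⟨hx, L, hL, hxL⟩ := hx
  obtain ⟨hy, L', hL', hyL⟩ := hy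
  refine ⟨mul_mem hx hy, _, ?_, hxL.mul hyL⟩
  intro ab hab
  rcases List.mem_append.1 hab with hab | hab
  · obtain ⟨c, hc, rfl⟩ := List.mem_map.1 hab
    exact ⟨(hL c hc).1, mul_mem (hL c hc).2 hy⟩
  · obtain ⟨c, hc, rfl⟩ := List.mem_map.1 hab
    exact ⟨mul_mem hx (hL' c hc).1, (hL' c hc).2⟩

theorem FlowSmooth.const {x : MatrixField.{u} q} (hx : x ∈ niceAlgebra q K)
    (h : ∀ n, ∀ U ∈ blockUnitary (q n), ∀ v,
      x ⟨n, γ.act n U v⟩ = (x ⟨n, v⟩ : BlockMatrix (q n))) :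
    FlowSmooth γ x :=
  ⟨hx, [], by simp, HasFlowDeriv.const h⟩

theorem FlowSmooth.one : FlowSmooth γ (1 : MatrixField.{u} q) :=
  FlowSmooth.const (one_mem _) fun _ _ _ _ => rfl

theorem FlowSmooth.proj (k : Fin d) : FlowSmooth γ (fieldProj.{u} q k) :=
  FlowSmooth.const (fieldProj_mem_niceAlgebra K k) fun _ _ _ _ => rfl

theorem FlowSmooth.neg {x : MatrixField.{u} q} (hx : FlowSmooth γ x) : FlowSmooth γ (-x) := by
  have h : FlowSmooth γ (-1 : MatrixField.{u} q) :=
    FlowSmooth.const (neg_mem (one_mem _)) fun _ _ _ _ => rfl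
  simpa using h.mul hx

/-- The gradient of the trace of `x`, whose derivative is `∑ a * X * b`, is `∑ b * a`. -/
theorem HasFlowDeriv.gradient_trace {x : MatrixField.{u} q}
    {L : List (MatrixField.{u} q × MatrixField.{u} q)} (h : HasFlowDeriv γ x L) :
    HasFlowGradient γ (fieldTrace q x) (L.map fun ab => ab.2 * ab.1).sum := by
  intro n X hX v t
  let tr : BlockMatrix (q n) →L[ℝ] ℂ :=
    LinearMap.toContinuousLinearMap ((Matrix.traceLinearMap (BlockIndex (q n)) ℝ ℂ))
  have h1 := (tr.hasFDerivAt.comp_hasDerivAt t (h n X hX v t)).const_mul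
    (((∑ l, q n l : ℕ) : ℂ)⁻¹)
  refine h1.congr_deriv ?_
  congr 1
  change Matrix.trace (tensorInsert L (γ.orbit X v t) X) = _
  have h2 : ∀ L : List (MatrixField.{u} q × MatrixField.{u} q),
      Matrix.trace (tensorInsert L (γ.orbit X v t) X) = Matrix.trace (X *
        (((L.map fun ab => ab.2 * ab.1).sum (γ.orbit X v t) : BlockMatrix (q n)))) := by
    intro L
    induction L with
    | nil => simp [tensorInsert]
    | cons ab L ih =>
      rw [tensorInsert] at ih ⊢
      rw [List.map_cons, List.sum_cons, Matrix.trace_add, ih, List.map_cons, List.sum_cons,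
        Pi.add_apply, mul_add, Matrix.trace_add, Pi.mul_apply]
      congr 1
      rw [mul_assoc, Matrix.trace_mul_comm, mul_assoc]
  exact h2 L

theorem FlowSmooth.trace {x : MatrixField.{u} q} (hx : FlowSmooth γ x) :
    FlowSmoothScalar γ (fieldTrace q x) := by
  obtain ⟨hx, L, hL, hxL⟩ := hx
  refine ⟨Nice.fieldTrace hx, _, ?_, hxL.gradient_trace⟩
  exact list_sum_mem fun y hy => by
    obtain ⟨ab, hab, rfl⟩ := List.mem_map.1 hy
    exact mul_mem (hL ab hab).2 (hL ab hab).1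

theorem FlowSmoothScalar.add {f g : Config.{u} q → ℂ} (hf : FlowSmoothScalar γ f)
    (hg : FlowSmoothScalar γ g) : FlowSmoothScalar γ (f + g) := by
  obtain ⟨hf, x, hx, hfx⟩ := hf
  obtain ⟨hg, y, hy, hgy⟩ := hg
  refine ⟨hf.add hg, x + y, add_mem hx hy, fun n X hX v t => ?_⟩
  refine ((hfx n X hX v t).add (hgy n X hX v t)).congr_deriv ?_
  rw [← mul_add, ← Matrix.trace_add, ← mul_add]
  rfl

/-- Multiplication of a matrix field by a scalar field. -/
def fieldSMul (f : Config.{u} q → ℂ) (x : MatrixField.{u} q) : MatrixField.{u} q :=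
  fun z => f z • x z

theorem fieldSMul_mem {f : Config.{u} q → ℂ} {x : MatrixField.{u} q} (hf : NiceScalar K f)
    (hx : x ∈ niceAlgebra q K) : fieldSMul f x ∈ niceAlgebra q K := by
  obtain ⟨C, hC⟩ := hf.bounded
  obtain ⟨D, hD⟩ := hx.bounded
  refine ⟨fun n i j => (hf.measurable n).mul (hx.measurable n i j), C * D, fun z hz => ?_⟩
  rw [fieldSMul, norm_smul]
  exact mul_le_mul (hC z hz) (hD z hz) (norm_nonneg _) ((norm_nonneg _).trans (hC z hz))

theorem FlowSmoothScalar.mul {f g : Config.{u} q → ℂ} (hf : FlowSmoothScalar γ f)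
    (hg : FlowSmoothScalar γ g) : FlowSmoothScalar γ (f * g) := by
  obtain ⟨hf, x, hx, hfx⟩ := hf
  obtain ⟨hg, y, hy, hgy⟩ := hg
  refine ⟨hf.mul hg, fieldSMul g x + fieldSMul f y,
    add_mem (fieldSMul_mem hg hx) (fieldSMul_mem hf hy), fun n X hX v t => ?_⟩
  refine ((hfx n X hX v t).mul (hgy n X hX v t)).congr_deriv ?_
  rw [Pi.add_apply, mul_add, Matrix.trace_add, fieldSMul, fieldSMul, mul_smul_comm, mul_smul_comm,
    Matrix.trace_smul, Matrix.trace_smul, smul_eq_mul, smul_eq_mul]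
  ring

/-- As `star X = -X`, conjugating `Tr (X g)` gives `Tr (X (-star g))`. This makes the conjugate of a
trace polynomial an admissible test function. -/
theorem FlowSmoothScalar.conj {f : Config.{u} q → ℂ} (hf : FlowSmoothScalar γ f) :
    FlowSmoothScalar γ (star f) := by
  obtain ⟨hf, x, hx, hfx⟩ := hf
  refine ⟨hf.conj, -star x, neg_mem (star_mem hx), fun n X hX v t => ?_⟩
  refine (hfx n X hX v t).star.congr_deriv ?_
  have h1 : star (Matrix.trace (X * (x (γ.orbit X v t) : BlockMatrix (q n)))) =
      Matrix.trace (X * (-star (x (γ.orbit X v t)) : BlockMatrix (q n))) := by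
    rw [← Matrix.trace_conjTranspose, ← Matrix.star_eq_conjTranspose, star_mul, hX.1,
      Matrix.trace_mul_comm, neg_mul, mul_neg]
  rw [star_mul', h1]
  simp

theorem FlowSmoothScalar.zero : FlowSmoothScalar γ (0 : Config.{u} q → ℂ) :=
  ⟨⟨fun _ => measurable_const, 0, by simp⟩, 0, zero_mem _, fun n X _ v t => by
    simpa using hasDerivAt_const t (0 : ℂ)⟩

theorem FlowSmoothScalar.tensorTrace (k : Fin d)
    {L : List (MatrixField.{u} q × MatrixField.{u} q)}
    (hL : ∀ ab ∈ L, FlowSmooth γ ab.1 ∧ FlowSmooth γ ab.2) :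
    FlowSmoothScalar γ (tensorTrace (fieldProj q) (fieldTrace q) k L) := by
  induction L with
  | nil => exact FlowSmoothScalar.zero
  | cons ab L ih =>
    have h := hL ab (by simp)
    exact ((((FlowSmooth.proj k).mul h.1).trace).mul (((FlowSmooth.proj k).mul h.2).trace)).add
      (ih fun c hc => hL c (by simp [hc]))

theorem trace_eq_sum_mul {m : Type*} [Fintype m] (X g : Matrix m m ℂ) :
    Matrix.trace (X * g) = ∑ a, ∑ b, X a b * g b a := by
  simp [Matrix.trace, Matrix.mul_apply]

/-- The coefficient of `X a b` in the `(i, j)` entry of `∑ u * X * v`. -/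
theorem tensorInsert_apply (L : List (MatrixField.{u} q × MatrixField.{u} q)) (z : Config.{u} q)
    (X : BlockMatrix (q z.size)) (i j : BlockIndex (q z.size)) :
    tensorInsert L z X i j =
      ∑ a, ∑ b, X a b * (L.map fun uv => uv.1 z i a * uv.2 z b j).sum := by
  induction L with
  | nil => simp [tensorInsert]
  | cons uv L ih =>
    rw [tensorInsert] at ih ⊢
    rw [List.map_cons, List.sum_cons, Matrix.add_apply, ih]
    simp only [List.map_cons, List.sum_cons, mul_add, Finset.sum_add_distrib]
    congr 1
    simp only [Matrix.mul_apply, Finset.sum_mul]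
    rw [Finset.sum_comm]
    exact Finset.sum_congr rfl fun a _ => Finset.sum_congr rfl fun b _ => by ring

theorem sum_single_mul {m : Type*} [Fintype m] [DecidableEq m] (c : m → m → ℂ) (a b : m) :
    ∑ i, ∑ j, Matrix.single a b (1 : ℂ) i j * c i j = c a b := by
  rw [Finset.sum_eq_single a, Finset.sum_eq_single b]
  · simp
  · intro j _ hj
    rw [Matrix.single_apply_of_col_ne _ _ hj.symm, zero_mul]
  · simp
  · intro i _ hi
    exact Finset.sum_eq_zero fun j _ => by
      rw [Matrix.single_apply_of_row_ne hi.symm, zero_mul]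
  · simp

/-- The form is complex linear in `X`, so its values on the two antihermitian directions determine
its value on the matrix unit: after division by `I`, half their sum. -/
theorem coeff_eq_zero_of_single {m : Type*} [Fintype m] [DecidableEq m] {S : Set (Matrix m m ℂ)}
    {c : m → m → ℂ} (h : ∀ X ∈ S, ∑ a, ∑ b, X a b * c a b = 0) (a b : m)
    (h1 : Matrix.single a b 1 - Matrix.single b a 1 ∈ S)
    (h2 : Complex.I • (Matrix.single a b 1 + Matrix.single b a 1) ∈ S) : c a b = 0 := by
  have h1 := h _ h1
  have h2 := h _ h2
  simp only [Matrix.sub_apply, sub_mul, Finset.sum_sub_distrib, sum_single_mul] at h1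
  simp only [Matrix.smul_apply, Matrix.add_apply, smul_eq_mul, mul_assoc, add_mul,
    Finset.sum_add_distrib, ← Finset.mul_sum, sum_single_mul] at h2
  have h3 := (mul_eq_zero.1 h2).resolve_left Complex.I_ne_zero
  linear_combination (h1 + h3) / 2

theorem star_single_one {m : Type*} [DecidableEq m] (a b : m) :
    star (Matrix.single a b (1 : ℂ)) = Matrix.single b a 1 := by
  rw [Matrix.star_eq_conjTranspose, Matrix.conjTranspose_single, star_one]

theorem commute_single_blockProj {r : Fin d → ℕ} (k l : Fin d) (a b : Fin (r k)) :
    Commute (Matrix.single (⟨k, a⟩ : BlockIndex r) ⟨k, b⟩ (1 : ℂ)) (blockProj r l) := by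
  ext i j
  rw [blockProj, Matrix.mul_diagonal, Matrix.diagonal_mul, Matrix.single_apply]
  by_cases h' : (⟨k, a⟩ : BlockIndex r) = i ∧ (⟨k, b⟩ : BlockIndex r) = j
  · rw [← h'.1, ← h'.2, mul_comm]
  · rw [if_neg h', zero_mul, mul_zero]

/-- Both indices must lie in the same block, since only then are the two test directions block
diagonal. -/
theorem coeff_eq_zero_of_skew {r : Fin d → ℕ} {c : BlockIndex r → BlockIndex r → ℂ}
    (h : ∀ X ∈ blockSkew r, ∑ a, ∑ b, X a b * c a b = 0) (k : Fin d) (a b : Fin (r k)) :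
    c ⟨k, a⟩ ⟨k, b⟩ = 0 := by
  refine coeff_eq_zero_of_single h _ _ ⟨?_, fun l => ?_⟩ ⟨?_, fun l => ?_⟩
  · rw [star_sub, star_single_one, star_single_one, neg_sub]
  · exact (commute_single_blockProj k l a b).sub_left (commute_single_blockProj k l b a)
  · rw [star_smul, star_add, star_single_one, star_single_one, Complex.star_def, Complex.conj_I,
      neg_smul, add_comm]
  · exact ((commute_single_blockProj k l a b).add_left
      (commute_single_blockProj k l b a)).smul_left _

theorem sum_list_mul {r : Type*} [Fintype r]
    {α : Type*} (L : List α) (f g : α → r → ℂ) :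
    ∑ a, ∑ b, (L.map fun u => f u a * g u b).sum = (L.map fun u => (∑ a, f u a) * ∑ b, g u b).sum := by
  induction L with
  | nil => simp
  | cons u L ih =>
    simp only [List.map_cons, List.sum_cons, Finset.sum_add_distrib, ih, Finset.sum_mul_sum]

theorem fieldTrace_proj_mul_proj_mul (g x : MatrixField.{u} q) (k : Fin d) (z : Config.{u} q) :
    fieldTrace q (fieldProj q k * g * fieldProj q k * x) z =
      ∑ a, ∑ b, ((∑ l, q z.size l : ℕ) : ℂ)⁻¹ * (g z ⟨k, b⟩ ⟨k, a⟩ * x z ⟨k, a⟩ ⟨k, b⟩) := by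
  have h : ∀ b, (g z * (blockProj (q z.size) k * x z)) ⟨k, b⟩ ⟨k, b⟩ =
      ∑ a, g z ⟨k, b⟩ ⟨k, a⟩ * x z ⟨k, a⟩ ⟨k, b⟩ := by
    intro b
    rw [Matrix.mul_apply, Fintype.sum_sigma, Finset.sum_eq_single k]
    · simp [blockProj, Matrix.diagonal_mul]
    · intro l _ hl
      simp [blockProj, Matrix.diagonal_mul, hl]
    · simp
  rw [fieldTrace_apply, Pi.mul_apply, Pi.mul_apply, Pi.mul_apply, mul_assoc, mul_assoc, fieldProj,
    trace_blockProj_mul, Finset.sum_congr rfl fun b _ => h b, Finset.sum_comm]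
  simp only [Finset.mul_sum]

/-- The two legs are evaluated on independent diagonal indices of block `k`; the square of the total
size undoes the two normalizations, and is the source of the gain in the variance bound. -/
theorem tensorTrace_eq (L : List (MatrixField.{u} q × MatrixField.{u} q)) (k : Fin d)
    (z : Config.{u} q) (hN : ((∑ l, q z.size l : ℕ) : ℂ) ≠ 0) :
    ((∑ l, q z.size l : ℕ) : ℂ) ^ 2 * tensorTrace (fieldProj q) (fieldTrace q) k L z =
      ∑ a, ∑ b, (L.map fun uv => uv.1 z ⟨k, a⟩ ⟨k, a⟩ * uv.2 z ⟨k, b⟩ ⟨k, b⟩).sum := by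
  rw [sum_list_mul L (fun uv a => uv.1 z ⟨k, a⟩ ⟨k, a⟩) (fun uv b => uv.2 z ⟨k, b⟩ ⟨k, b⟩)]
  induction L with
  | nil => simp [tensorTrace]
  | cons uv L ih =>
    rw [tensorTrace] at ih ⊢
    rw [List.map_cons, List.sum_cons, Pi.add_apply, mul_add, ih, List.map_cons, List.sum_cons,
      Pi.mul_apply, fieldTrace_apply, fieldTrace_apply, Pi.mul_apply, Pi.mul_apply, fieldProj,
      trace_blockProj_mul, trace_blockProj_mul]
    congr 1
    field_simp

theorem HasFlowDeriv.entry {x : MatrixField.{u} q}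
    {L : List (MatrixField.{u} q × MatrixField.{u} q)} (hd : HasFlowDeriv γ x L) {n : ℕ}
    {X : BlockMatrix (q n)} (hX : X ∈ blockSkew (q n)) (v : RandomIndex d → BlockMatrix (q n))
    (t : ℝ) (i j : BlockIndex (q n)) :
    HasDerivAt (fun s : ℝ => (x (γ.orbit X v s) : BlockMatrix (q n)) i j)
      ((tensorInsert L (γ.orbit X v t) X : BlockMatrix (q n)) i j) t := by
  let e : BlockMatrix (q n) →L[ℝ] ℂ :=
    LinearMap.toContinuousLinearMap (Matrix.entryLinearMap ℝ ℂ i j)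
  exact e.hasFDerivAt.comp_hasDerivAt t (hd n X hX v t)

/-- The Schwinger–Dyson equation, tested against a scalar field. -/
theorem HasFlowDeriv.integral_eq {n : ℕ} [IsFiniteMeasure (P n)] (hY : Measurable (Y n))
    (hb : ∀ᵐ ω ∂P n, ∀ t, ‖Y n ω t‖ ≤ K) (hN : ((∑ l, q n l : ℕ) : ℂ) ≠ 0)
    {x : MatrixField.{u} q} {L : List (MatrixField.{u} q × MatrixField.{u} q)}
    (hx : x ∈ niceAlgebra q K) (hL : ∀ ab ∈ L, ab.1 ∈ niceAlgebra q K ∧ ab.2 ∈ niceAlgebra q K)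
    (hd : HasFlowDeriv γ x L) {f : Config.{u} q → ℂ} {g : MatrixField.{u} q}
    (hf : NiceScalar K f) (hg : g ∈ niceAlgebra q K) (hfg : HasFlowGradient γ f g) (k : Fin d) :
    ∫ ω, ((∑ l, q n l : ℕ) : ℂ) ^ 2 *
        (f ⟨n, Y n ω⟩ * tensorTrace (fieldProj q) (fieldTrace q) k L ⟨n, Y n ω⟩) +
      fieldTrace q (fieldProj q k * g * fieldProj q k * x) ⟨n, Y n ω⟩ ∂P n = 0 := by
  set N : ℂ := ((∑ l, q n l : ℕ) : ℂ) with hNdef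
  -- Coefficient of `X a b` in the derivative of `f * x i j`: the first summand comes from the
  -- gradient of `f`, the second from the derivative of `x`.
  let Ψ (a b i j : BlockIndex (q n)) (v : RandomIndex d → BlockMatrix (q n)) : ℂ :=
    N⁻¹ * ((g ⟨n, v⟩ : BlockMatrix (q n)) b a * (x ⟨n, v⟩ : BlockMatrix (q n)) i j) +
      f ⟨n, v⟩ * (L.map fun uv => (uv.1 ⟨n, v⟩ : BlockMatrix (q n)) i a *
        (uv.2 ⟨n, v⟩ : BlockMatrix (q n)) b j).sum
  have hΨ : ∀ a b i j, NiceFun K (Ψ a b i j) := fun a b i j =>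
    ((NiceFun.const _).mul ((hg.niceFun n b a).mul (hx.niceFun n i j))).add
      ((hf.niceFun n).mul (NiceFun.listSum L fun uv huv =>
        ((hL uv huv).1.niceFun n i a).mul ((hL uv huv).2.niceFun n b j)))
  have hzero : ∀ i j, ∀ X ∈ blockSkew (q n),
      ∑ a, ∑ b, X a b * ∫ ω, Ψ a b i j (Y n ω) ∂P n = 0 := by
    intro i j X hX
    have h1 := γ.integral_eq_zero hY hb hX ((hf.niceFun n).mul (hx.niceFun n i j))
      (f' := fun v => ∑ a, ∑ b, X a b * Ψ a b i j v)
      (NiceFun.sum _ fun a _ => NiceFun.sum _ fun b _ => (NiceFun.const _).mul (hΨ a b i j))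
      (fun v t => by
        refine ((hfg n X hX v t).mul (hd.entry hX v t i j)).congr_deriv ?_
        rw [trace_eq_sum_mul]
        have h2 := tensorInsert_apply L (γ.orbit X v t) X i j
        simp only [Ψ, mul_add, Finset.sum_add_distrib, Finset.sum_mul, Finset.mul_sum, h2]
        congr 1
        · exact Finset.sum_congr rfl fun a _ => Finset.sum_congr rfl fun b _ => by ring
        · exact Finset.sum_congr rfl fun a _ => Finset.sum_congr rfl fun b _ => by ring)
    rw [integral_finsetSum _ fun a _ => ?_] at h1
    · rw [← h1]
      refine Finset.sum_congr rfl fun a _ => ?_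
      rw [integral_finsetSum _ fun b _ => ?_]
      · exact Finset.sum_congr rfl fun b _ => (integral_const_mul _ _).symm
      · exact ((hΨ a b i j).integrable hY hb).const_mul _
    · exact integrable_finsetSum _ fun b _ => ((hΨ a b i j).integrable hY hb).const_mul _
  -- The differentiated entry is chosen equal to the direction `(a, b)`. Each term of the tensor
  -- then becomes a product of the diagonal entries `u a a` and `v b b`, so that the sum over `a`
  -- and `b` factors into two block traces.
  have hcoef := fun a b => coeff_eq_zero_of_skew (hzero ⟨k, a⟩ ⟨k, b⟩) k a b
  have hsum : ∫ ω, ∑ a, ∑ b, Ψ ⟨k, a⟩ ⟨k, b⟩ ⟨k, a⟩ ⟨k, b⟩ (Y n ω) ∂P n = 0 := by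
    rw [integral_finsetSum _ fun a _ => ?_]
    · refine Finset.sum_eq_zero fun a _ => ?_
      rw [integral_finsetSum _ fun b _ => ?_]
      · exact Finset.sum_eq_zero fun b _ => hcoef a b
      · exact (hΨ _ _ _ _).integrable hY hb
    · exact integrable_finsetSum _ fun b _ => (hΨ _ _ _ _).integrable hY hb
  rw [← hsum]
  refine integral_congr_ae (Eventually.of_forall fun ω => ?_)
  have h3 := tensorTrace_eq L k (⟨n, Y n ω⟩ : Config.{u} q) hN
  have h4 := fieldTrace_proj_mul_proj_mul g x k (⟨n, Y n ω⟩ : Config.{u} q)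
  beta_reduce
  rw [h4, mul_left_comm, h3]
  simp only [Ψ, Finset.sum_add_distrib, Finset.mul_sum]
  rw [add_comm]

/-- The Schwinger–Dyson equation. -/
theorem HasFlowDeriv.tendsto_tensorTrace [∀ n, IsProbabilityMeasure (P n)]
    (hY : ∀ n, Measurable (Y n)) (hb : ∀ n, ∀ᵐ ω ∂P n, ∀ t, ‖Y n ω t‖ ≤ K)
    (hN : Tendsto (fun n => ∑ l, q n l) atTop atTop) (hN0 : ∀ n, 0 < ∑ l, q n l)
    {x : MatrixField.{u} q} {L : List (MatrixField.{u} q × MatrixField.{u} q)}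
    (hx : x ∈ niceAlgebra q K) (hL : ∀ ab ∈ L, FlowSmooth γ ab.1 ∧ FlowSmooth γ ab.2)
    (hd : HasFlowDeriv γ x L) (k : Fin d) :
    Tendsto (tensorTrace (fieldProj q) (fieldTrace q) k L) (configFilter P Y) (𝓝 0) := by
  set Z := tensorTrace (fieldProj q) (fieldTrace q) k L with hZ
  have hZs : FlowSmoothScalar γ Z := FlowSmoothScalar.tensorTrace k hL
  -- The test function is the conjugate of the quantity to be estimated, which turns the first term
  -- of the equation into a second moment.
  obtain ⟨hf, g, hg, hfg⟩ := hZs.conj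
  have hB : Nice K (fieldProj q k * g * fieldProj q k * x) :=
    mul_mem (mul_mem (mul_mem (fieldProj_mem_niceAlgebra K k) hg) (fieldProj_mem_niceAlgebra K k)) hx
  obtain ⟨C, hC⟩ := hB.bounded
  have hsq : NiceScalar K (star Z * Z) := hf.mul hZs.1
  have hpt : ∀ z, (star Z * Z) z = ((‖Z z‖ ^ 2 : ℝ) : ℂ) := by
    intro z
    rw [Pi.mul_apply, Pi.star_apply, Complex.star_def, ← Complex.normSq_eq_conj_mul_self,
      Complex.normSq_eq_norm_sq]
  have hint : ∀ n, Integrable (fun ω => (star Z * Z) (⟨n, Y n ω⟩ : Config.{u} q)) (P n) :=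
    fun n => hsq.integrable (hY n) (hb n)
  have hint' : ∀ n, Integrable (fun ω => ‖Z (⟨n, Y n ω⟩ : Config.{u} q)‖ ^ 2) (P n) := by
    intro n
    have := (hint n).re
    refine this.congr (Eventually.of_forall fun ω => ?_)
    beta_reduce
    rw [hpt]
    exact RCLike.ofReal_re (K := ℂ) _
  -- The constant `C` bounds `p k * g * p k * x` on bounded configurations, so the equation bounds
  -- `N²` times the second moment by `C`.
  refine tendsto_configFilter_zero_of_sq P Y (b := fun n => C / ((∑ l, q n l : ℕ) : ℝ) ^ 2)
    hint' (fun n => ?_) ?_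
  · have hN1 : (0 : ℝ) < ((∑ l, q n l : ℕ) : ℝ) := by exact_mod_cast hN0 n
    have hN2 : ((∑ l, q n l : ℕ) : ℂ) ≠ 0 := by exact_mod_cast (hN0 n).ne'
    have h1 : ∫ ω, ((∑ l, q n l : ℕ) : ℂ) ^ 2 * (star Z * Z) (⟨n, Y n ω⟩ : Config.{u} q) +
        fieldTrace q (fieldProj q k * g * fieldProj q k * x) ⟨n, Y n ω⟩ ∂P n = 0 :=
      HasFlowDeriv.integral_eq (hY n) (hb n) hN2 hx
      (fun ab hab => ⟨(hL ab hab).1.1, (hL ab hab).2.1⟩) hd hf hg hfg k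
    rw [integral_add ((hint n).const_mul _) (hB.fieldTrace.integrable (hY n) (hb n)),
      integral_const_mul] at h1
    have h2 : ∫ ω, (star Z * Z) (⟨n, Y n ω⟩ : Config.{u} q) ∂P n =
        ((∫ ω, ‖Z (⟨n, Y n ω⟩ : Config.{u} q)‖ ^ 2 ∂P n : ℝ) : ℂ) := by
      rw [← integral_complex_ofReal]
      congr 1
      exact funext fun ω => hpt _
    have h3 : ‖∫ ω, fieldTrace q (fieldProj q k * g * fieldProj q k * x)
        (⟨n, Y n ω⟩ : Config.{u} q) ∂P n‖ ≤ C := by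
      have h5 : ∀ᵐ ω ∂P n, ‖fieldTrace q (fieldProj q k * g * fieldProj q k * x)
          (⟨n, Y n ω⟩ : Config.{u} q)‖ ≤ C := by
        filter_upwards [hb n] with ω hω
        exact (norm_fieldTrace_le _ _).trans (hC ⟨n, Y n ω⟩ hω)
      refine (norm_integral_le_of_norm_le_const h5).trans ?_
      rw [probReal_univ, mul_one]
    rw [h2] at h1
    have h4 := congrArg norm (eq_neg_of_add_eq_zero_left h1)
    rw [norm_neg, norm_mul, norm_pow, Complex.norm_natCast, Complex.norm_real,
      Real.norm_of_nonneg (integral_nonneg fun ω => sq_nonneg _)] at h4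
    rw [le_div_iff₀ (by positivity), mul_comm, h4]
    exact h3
  · have h5 : Tendsto (fun n => ((∑ l, q n l : ℕ) : ℝ) ^ 2) atTop atTop :=
      (tendsto_pow_atTop two_ne_zero).comp (tendsto_natCast_atTop_atTop.comp hN)
    exact h5.const_div_atTop C

end SchwingerDyson

/-! ### Block embeddings -/

section BlockEmbedding

variable {d : ℕ} (r : Fin d → ℕ)

/-- The isometric embedding of the `k`-th block. -/
def blockEmb (k : Fin d) : Matrix (BlockIndex r) (Fin (r k)) ℂ :=
  Matrix.of fun x i => if x = ⟨k, i⟩ then 1 else 0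

theorem blockEmb_conjTranspose_mul (k : Fin d) : (blockEmb r k).conjTranspose * blockEmb r k = 1 := by
  ext i j
  rw [Matrix.mul_apply, Finset.sum_eq_single ⟨k, i⟩]
  · simp [blockEmb, Matrix.one_apply]
  · intro x _ hx
    simp [blockEmb, hx]
  · simp

theorem blockEmb_mul_conjTranspose (k : Fin d) :
    blockEmb r k * (blockEmb r k).conjTranspose = blockProj r k := by
  ext x y
  rw [Matrix.mul_apply, blockProj, Matrix.diagonal_apply]
  by_cases hx : x.1 = k
  · obtain ⟨l, i⟩ := x
    subst hx
    rw [Finset.sum_eq_single i]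
    · by_cases hy : (⟨l, i⟩ : BlockIndex r) = y
      · subst hy; simp [blockEmb]
      · simp [blockEmb, hy, Ne.symm hy]
    · intro j _ hj
      simp [blockEmb, hj.symm]
    · simp
  · rw [Finset.sum_eq_zero fun i _ => ?_]
    · simp [hx]
    · have : x ≠ ⟨k, i⟩ := fun h => hx (by rw [h])
      simp [blockEmb, this]

theorem blockExt_eq {q : Fin d → ℕ} {k l : Fin d} (M : Matrix (Fin (q k)) (Fin (q l)) ℂ) :
    blockExt M = blockEmb q k * M * (blockEmb q l).conjTranspose := by
  ext x y
  simp only [blockExt, Matrix.sum_apply, Matrix.single_apply, Matrix.mul_apply, Finset.sum_mul]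
  rw [Finset.sum_comm]
  refine Finset.sum_congr rfl fun j _ => Finset.sum_congr rfl fun i _ => ?_
  rcases eq_or_ne x ⟨k, i⟩ with hx | hx <;> rcases eq_or_ne y ⟨l, j⟩ with hy | hy
  · simp [blockEmb, hx, hy]
  · simp [blockEmb, hy, hy.symm]
  · simp [blockEmb, hx, hx.symm]
  · simp [blockEmb, hx, hx.symm]

variable {r}

theorem blockProj_mul_blockEmb (k : Fin d) : blockProj r k * blockEmb r k = blockEmb r k := by
  rw [← blockEmb_mul_conjTranspose, Matrix.mul_assoc, blockEmb_conjTranspose_mul, Matrix.mul_one]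

/-- The restriction of a matrix to the `k`-th block. -/
def blockRestrict (U : BlockMatrix r) (k : Fin d) : Matrix (Fin (r k)) (Fin (r k)) ℂ :=
  (blockEmb r k).conjTranspose * U * blockEmb r k

/-- Commuting with the projection means preserving the range of the embedding; the action of `U`
there is its restriction to the block. -/
theorem mul_blockEmb {U : BlockMatrix r} {k : Fin d} (hU : Commute U (blockProj r k)) :
    U * blockEmb r k = blockEmb r k * blockRestrict U k := by
  rw [blockRestrict, ← Matrix.mul_assoc, ← Matrix.mul_assoc, blockEmb_mul_conjTranspose, ← hU.eq,
    Matrix.mul_assoc, blockProj_mul_blockEmb]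

theorem blockRestrict_mem_unitaryGroup {U : BlockMatrix r} (hU : U ∈ blockUnitary r) (k : Fin d) :
    blockRestrict U k ∈ Matrix.unitaryGroup (Fin (r k)) ℂ := by
  rw [Matrix.mem_unitaryGroup_iff', Matrix.star_eq_conjTranspose]
  have h1 := Matrix.mem_unitaryGroup_iff'.1 hU.1
  rw [Matrix.star_eq_conjTranspose] at h1
  calc (blockRestrict U k).conjTranspose * blockRestrict U k
      = (blockRestrict U k).conjTranspose * ((blockEmb r k).conjTranspose * blockEmb r k) *
          blockRestrict U k := by
        rw [blockEmb_conjTranspose_mul, Matrix.mul_one]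
    _ = (U * blockEmb r k).conjTranspose * (U * blockEmb r k) := by
        rw [mul_blockEmb (hU.2 k), Matrix.conjTranspose_mul]
        simp only [Matrix.mul_assoc]
    _ = 1 := by
        rw [Matrix.conjTranspose_mul, Matrix.mul_assoc, ← Matrix.mul_assoc U.conjTranspose, h1,
          Matrix.one_mul, blockEmb_conjTranspose_mul]

theorem mul_blockExt {U : BlockMatrix r} (hU : U ∈ blockUnitary r) {k l : Fin d}
    (M : Matrix (Fin (r k)) (Fin (r l)) ℂ) :
    U * blockExt M = blockExt (blockRestrict U k * M) := by
  rw [blockExt_eq, blockExt_eq, ← Matrix.mul_assoc, ← Matrix.mul_assoc, mul_blockEmb (hU.2 k),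
    ← Matrix.mul_assoc]

theorem blockExt_mul_star {U : BlockMatrix r} (hU : U ∈ blockUnitary r) {k l : Fin d}
    (M : Matrix (Fin (r k)) (Fin (r l)) ℂ) :
    blockExt M * star U = blockExt (M * star (blockRestrict U l)) := by
  rw [blockExt_eq, blockExt_eq, Matrix.star_eq_conjTranspose, Matrix.star_eq_conjTranspose,
    Matrix.mul_assoc, ← Matrix.conjTranspose_mul, mul_blockEmb (hU.2 l), Matrix.conjTranspose_mul]
  simp only [Matrix.mul_assoc]

theorem blockProj_mul_blockExt_mul {k l : Fin d} (M : Matrix (Fin (r k)) (Fin (r l)) ℂ) :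
    blockProj r k * blockExt M * blockProj r l = blockExt M := by
  have h : (blockEmb r l).conjTranspose * blockProj r l = (blockEmb r l).conjTranspose := by
    rw [← blockEmb_mul_conjTranspose, ← Matrix.mul_assoc, blockEmb_conjTranspose_mul,
      Matrix.one_mul]
  rw [blockExt_eq, ← Matrix.mul_assoc, ← Matrix.mul_assoc, blockProj_mul_blockEmb,
    Matrix.mul_assoc _ _ (blockProj r l), h]

open scoped Matrix.Norms.L2Operator in
theorem norm_blockEmb_le (k : Fin d) : ‖blockEmb r k‖ ≤ 1 := by
  have h := Matrix.l2_opNorm_conjTranspose_mul_self (blockEmb r k)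
  rw [blockEmb_conjTranspose_mul] at h
  have h1 := Matrix.norm_one_le_opNorm (n := Fin (r k))
  rw [h] at h1
  nlinarith [norm_nonneg (blockEmb r k)]

open scoped Matrix.Norms.L2Operator in
theorem opNorm_eq_norm {m n : ℕ} (M : Matrix (Fin m) (Fin n) ℂ) : opNorm M = ‖M‖ := rfl

open scoped Matrix.Norms.L2Operator in
theorem norm_blockExt_le {k l : Fin d} (M : Matrix (Fin (r k)) (Fin (r l)) ℂ) :
    ‖blockExt M‖ ≤ opNorm M := by
  rw [blockExt_eq, opNorm_eq_norm]
  have h1 := norm_blockEmb_le (r := r) k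
  have h2 := norm_blockEmb_le (r := r) l
  rw [← Matrix.l2_opNorm_conjTranspose] at h2
  calc ‖blockEmb r k * M * (blockEmb r l).conjTranspose‖
      ≤ ‖blockEmb r k * M‖ * ‖(blockEmb r l).conjTranspose‖ := Matrix.l2_opNorm_mul _ _
    _ ≤ ‖blockEmb r k * M‖ := mul_le_of_le_one_right (norm_nonneg _) h2
    _ ≤ ‖blockEmb r k‖ * ‖M‖ := Matrix.l2_opNorm_mul _ _
    _ ≤ ‖M‖ := mul_le_of_le_one_left (norm_nonneg _) h1

end BlockEmbedding

/-! ### Measurability of matrix operations -/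

section MeasurableMatrix

variable {α m n l : Type*} [MeasurableSpace α]

theorem measurable_matrix_iff {f : α → Matrix m n ℂ} :
    Measurable f ↔ ∀ i j, Measurable fun x => f x i j :=
  measurable_pi_iff.trans (forall_congr' fun _ => measurable_pi_iff)

theorem Measurable.matrix_mul [Fintype n] {f : α → Matrix m n ℂ} {g : α → Matrix n l ℂ}
    (hf : Measurable f) (hg : Measurable g) : Measurable fun x => f x * g x := by
  rw [measurable_matrix_iff] at *
  intro i j
  simp only [Matrix.mul_apply]
  exact Finset.measurable_sum _ fun k _ => (hf i k).mul (hg k j)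

theorem Measurable.matrix_conjTranspose {f : α → Matrix m n ℂ} (hf : Measurable f) :
    Measurable fun x => (f x).conjTranspose := by
  rw [measurable_matrix_iff] at *
  exact fun i j => Complex.continuous_conj.measurable.comp (hf j i)

theorem Measurable.blockExt {d : ℕ} {r : Fin d → ℕ} {k k' : Fin d}
    {f : α → Matrix (Fin (r k)) (Fin (r k')) ℂ} (hf : Measurable f) :
    Measurable fun x => blockExt (f x) := by
  simp only [blockExt_eq]
  exact (measurable_const.matrix_mul hf).matrix_mul measurable_const

end MeasurableMatrix

/-! ### Uniform unitary matrices -/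

section UniformUnitary

variable {Ω : Type*} [MeasurableSpace Ω] {P : Measure Ω} [IsProbabilityMeasure P] {p : ℕ}
  {R : Ω → Matrix (Fin p) (Fin p) ℂ}

/-- The law of a uniform unitary matrix is invariant under adjunction. -/
theorem UniformUnitary.map_star (hR : Measurable R) (h : UniformUnitary P R) :
    P.map (fun ω => star (R ω)) = P.map R := by
  set μ := P.map R with hμ
  have hμp : IsProbabilityMeasure μ := Measure.isProbabilityMeasure_map hR.aemeasurable
  have hstar : Measurable fun x : Matrix (Fin p) (Fin p) ℂ => star x :=
    measurable_id.matrix_conjTranspose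
  have hmul : ∀ V : Matrix (Fin p) (Fin p) ℂ, Measurable fun x => V * x :=
    fun V => measurable_const.matrix_mul measurable_id
  have hμU : ∀ᵐ x ∂μ, x ∈ Matrix.unitaryGroup (Fin p) ℂ := by
    have hm : MeasurableSet {x : Matrix (Fin p) (Fin p) ℂ | x ∈ Matrix.unitaryGroup (Fin p) ℂ} := by
      have e : {x : Matrix (Fin p) (Fin p) ℂ | x ∈ Matrix.unitaryGroup (Fin p) ℂ} =
          ⋂ i, ⋂ j, {x | (star x * x) i j = (1 : Matrix (Fin p) (Fin p) ℂ) i j} := by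
        ext x
        simp only [Set.mem_ofPred_eq, Set.mem_iInter, Matrix.mem_unitaryGroup_iff']
        exact Matrix.ext_iff.symm
      rw [e]
      exact MeasurableSet.iInter fun i => MeasurableSet.iInter fun j => measurableSet_eq_fun
        (measurable_matrix_iff.1 (hstar.matrix_mul measurable_id) i j) measurable_const
    exact (ae_map_iff hR.aemeasurable hm).2 h.1
  have hleft : ∀ U ∈ Matrix.unitaryGroup (Fin p) ℂ, μ.map (fun x => U * x) = μ := by
    intro U hU
    rw [hμ, Measure.map_map (hmul U) hR]
    exact h.2 U hU
  -- the law of `star x * y` under `μ ⊗ μ` is `μ`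
  have hmeas : Measurable fun z : Matrix (Fin p) (Fin p) ℂ × Matrix (Fin p) (Fin p) ℂ =>
      star z.1 * z.2 := (hstar.comp measurable_fst).matrix_mul measurable_snd
  have h1 : (μ.prod μ).map (fun z => star z.1 * z.2) = μ := by
    ext s hs
    rw [Measure.map_apply hmeas hs, Measure.prod_apply (hmeas hs)]
    have : ∀ᵐ x ∂μ, μ (Prod.mk x ⁻¹' ((fun z : Matrix (Fin p) (Fin p) ℂ × Matrix (Fin p) (Fin p) ℂ =>
        star z.1 * z.2) ⁻¹' s)) = μ s := by
      filter_upwards [hμU] with x hx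
      conv_rhs => rw [← hleft (star x) (Unitary.star_mem hx)]
      rw [Measure.map_apply (hmul _) hs]
      rfl
    rw [lintegral_congr_ae this]
    simp
  -- Taking the adjoint exchanges the two independent copies, and the product measure is symmetric.
  have h2 : (μ.prod μ).map (fun z => star (star z.1 * z.2)) = μ := by
    have e : (fun z : Matrix (Fin p) (Fin p) ℂ × Matrix (Fin p) (Fin p) ℂ =>
        star (star z.1 * z.2)) = (fun z => star z.1 * z.2) ∘ Prod.swap := by
      funext z
      simp
    rw [e, ← Measure.map_map hmeas measurable_swap, Measure.prod_swap, h1]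
  rw [← Function.comp_def, ← Measure.map_map hstar hR]
  conv_lhs => rw [← hμ, ← h1]
  rw [Measure.map_map hstar hmeas]
  exact h2

/-- Right multiplication by `star U` is left multiplication by `U` seen through the adjoint.
Invariance under adjunction therefore upgrades left invariance to right invariance, hence to
conjugation invariance. -/
theorem UniformUnitary.unitarilyInvariant (hR : Measurable R) (h : UniformUnitary P R) :
    UnitarilyInvariant P R := by
  intro U hU
  have hstar : Measurable fun x : Matrix (Fin p) (Fin p) ℂ => star x :=
    measurable_id.matrix_conjTranspose
  have hmul : ∀ V : Matrix (Fin p) (Fin p) ℂ, Measurable fun x => V * x :=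
    fun V => measurable_const.matrix_mul measurable_id
  have h1 : P.map (fun ω => R ω * star U) = P.map R := by
    have e : (fun ω => R ω * star U) =
        (fun x => star x) ∘ (fun x => U * x) ∘ (fun x => star x) ∘ R := by
      funext ω
      simp
    rw [e, ← Measure.map_map hstar ((hmul U).comp (hstar.comp hR)),
      ← Measure.map_map (hmul U) (hstar.comp hR)]
    have e1 : P.map ((fun x => star x) ∘ R) = P.map R := h.map_star hR
    rw [e1, Measure.map_map (hmul U) hR]
    have e2 : P.map ((fun x => U * x) ∘ R) = P.map R := h.2 U hU
    rw [e2, Measure.map_map hstar hR, e1]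
  have e : (fun ω => U * R ω * star U) = (fun x => U * x) ∘ fun ω => R ω * star U := by
    funext ω
    simp [mul_assoc]
  rw [e, ← Measure.map_map (hmul U) (hR.matrix_mul measurable_const), h1,
    Measure.map_map (hmul U) hR]
  exact h.2 U hU

end UniformUnitary

/-! ### The flows -/

section Flows

/-- Changing one variable of an independent family, without changing its law, does not change
the law of the family. -/
theorem ProbabilityTheory.iIndepFun.map_update_eq {Ω ι M : Type*} [DecidableEq ι]
    [MeasurableSpace Ω] [MeasurableSpace M] {P : Measure Ω} [IsProbabilityMeasure P]
    {X : ι → Ω → M} (h : iIndepFun X P) (hX : ∀ i, Measurable (X i)) (t : ι) {g : M → M}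
    (hg : Measurable g) (hmap : P.map (fun ω => g (X t ω)) = P.map (X t)) :
    P.map (fun ω => Function.update (fun i => X i ω) t (g (X t ω))) = P.map (fun ω i => X i ω) := by
  -- The update acts coordinate by coordinate, so the modified family is still independent. Both
  -- joint laws are products of marginals, which only need comparing at `t`.
  let G : ι → M → M := Function.update (fun _ => id) t g
  have hG : ∀ i, Measurable (G i) := by
    intro i
    rcases eq_or_ne i t with rfl | hi
    · simpa [G] using hg
    · simpa [G, hi] using measurable_id
  have e : (fun ω => Function.update (fun i => X i ω) t (g (X t ω))) =
      fun ω i => (G i ∘ X i) ω := by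
    funext ω i
    rcases eq_or_ne i t with rfl | hi
    · simp [G]
    · simp [G, hi]
  rw [e, (h.comp G hG).map_fun_eq_infinitePi_map fun i => (hG i).comp (hX i),
    h.map_fun_eq_infinitePi_map hX]
  congr 1
  funext i
  rcases eq_or_ne i t with rfl | hi
  · have : G i ∘ X i = fun ω => g (X i ω) := by funext ω; simp [G]
    rw [this, hmap]
  · have : G i ∘ X i = X i := by funext ω; simp [G, hi]
    rw [this]

variable {d : ℕ} {q : ℕ → Fin d → ℕ} {Ω : ℕ → Type*} [∀ n, MeasurableSpace (Ω n)]
  {P : ∀ n, Measure (Ω n)} {Y : ∀ n, Ω n → RandomIndex d → BlockMatrix (q n)} {K : ℝ}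

theorem measurable_update_apply {M ι : Type*} [MeasurableSpace M] [DecidableEq ι] (t : ι)
    {g : M → M} (hg : Measurable g) :
    Measurable fun v : ι → M => Function.update v t (g (v t)) := by
  refine measurable_pi_iff.2 fun i => ?_
  rcases eq_or_ne i t with rfl | hi
  · simp only [Function.update_self]
    exact hg.comp (measurable_pi_apply i)
  · simpa [hi] using measurable_pi_apply i

/-- The conjugation of the matrix of index `t`. -/
noncomputable def conjFlow (t : RandomIndex d)
    (h : ∀ n, ∀ U ∈ blockUnitary (q n),
      (P n).map (fun ω => Function.update (Y n ω) t (U * Y n ω t * star U)) = (P n).map (Y n)) :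
    UnitaryFlow P Y K where
  act n U v := Function.update v t (U * v t * star U)
  measurable n U := measurable_update_apply t
    ((measurable_const.matrix_mul measurable_id).matrix_mul measurable_const)
  map_eq := h
  bounded n U hU v hv t' := by
    rcases eq_or_ne t' t with rfl | ht
    · rw [Function.update_self, Matrix.opNorm_mul_of_unitary_mem (Unitary.star_mem hU.1),
        Matrix.opNorm_mul_of_mem_unitary hU.1]
      exact hv t'
    · rw [Function.update_of_ne ht]
      exact hv t'

/-- The left multiplication of the matrix of index `t`. -/
noncomputable def leftFlow (t : RandomIndex d)
    (h : ∀ n, ∀ U ∈ blockUnitary (q n),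
      (P n).map (fun ω => Function.update (Y n ω) t (U * Y n ω t)) = (P n).map (Y n)) :
    UnitaryFlow P Y K where
  act n U v := Function.update v t (U * v t)
  measurable n U := measurable_update_apply t (measurable_const.matrix_mul measurable_id)
  map_eq := h
  bounded n U hU v hv t' := by
    rcases eq_or_ne t' t with rfl | ht
    · rw [Function.update_self, Matrix.opNorm_mul_of_mem_unitary hU.1]
      exact hv t'
    · rw [Function.update_of_ne ht]
      exact hv t'

variable (γ : UnitaryFlow P Y K)

/-- The matrix fields which are conjugated by the flow. -/
def conjAlgebra : StarSubalgebra ℂ (MatrixField.{u} q) where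
  carrier := {x | ∀ n, ∀ U ∈ blockUnitary (q n), ∀ v,
    x ⟨n, γ.act n U v⟩ = U * (x ⟨n, v⟩ : BlockMatrix (q n)) * star U}
  mul_mem' := by
    intro x y hx hy n U hU v
    have h1 : star U * U = 1 := Matrix.mem_unitaryGroup_iff'.1 hU.1
    change (x ⟨n, γ.act n U v⟩ * y ⟨n, γ.act n U v⟩ : BlockMatrix (q n)) =
      U * (x ⟨n, v⟩ * y ⟨n, v⟩ : BlockMatrix (q n)) * star U
    rw [hx n U hU v, hy n U hU v]
    calc U * (x ⟨n, v⟩ : BlockMatrix (q n)) * star U * (U * y ⟨n, v⟩ * star U)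
        = U * (x ⟨n, v⟩ : BlockMatrix (q n)) * (star U * U) * (y ⟨n, v⟩ * star U) := by
          simp only [mul_assoc]
      _ = _ := by rw [h1, mul_one]; simp only [mul_assoc]
  add_mem' := by
    intro x y hx hy n U hU v
    change (x ⟨n, γ.act n U v⟩ + y ⟨n, γ.act n U v⟩ : BlockMatrix (q n)) =
      U * (x ⟨n, v⟩ + y ⟨n, v⟩ : BlockMatrix (q n)) * star U
    rw [hx n U hU v, hy n U hU v, mul_add, add_mul]
  algebraMap_mem' := by
    intro c n U hU v
    have h1 : U * star U = 1 := Matrix.mem_unitaryGroup_iff.1 hU.1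
    change algebraMap ℂ (BlockMatrix (q n)) c = U * algebraMap ℂ (BlockMatrix (q n)) c * star U
    rw [← Algebra.commutes, mul_assoc, h1, mul_one]
  star_mem' := by
    intro x hx n U hU v
    change star (x ⟨n, γ.act n U v⟩ : BlockMatrix (q n)) =
      U * star (x ⟨n, v⟩ : BlockMatrix (q n)) * star U
    rw [hx n U hU v, star_mul, star_mul, star_star, mul_assoc]

/-- The matrix fields which are invariant under the flow. -/
def fixedAlgebra : StarSubalgebra ℂ (MatrixField.{u} q) where
  carrier := {x | ∀ n, ∀ U ∈ blockUnitary (q n), ∀ v,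
    x ⟨n, γ.act n U v⟩ = (x ⟨n, v⟩ : BlockMatrix (q n))}
  mul_mem' := by
    intro x y hx hy n U hU v
    change (x ⟨n, γ.act n U v⟩ * y ⟨n, γ.act n U v⟩ : BlockMatrix (q n)) =
      (x ⟨n, v⟩ * y ⟨n, v⟩ : BlockMatrix (q n))
    rw [hx n U hU v, hy n U hU v]
  add_mem' := by
    intro x y hx hy n U hU v
    change (x ⟨n, γ.act n U v⟩ + y ⟨n, γ.act n U v⟩ : BlockMatrix (q n)) =
      (x ⟨n, v⟩ + y ⟨n, v⟩ : BlockMatrix (q n))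
    rw [hx n U hU v, hy n U hU v]
  algebraMap_mem' := fun c n U hU v => rfl
  star_mem' := by
    intro x hx n U hU v
    change star (x ⟨n, γ.act n U v⟩ : BlockMatrix (q n)) = star (x ⟨n, v⟩ : BlockMatrix (q n))
    rw [hx n U hU v]

variable {γ}

theorem fieldProj_mem_conjAlgebra (k : Fin d) : fieldProj.{u} q k ∈ conjAlgebra γ := by
  intro n U hU v
  change blockProj (q n) k = U * blockProj (q n) k * star U
  rw [(hU.2 k).eq, mul_assoc, Matrix.mem_unitaryGroup_iff.1 hU.1, mul_one]

theorem fieldProj_mem_fixedAlgebra (k : Fin d) : fieldProj.{u} q k ∈ fixedAlgebra γ :=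
  fun _ _ _ _ => rfl

/-- The random matrix of index `t`. -/
noncomputable def randomField (q : ℕ → Fin d → ℕ) (t : RandomIndex d) : MatrixField.{u} q :=
  fun z => blockProj (q z.size) t.2.1 * z.val t * blockProj (q z.size) t.2.2

theorem randomField_mem_niceAlgebra (K : ℝ) (t : RandomIndex d) :
    randomField q t ∈ niceAlgebra.{u} q K := by
  have h : (fun z => z.val t : MatrixField.{u} q) ∈ niceAlgebra.{u} q K := by
    refine ⟨fun n i j => ?_, K, fun z hz => hz t⟩
    exact measurable_matrix_iff.1 (measurable_pi_apply (X := fun _ : RandomIndex d =>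
      BlockMatrix (q n)) t) i j
  exact mul_mem (mul_mem (fieldProj_mem_niceAlgebra K _) h) (fieldProj_mem_niceAlgebra K _)

/-- The compression built into `randomField` puts it in its corner at every configuration, not only
at those reached by the family. It is compatible with the flow since block diagonal unitaries
commute with the projections. -/
theorem randomField_mem_conjAlgebra {t : RandomIndex d} {h} :
    randomField.{u} q t ∈ conjAlgebra (conjFlow (P := P) (Y := Y) (K := K) t h) := by
  intro n U hU v
  have h1 : (fun z => z.val t : MatrixField.{u} q) ∈
      conjAlgebra (conjFlow (P := P) (Y := Y) (K := K) t h) := by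
    intro n U hU v
    exact Function.update_self (β := fun _ => BlockMatrix (q n)) _ _ _
  exact mul_mem (mul_mem (fieldProj_mem_conjAlgebra t.2.1) h1)
    (fieldProj_mem_conjAlgebra t.2.2) n U hU v

theorem randomField_mem_fixedAlgebra {s t : RandomIndex d} (hst : s ≠ t) {h} :
    randomField.{u} q s ∈ fixedAlgebra (conjFlow (P := P) (Y := Y) (K := K) t h) := by
  intro n U hU v
  have h1 : Function.update v t (U * v t * star U) s = v s := Function.update_of_ne hst _ _
  change _ * Function.update v t (U * v t * star U) s * _ = _
  rw [h1]
  rfl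

theorem leftFlow_randomField {t : RandomIndex d} {h} {n : ℕ} {U : BlockMatrix (q n)}
    (hU : U ∈ blockUnitary (q n)) (v : RandomIndex d → BlockMatrix (q n)) :
    randomField.{u} q t ⟨n, (leftFlow (P := P) (Y := Y) (K := K) t h).act n U v⟩ =
      U * (randomField.{u} q t ⟨n, v⟩ : BlockMatrix (q n)) := by
  change _ * Function.update v t (U * v t) t * _ = U * (_ * _ * _)
  rw [Function.update_self]
  simp only [← mul_assoc]
  rw [(hU.2 _).eq]

/-- The derivative of a product along a flow which conjugates the factors of index `t` and
fixes the other ones. -/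
theorem tendsto_liberationTerms {κ : Type*} [∀ n, IsProbabilityMeasure (P n)]
    (hY : ∀ n, Measurable (Y n))
    (hb : ∀ n, ∀ᵐ ω ∂P n, (⟨n, Y n ω⟩ : Config.{u} q).Bounded K)
    (hN : Tendsto (fun n => ∑ l, q n l) atTop atTop) (hN0 : ∀ n, 0 < ∑ l, q n l)
    {T : Option κ → Subalgebra ℂ (MatrixField.{u} q)} {t : κ}
    (hnice : ∀ α, ∀ x ∈ T α, x ∈ niceAlgebra q K)
    (hconj : ∀ x ∈ T (some t), x ∈ conjAlgebra γ)
    (hfix : ∀ α, α ≠ some t → ∀ x ∈ T α, x ∈ fixedAlgebra γ) (k : Fin d)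
    (l : List (Option κ × MatrixField.{u} q)) (hl : ∀ y ∈ l, y.2 ∈ T y.1) :
    Tendsto (tensorTrace (fieldProj q) (fieldTrace q) k (liberationTerms t l))
      (configFilter P Y) (𝓝 0) := by
  classical
  have hd : ∀ α, ∀ x ∈ T α, HasFlowDeriv γ x (if α = some t then [(1, x), (-x, 1)] else []) := by
    intro α x hx
    by_cases hα : α = some t
    · rw [if_pos hα]
      exact HasFlowDeriv.of_conj (hconj x (hα ▸ hx))
    · rw [if_neg hα]
      exact HasFlowDeriv.const (hfix α hα x hx)
  have hs : ∀ α, ∀ x ∈ T α, FlowSmooth γ x := by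
    intro α x hx
    refine ⟨hnice α x hx, _, fun ab hab => ?_, hd α x hx⟩
    by_cases hα : α = some t
    · rw [if_pos hα] at hab
      rcases List.mem_pair.1 hab with rfl | rfl
      · exact ⟨one_mem _, hnice α x hx⟩
      · exact ⟨neg_mem (hnice α x hx), one_mem _⟩
    · rw [if_neg hα] at hab
      simp at hab
  -- The Leibniz rule reproduces the recursion of `liberationTerms`. Smoothness of both legs is
  -- carried along because the Schwinger–Dyson estimate differentiates the scalar field that they
  -- form.
  have key : FlowSmooth γ (l.map Prod.snd).prod ∧
      HasFlowDeriv γ (l.map Prod.snd).prod (liberationTerms t l) ∧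
      ∀ ab ∈ liberationTerms t l, FlowSmooth γ ab.1 ∧ FlowSmooth γ ab.2 := by
    induction l with
    | nil => exact ⟨FlowSmooth.one, HasFlowDeriv.const fun _ _ _ _ => rfl, by simp [liberationTerms]⟩
    | cons y l ih =>
      obtain ⟨h1, h2, h3⟩ := ih fun z hz => hl z (List.mem_cons_of_mem _ hz)
      have hy := hl y (by simp)
      refine ⟨(hs _ _ hy).mul h1, ?_, ?_⟩
      · have h4 := (hd _ _ hy).mul h2
        rw [liberationTerms]
        by_cases hα : y.1 = some t
        · simpa [hα] using h4
        · simpa [hα] using h4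
      · intro ab hab
        rw [liberationTerms, List.mem_append] at hab
        rcases hab with hab | hab
        · by_cases hα : y.1 = some t
          · rw [if_pos hα] at hab
            rcases List.mem_pair.1 hab with rfl | rfl
            · exact ⟨FlowSmooth.one, (hs _ _ hy).mul h1⟩
            · exact ⟨(hs _ _ hy).neg, h1⟩
          · rw [if_neg hα] at hab
            simp at hab
        · obtain ⟨c, hc, rfl⟩ := List.mem_map.1 hab
          exact ⟨(hs _ _ hy).mul (h3 c hc).1, (h3 c hc).2⟩
  exact key.2.1.tendsto_tensorTrace hY hb hN hN0 key.1.1 key.2.2 k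

end Flows

/-! ### Moments of the spectral and singular laws -/

section Moments

theorem Matrix.trace_eq_trace_toEuclideanLin {m : Type*} [Fintype m] [DecidableEq m]
    (A : Matrix m m ℂ) : A.trace = LinearMap.trace ℂ _ (Matrix.toEuclideanLin A) := by
  rw [LinearMap.trace_eq_sum_inner _ (EuclideanSpace.basisFun m ℂ), Matrix.trace]
  refine Finset.sum_congr rfl fun i _ => ?_
  simp [EuclideanSpace.inner_single_left, Matrix.toLpLin_apply]

theorem Matrix.toEuclideanLin_mul_apply {l m n : Type*} [Fintype l] [Fintype m] [Fintype n]
    [DecidableEq m] [DecidableEq n] (A : Matrix l m ℂ) (B : Matrix m n ℂ)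
    (x : EuclideanSpace ℂ n) :
    Matrix.toEuclideanLin (A * B) x = Matrix.toEuclideanLin A (Matrix.toEuclideanLin B x) := by
  simp [Matrix.toLpLin_apply]

theorem Matrix.trace_pow_eq_sum {m ι : Type*} [Fintype m] [DecidableEq m] [Fintype ι]
    {A : Matrix m m ℂ} (b : OrthonormalBasis ι ℂ (EuclideanSpace ℂ m)) {μ : ι → ℝ}
    (h : ∀ i, Matrix.toEuclideanLin A (b i) = (μ i : ℂ) • b i) (j : ℕ) :
    (A ^ j).trace = ((∑ i, μ i ^ j : ℝ) : ℂ) := by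
  have hj : ∀ i, Matrix.toEuclideanLin (A ^ j) (b i) = ((μ i : ℂ) ^ j) • b i := by
    intro i
    induction j with
    | zero => simp
    | succ j ih =>
      rw [pow_succ, Matrix.toEuclideanLin_mul_apply, h, map_smul, ih, smul_smul, pow_succ, mul_comm]
  rw [Matrix.trace_eq_trace_toEuclideanLin, LinearMap.trace_eq_sum_inner _ b]
  push_cast
  refine Finset.sum_congr rfl fun i _ => ?_
  rw [hj, inner_smul_right, inner_self_eq_norm_sq_to_K, b.norm_eq_one]
  simp

open scoped Matrix.Norms.L2Operator in
theorem Matrix.abs_le_opNorm_of_eigenvector {m ι : Type*} [Fintype m] [DecidableEq m] [Fintype ι]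
    {A : Matrix m m ℂ} (b : OrthonormalBasis ι ℂ (EuclideanSpace ℂ m)) {i : ι} {μ : ℝ}
    (h : Matrix.toEuclideanLin A (b i) = (μ : ℂ) • b i) : |μ| ≤ ‖A‖ := by
  have h1 := Matrix.l2_opNorm_mulVec A (b i)
  have h2 : ‖Matrix.toEuclideanLin A (b i)‖ = |μ| := by
    rw [h, norm_smul, b.norm_eq_one, mul_one, Complex.norm_real, Real.norm_eq_abs]
  rw [b.norm_eq_one, mul_one] at h1
  rw [← h2]
  exact h1

theorem integral_empiricalLaw {m : ℕ} (x : Fin m → ℝ) (f : ℝ → ℝ) :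
    ∫ y, f y ∂(empiricalLaw x) = (m : ℝ)⁻¹ * ∑ i, f (x i) := by
  rw [empiricalLaw, integral_smul_measure, integral_finsetSum_measure fun i _ => ?_]
  · simp only [integral_dirac, smul_eq_mul]
    congr 1
    simp
  · exact integrable_dirac (by simp)

/-- The polynomial `x ^ j`, truncated at `K` and `-K`. -/
noncomputable def truncatedPow (K : ℝ) (hK : 0 ≤ K) (j : ℕ) : BoundedContinuousFunction ℝ ℝ :=
  BoundedContinuousFunction.ofNormedAddCommGroup (fun x => (max (-K) (min K x)) ^ j) (by fun_prop)
    (K ^ j) fun x => by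
      rw [norm_pow, Real.norm_eq_abs]
      exact pow_le_pow_left₀ (abs_nonneg _) (abs_le.2 ⟨le_max_left _ _,
        max_le (by linarith) (min_le_left _ _)⟩) j

theorem truncatedPow_apply {K : ℝ} (hK : 0 ≤ K) (j : ℕ) {x : ℝ} (hx : |x| ≤ K) :
    truncatedPow K hK j x = x ^ j := by
  obtain ⟨h1, h2⟩ := abs_le.1 hx
  change (max (-K) (min K x)) ^ j = x ^ j
  rw [min_eq_right h2, max_eq_right h1]

/-- Moments of the spectral law. -/
theorem trace_pow_eq_integral_spectralLaw {p : ℕ} {M : Matrix (Fin p) (Fin p) ℂ}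
    (hM : M.IsHermitian) {K : ℝ} (hK : 0 ≤ K) (hMK : opNorm M ≤ K) (j : ℕ) :
    (M ^ j).trace = ((p * ∫ x, truncatedPow K hK j x ∂(spectralLaw M) : ℝ) : ℂ) := by
  have h : ∀ i, Matrix.toEuclideanLin M (hM.eigenvectorBasis i) =
      (hM.eigenvalues i : ℂ) • hM.eigenvectorBasis i := by
    intro i
    ext x
    have := congrFun (hM.mulVec_eigenvectorBasis i) x
    simpa [Matrix.toLpLin_apply] using this
  have hle : ∀ i, |hM.eigenvalues i| ≤ K := fun i =>
    (Matrix.abs_le_opNorm_of_eigenvector _ (h i)).trans (by rw [← opNorm_eq_norm]; exact hMK)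
  rw [Matrix.trace_pow_eq_sum _ h, spectralLaw, dif_pos hM,
    integral_empiricalLaw]
  congr 1
  rcases Nat.eq_zero_or_pos p with rfl | hp
  · simp
  · rw [mul_inv_cancel_left₀ (by exact_mod_cast hp.ne')]
    exact Finset.sum_congr rfl fun i _ => (truncatedPow_apply hK j (hle i)).symm

/-- Moments of the singular law. -/
theorem trace_pow_eq_integral_singularLaw {p q : ℕ} (M : Matrix (Fin p) (Fin q) ℂ)
    {K : ℝ} (hK : 0 ≤ K) (hMK : opNorm M ≤ K) (j : ℕ) :
    ((M.conjTranspose * M) ^ (j + 1)).trace =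
      ((((min p q : ℕ) : ℝ) * ∫ x, truncatedPow K hK (2 * (j + 1)) x ∂(singularLaw M) : ℝ) : ℂ) := by
  set T := Matrix.toEuclideanLin M with hT
  have hfin : Module.finrank ℂ (EuclideanSpace ℂ (Fin q)) = q := by simp
  have hS := T.isSymmetric_adjoint_comp_self
  have hcomp : Matrix.toEuclideanLin (M.conjTranspose * M) = LinearMap.adjoint T ∘ₗ T := by
    ext1 x
    rw [Matrix.toEuclideanLin_mul_apply, Matrix.toEuclideanLin_conjTranspose_eq_adjoint]
    rfl
  have h : ∀ i, Matrix.toEuclideanLin (M.conjTranspose * M) (hS.eigenvectorBasis hfin i) =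
      ((T.singularValues i ^ 2 : ℝ) : ℂ) • hS.eigenvectorBasis hfin i := by
    intro i
    rw [hcomp, T.sq_singularValues_fin hfin i]
    exact hS.apply_eigenvectorBasis hfin i
  have hle : ∀ i : Fin q, |T.singularValues i| ≤ K := by
    intro i
    have h1 := Matrix.abs_le_opNorm_of_eigenvector _ (h i)
    rw [Matrix.l2_opNorm_conjTranspose_mul_self, ← opNorm_eq_norm, abs_pow] at h1
    have h2 : 0 ≤ opNorm M := norm_nonneg _
    have h3 : |T.singularValues i| ≤ opNorm M := by
      refine le_of_sq_le_sq ?_ h2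
      rw [sq (opNorm M)]
      exact h1
    exact h3.trans hMK
  have hrank : Module.finrank ℂ (LinearMap.range T) ≤ p := by
    have := Submodule.finrank_le (LinearMap.range T)
    simpa using this
  rw [Matrix.trace_pow_eq_sum _ h, singularLaw,
    integral_empiricalLaw]
  congr 1
  -- The matrix `M^* M` has `q` eigenvalues, while the singular law has `min p q` atoms. The missing
  -- singular values vanish by the rank bound, and the exponent `j + 1` is positive, so they
  -- contribute nothing.
  have hsum : ∑ i : Fin q, (T.singularValues i ^ 2) ^ (j + 1) =
      ∑ i : Fin (min p q), truncatedPow K hK (2 * (j + 1)) (T.singularValues i) := by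
    have h1 : ∀ i : Fin (min p q), truncatedPow K hK (2 * (j + 1)) (T.singularValues i) =
        (T.singularValues i ^ 2) ^ (j + 1) := fun i => by
      rw [truncatedPow_apply hK _ (hle ⟨i, i.2.trans_le (min_le_right _ _)⟩), pow_mul]
    rw [Finset.sum_congr rfl fun i _ => h1 i,
      Fin.sum_univ_eq_sum_range (fun i => (T.singularValues i ^ 2) ^ (j + 1)) q,
      Fin.sum_univ_eq_sum_range (fun i => (T.singularValues i ^ 2) ^ (j + 1)) (min p q)]
    symm
    refine Finset.sum_subset (Finset.range_subset_range.2 (min_le_right _ _)) fun i hi hi' => ?_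
    rw [Finset.mem_range] at hi hi'
    have h2 : T.singularValues i = 0 :=
      T.singularValues_eq_zero_iff_le_finrank_range.2 (by omega)
    rw [h2]
    simp
  rw [hsum]
  rcases Nat.eq_zero_or_pos (min p q) with hp | hp
  · rw [Finset.sum_eq_zero]
    · simp
    · intro i
      exact absurd i.2 (by omega)
  · rw [mul_inv_cancel_left₀ (by exact_mod_cast hp.ne')]

end Moments

/-! ### Products, adjoints and traces of extensions of blocks -/

section BlockAlgebra

variable {d : ℕ} {r : Fin d → ℕ}

theorem blockExt_mul {k l m : Fin d} (A : Matrix (Fin (r k)) (Fin (r l)) ℂ)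
    (B : Matrix (Fin (r l)) (Fin (r m)) ℂ) : blockExt A * blockExt B = blockExt (A * B) := by
  simp only [blockExt_eq, Matrix.mul_assoc]
  rw [← Matrix.mul_assoc (blockEmb r l).conjTranspose, blockEmb_conjTranspose_mul, Matrix.one_mul]

theorem star_blockExt {k l : Fin d} (A : Matrix (Fin (r k)) (Fin (r l)) ℂ) :
    star (blockExt A) = blockExt A.conjTranspose := by
  rw [blockExt_eq, blockExt_eq, Matrix.star_eq_conjTranspose, Matrix.conjTranspose_mul,
    Matrix.conjTranspose_mul, Matrix.conjTranspose_conjTranspose, Matrix.mul_assoc]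

theorem blockExt_pow {k : Fin d} (A : Matrix (Fin (r k)) (Fin (r k)) ℂ) (j : ℕ) :
    blockExt A ^ (j + 1) = blockExt (A ^ (j + 1)) := by
  induction j with
  | zero => simp
  | succ j ih => rw [pow_succ, ih, blockExt_mul, ← pow_succ]

theorem trace_blockExt {k : Fin d} (A : Matrix (Fin (r k)) (Fin (r k)) ℂ) :
    (blockExt A).trace = A.trace := by
  rw [blockExt_eq, Matrix.trace_mul_comm, ← Matrix.mul_assoc, blockEmb_conjTranspose_mul,
    Matrix.one_mul]

theorem blockExt_one (k : Fin d) :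
    blockExt (1 : Matrix (Fin (r k)) (Fin (r k)) ℂ) = blockProj r k := by
  rw [blockExt_eq, Matrix.mul_one, blockEmb_mul_conjTranspose]

theorem blockEmb_conjTranspose_mul_blockExt_mul {k l : Fin d}
    (A : Matrix (Fin (r k)) (Fin (r l)) ℂ) :
    (blockEmb r k).conjTranspose * blockExt A * blockEmb r l = A := by
  rw [blockExt_eq, ← Matrix.mul_assoc, ← Matrix.mul_assoc, blockEmb_conjTranspose_mul,
    Matrix.one_mul, Matrix.mul_assoc, blockEmb_conjTranspose_mul, Matrix.mul_one]

end BlockAlgebra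

/-! ### Convergence of the marginal distributions -/

section Marginals

variable {d : ℕ} {q : ℕ → Fin d → ℕ}

/-- The block of index `(k, l)` of the matrix of index `(s, k, l)`. -/
noncomputable def configBlock (t : RandomIndex d) (z : Config.{u} q) :
    Matrix (Fin (q z.size t.2.1)) (Fin (q z.size t.2.2)) ℂ :=
  (blockEmb (q z.size) t.2.1).conjTranspose * z.val t * blockEmb (q z.size) t.2.2

theorem randomField_eq_blockExt (t : RandomIndex d) (z : Config.{u} q) :
    randomField q t z = blockExt (configBlock t z) := by
  rw [randomField, configBlock, blockExt_eq, ← blockEmb_mul_conjTranspose,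
    ← blockEmb_mul_conjTranspose]
  simp only [Matrix.mul_assoc]

theorem randomField_corner (t : RandomIndex d) :
    fieldProj q t.2.1 * randomField.{u} q t * fieldProj q t.2.2 = randomField q t := by
  funext z
  rw [Pi.mul_apply, Pi.mul_apply, randomField_eq_blockExt]
  exact blockProj_mul_blockExt_mul _

variable {Ω : ℕ → Type*}
  {R : ∀ n, ℕ → ∀ k l : Fin d, Ω n → Matrix (Fin (q n k)) (Fin (q n l)) ℂ}

/-- The family of random matrices, seen as block matrices. -/
noncomputable def blockFamily (R : ∀ n, ℕ → ∀ k l : Fin d, Ω n → Matrix (Fin (q n k)) (Fin (q n l)) ℂ)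
    (n : ℕ) (ω : Ω n) (t : RandomIndex d) : BlockMatrix (q n) :=
  blockExt (R n t.1 t.2.1 t.2.2 ω)

theorem configBlock_blockFamily (t : RandomIndex d) (n : ℕ) (ω : Ω n) :
    configBlock t (⟨n, blockFamily R n ω⟩ : Config.{u} q) = R n t.1 t.2.1 t.2.2 ω :=
  blockEmb_conjTranspose_mul_blockExt_mul _

theorem randomField_blockFamily (t : RandomIndex d) (n : ℕ) (ω : Ω n) :
    randomField q t (⟨n, blockFamily R n ω⟩ : Config.{u} q) = blockExt (R n t.1 t.2.1 t.2.2 ω) := by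
  rw [randomField_eq_blockExt, configBlock_blockFamily]

variable [∀ n, MeasurableSpace (Ω n)] {P : ∀ n, Measure (Ω n)}

theorem fieldTrace_eq_of_blockExt {x : MatrixField.{u} q} {z : Config.{u} q} {k : Fin d}
    {A : Matrix (Fin (q z.size k)) (Fin (q z.size k)) ℂ} (h : x z = blockExt A) :
    fieldTrace q x z = ((∑ l, q z.size l : ℕ) : ℂ)⁻¹ * A.trace := by
  rw [fieldTrace_apply, h, trace_blockExt]

theorem exists_tendsto_ratio_mul {F : Filter (Config.{u} q)} {a b : Config.{u} q → ℝ}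
    {f : Config.{u} q → ℂ} {α β : ℝ} (ha : Tendsto a F (𝓝 α)) (hb : Tendsto b F (𝓝 β))
    (h : ∀ᶠ z in F, f z = ((a z * b z : ℝ) : ℂ)) : ∃ c, Tendsto f F (𝓝 c) :=
  ⟨_, Tendsto.congr' (h.mono fun _ h => h.symm)
    ((Complex.continuous_ofReal.tendsto _).comp (ha.mul hb))⟩

variable {ρ : Fin d → ℝ} {K : ℝ}

theorem tendsto_ratio (Y : ∀ n, Ω n → RandomIndex d → BlockMatrix (q n))
    (hq_lim : ∀ k, Tendsto (fun n => (q n k : ℝ) / ((∑ l, q n l : ℕ) : ℝ)) atTop (𝓝 (ρ k)))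
    (k : Fin d) :
    Tendsto (fun z : Config.{u} q => (q z.size k : ℝ) / ((∑ l, q z.size l : ℕ) : ℝ))
      (configFilter P Y) (𝓝 (ρ k)) :=
  (hq_lim k).comp (tendsto_size_configFilter P Y)

/-- Moments of a bi-unitarily invariant matrix. -/
theorem exists_tendsto_trace_star_mul_pow (hK : 0 ≤ K)
    (hq_lim : ∀ k, Tendsto (fun n => (q n k : ℝ) / ((∑ l, q n l : ℕ) : ℝ)) atTop (𝓝 (ρ k)))
    (t : RandomIndex d) (hb : ∀ n, ∀ᵐ ω ∂P n, opNorm (R n t.1 t.2.1 t.2.2 ω) ≤ K)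
    (hlaw : ConvergesToDeterministicLaw P (fun n ω => singularLaw (R n t.1 t.2.1 t.2.2 ω)))
    (j : ℕ) :
    ∃ c, Tendsto (fieldTrace q ((star (randomField.{u} q t) * randomField q t) ^ (j + 1)))
      (configFilter P (blockFamily R)) (𝓝 c) := by
  obtain ⟨ν, -, hν⟩ := hlaw
  have h1 : Tendsto (fun z : Config.{u} q =>
      ∫ x, truncatedPow K hK (2 * (j + 1)) x ∂(singularLaw (configBlock t z)))
      (configFilter P (blockFamily R)) (𝓝 (∫ x, truncatedPow K hK (2 * (j + 1)) x ∂ν)) := by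
    rw [tendsto_configFilter]
    simp only [configBlock_blockFamily]
    exact hν _
  -- The singular law is normalized by the smaller side of the block and the trace by the total
  -- size; their ratio converges to the smaller of the two limit ratios.
  have h2 := (tendsto_ratio.{u} (P := P) (blockFamily R) hq_lim t.2.1).min
    (tendsto_ratio.{u} (P := P) (blockFamily R) hq_lim t.2.2)
  have h3 : ∀ᶠ z : Config.{u} q in configFilter P (blockFamily R), opNorm (configBlock t z) ≤ K := by
    refine eventually_configFilter_of_ae _ _ fun n => ?_
    simp only [configBlock_blockFamily]
    exact hb n
  refine exists_tendsto_ratio_mul h2 h1 (h3.mono fun z hz => ?_)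
  have h4 : ((star (randomField.{u} q t) * randomField q t) ^ (j + 1)) z = blockExt
      (((configBlock t z).conjTranspose * configBlock t z) ^ (j + 1)) := by
    rw [Pi.pow_apply, Pi.mul_apply, Pi.star_apply, randomField_eq_blockExt, star_blockExt,
      blockExt_mul, blockExt_pow]
  rw [fieldTrace_eq_of_blockExt h4, trace_pow_eq_integral_singularLaw _ hK hz,
    min_div_div_right (Nat.cast_nonneg _)]
  push_cast
  ring

/-- Moments of a unitarily invariant hermitian matrix. -/
theorem exists_tendsto_trace_pow (hK : 0 ≤ K)
    (hq_lim : ∀ k, Tendsto (fun n => (q n k : ℝ) / ((∑ l, q n l : ℕ) : ℝ)) atTop (𝓝 (ρ k)))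
    (s : ℕ) (k : Fin d) (hb : ∀ n, ∀ᵐ ω ∂P n, opNorm (R n s k k ω) ≤ K)
    (hherm : ∀ n, ∀ᵐ ω ∂P n, (R n s k k ω).IsHermitian)
    (hlaw : ConvergesToDeterministicLaw P (fun n ω => spectralLaw (R n s k k ω)))
    (j : ℕ) :
    ∃ c, Tendsto (fieldTrace q (randomField.{u} q (s, k, k) ^ (j + 1)))
      (configFilter P (blockFamily R)) (𝓝 c) := by
  obtain ⟨ν, -, hν⟩ := hlaw
  have h1 : Tendsto (fun z : Config.{u} q =>
      ∫ x, truncatedPow K hK (j + 1) x ∂(spectralLaw (configBlock (s, k, k) z)))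
      (configFilter P (blockFamily R)) (𝓝 (∫ x, truncatedPow K hK (j + 1) x ∂ν)) := by
    rw [tendsto_configFilter]
    simp only [configBlock_blockFamily]
    exact hν _
  have h2 := tendsto_ratio.{u} (P := P) (blockFamily R) hq_lim k
  have h3 : ∀ᶠ z : Config.{u} q in configFilter P (blockFamily R),
      opNorm (configBlock (s, k, k) z) ≤ K ∧ (configBlock (s, k, k) z).IsHermitian := by
    refine eventually_configFilter_of_ae _ _ fun n => ?_
    simp only [configBlock_blockFamily]
    exact (hb n).and (hherm n)
  refine exists_tendsto_ratio_mul h2 h1 (h3.mono fun z hz => ?_)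
  have h4 : (randomField.{u} q (s, k, k) ^ (j + 1)) z =
      blockExt (configBlock (s, k, k) z ^ (j + 1)) := by
    rw [Pi.pow_apply, randomField_eq_blockExt, blockExt_pow]
  rw [fieldTrace_eq_of_blockExt h4, trace_pow_eq_integral_spectralLaw hz.2 hK hz.1]
  push_cast
  ring

/-- The powers of a matrix field which is multiplied on the left along the flow. -/
theorem hasFlowDeriv_pow {K : ℝ} {Y : ∀ n, Ω n → RandomIndex d → BlockMatrix (q n)}
    {γ : UnitaryFlow P Y K} {x : MatrixField.{u} q} (hx : HasFlowDeriv γ x [(1, x)]) (j : ℕ) :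
    HasFlowDeriv γ (x ^ (j + 1)) ((List.range (j + 1)).map fun i => (x ^ i, x ^ (j + 1 - i))) := by
  induction j with
  | zero => simpa using hx
  | succ j ih =>
    have h := hx.mul ih
    rw [← pow_succ'] at h
    convert h using 1
    rw [List.range_succ_eq_map]
    simp [List.map_map, Function.comp_def, pow_succ']

end Marginals

/-! ### Words in one element of a corner and its adjoint -/

section Corners

variable {𝔄 Z : Type*} [Ring 𝔄] [Algebra ℂ 𝔄] {d : ℕ} {p : Fin d → 𝔄} {τ : 𝔄 →ₗ[ℂ] Z → ℂ}
  {F : Filter Z} {ρ : Fin d → ℂ}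

theorem AsymptoticTrace.convergent_proj (h : AsymptoticTrace p τ F ρ) (j : Fin d) :
    AsymptoticallyConvergent p τ F (p j) := by
  intro k
  rcases eq_or_ne k j with rfl | hkj
  · exact ⟨ρ k, by rw [h.idem]; exact h.tendsto k⟩
  · exact ⟨0, by rw [h.orth k j hkj, map_zero]; exact tendsto_const_nhds⟩

/-- Only the component of index `k` is nonzero, and it is the full trace. -/
theorem AsymptoticTrace.convergent_of_left {x : 𝔄} (h : AsymptoticTrace p τ F ρ) {k : Fin d}
    (hx : p k * x = x) (hlim : ∃ c, Tendsto (τ x) F (𝓝 c)) :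
    AsymptoticallyConvergent p τ F x := by
  intro j
  rcases eq_or_ne j k with rfl | hjk
  · rw [hx]; exact hlim
  · exact ⟨0, by rw [← hx, ← mul_assoc, h.orth j k hjk, zero_mul, map_zero]
                 exact tendsto_const_nhds⟩

/-- By traciality `τ x = τ (p l * x)`, which vanishes because `x` starts with `p k`. -/
theorem AsymptoticTrace.convergent_of_off_diagonal {x : 𝔄} (h : AsymptoticTrace p τ F ρ)
    {k l : Fin d} (hkl : k ≠ l) (hx : p k * x = x) (hx' : x * p l = x) :
    AsymptoticallyConvergent p τ F x := by
  refine h.convergent_of_left hx ⟨0, ?_⟩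
  rw [← hx', h.trace_comm, ← hx, ← mul_assoc, h.orth l k hkl.symm, zero_mul, map_zero]
  exact tendsto_const_nhds

/-- Generators, as a vector space, of the algebra generated by the diagonal and by an element of
an off diagonal corner and its adjoint. -/
def offDiagonalSet (p : Fin d → 𝔄) (r r' : 𝔄) : Set 𝔄 :=
  Set.range p ∪ ((Set.range (fun m : ℕ => (r * r') ^ (m + 1)) ∪
    Set.range fun m : ℕ => (r' * r) ^ (m + 1)) ∪
    (Set.range (fun m : ℕ => r * (r' * r) ^ m) ∪ Set.range fun m : ℕ => r' * (r * r') ^ m))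

omit [Algebra ℂ 𝔄] in
theorem offDiagonalSet_comm (r r' : 𝔄) : offDiagonalSet p r r' = offDiagonalSet p r' r := by
  rw [offDiagonalSet, offDiagonalSet, Set.union_comm (Set.range fun m : ℕ => (r * r') ^ (m + 1)),
    Set.union_comm (Set.range fun m : ℕ => r * (r' * r) ^ m)]

/-- As `k ≠ l`, the square of `r` is zero. Only words alternating between `r` and `r'` survive, and
these are exactly the words listed in `offDiagonalSet`. -/
theorem mul_mem_offDiagonalSet (h : AsymptoticTrace p τ F ρ) {k l : Fin d} (hkl : k ≠ l)
    {r r' : 𝔄} (hr : p k * r = r) (hr2 : r * p l = r) {g : 𝔄} (hg : g ∈ offDiagonalSet p r r') :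
    r * g = 0 ∨ r * g ∈ offDiagonalSet p r r' := by
  have hrr : r * r = 0 := by
    nth_rewrite 1 [← hr2]
    rw [← hr, mul_assoc, ← mul_assoc (p l), h.orth l k hkl.symm, zero_mul, mul_zero]
  rcases hg with ⟨j, rfl⟩ | (⟨m, rfl⟩ | ⟨m, rfl⟩) | (⟨m, rfl⟩ | ⟨m, rfl⟩)
  · rcases eq_or_ne l j with rfl | hj
    · exact Or.inr (Or.inr (Or.inr (Or.inl ⟨0, by simp [hr2]⟩)))
    · exact Or.inl (by rw [← hr2, mul_assoc, h.orth l j hj, mul_zero])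
  · refine Or.inl ?_
    beta_reduce
    rw [pow_succ', ← mul_assoc, ← mul_assoc, hrr, zero_mul, zero_mul]
  · exact Or.inr (Or.inr (Or.inr (Or.inl ⟨m + 1, rfl⟩)))
  · refine Or.inl ?_
    beta_reduce
    rw [← mul_assoc, hrr, zero_mul]
  · refine Or.inr (Or.inr (Or.inl (Or.inl ⟨m, ?_⟩)))
    beta_reduce
    rw [← mul_assoc, pow_succ']

omit [Algebra ℂ 𝔄] in
theorem left_of_mem_offDiagonalSet {k l : Fin d} {r r' : 𝔄} (hr : p k * r = r)
    (hr' : p l * r' = r') {g : 𝔄} (hg : g ∈ offDiagonalSet p r r') :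
    ∃ i, p i * g = g ∨ g = p i := by
  rcases hg with ⟨j, rfl⟩ | (⟨m, rfl⟩ | ⟨m, rfl⟩) | (⟨m, rfl⟩ | ⟨m, rfl⟩)
  · exact ⟨j, Or.inr rfl⟩
  · exact ⟨k, Or.inl (by beta_reduce; rw [pow_succ', ← mul_assoc, ← mul_assoc, hr])⟩
  · exact ⟨l, Or.inl (by beta_reduce; rw [pow_succ', ← mul_assoc, ← mul_assoc, hr'])⟩
  · exact ⟨k, Or.inl (by beta_reduce; rw [← mul_assoc, hr])⟩
  · exact ⟨l, Or.inl (by beta_reduce; rw [← mul_assoc, hr'])⟩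

/-- Words of odd length lie in off diagonal corners and have zero trace. Cyclicity identifies the
traces of the powers of `r * r'` and `r' * r`, so one sequence of limits is enough. -/
theorem convergent_of_mem_offDiagonalSet (h : AsymptoticTrace p τ F ρ) {k l : Fin d} (hkl : k ≠ l)
    {r r' : 𝔄} (hr : p k * r = r) (hr2 : r * p l = r) (hr' : p l * r' = r') (hr2' : r' * p k = r')
    (hlim : ∀ m : ℕ, ∃ c, Tendsto (τ ((r' * r) ^ (m + 1))) F (𝓝 c)) {g : 𝔄}
    (hg : g ∈ offDiagonalSet p r r') : AsymptoticallyConvergent p τ F g := by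
  rcases hg with ⟨j, rfl⟩ | (⟨m, rfl⟩ | ⟨m, rfl⟩) | (⟨m, rfl⟩ | ⟨m, rfl⟩)
  · exact h.convergent_proj j
  · refine h.convergent_of_left (k := k)
      (by beta_reduce; rw [pow_succ', ← mul_assoc, ← mul_assoc, hr]) ?_
    obtain ⟨c, hc⟩ := hlim m
    refine ⟨c, ?_⟩
    have e : τ ((r * r') ^ (m + 1)) = τ ((r' * r) ^ (m + 1)) := by
      rw [pow_succ', mul_assoc, h.trace_comm, mul_assoc]
      congr 1
      have : (r * r') ^ m * r = r * (r' * r) ^ m := by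
        clear hc
        induction m with
        | zero => simp
        | succ m ih => rw [pow_succ', mul_assoc, ih, pow_succ' (r' * r)]; simp only [mul_assoc]
      rw [this, pow_succ', mul_assoc]
    beta_reduce
    rw [e]
    exact hc
  · exact h.convergent_of_left (k := l)
      (by beta_reduce; rw [pow_succ', ← mul_assoc, ← mul_assoc, hr']) (hlim m)
  · refine h.convergent_of_off_diagonal hkl (by beta_reduce; rw [← mul_assoc, hr]) ?_
    rcases m with _ | m
    · simpa using hr2
    · beta_reduce
      rw [mul_assoc, pow_succ, mul_assoc, mul_assoc, hr2]
  · refine h.convergent_of_off_diagonal hkl.symm (by beta_reduce; rw [← mul_assoc, hr']) ?_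
    rcases m with _ | m
    · simpa using hr2'
    · beta_reduce
      rw [mul_assoc, pow_succ, mul_assoc, mul_assoc, hr2']

end Corners

/-! ### Convergence criteria for the algebra generated by one matrix -/

section Marginals

variable {d : ℕ} {q : ℕ → Fin d → ℕ} {F : Filter (Config.{u} q)} {ρ : Fin d → ℂ}

theorem AsymptoticallyConvergent.congr {x y : MatrixField.{u} q}
    (hy : AsymptoticallyConvergent (fieldProj q) (fieldTrace q) F y)
    (h : ∀ᶠ z in F, x z = y z) : AsymptoticallyConvergent (fieldProj q) (fieldTrace q) F x := by
  intro k
  obtain ⟨c, hc⟩ := hy k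
  refine ⟨c, hc.congr' (h.mono fun z hz => ?_)⟩
  rw [fieldTrace_apply, fieldTrace_apply, Pi.mul_apply, Pi.mul_apply, hz]

/-- Convergence on the algebra generated by `S`, when the linear span of `G` is, up to an
eventual equality, stable under multiplication by the elements of `S`. -/
theorem convergent_of_mem_adjoin_of_span {S G : Set (MatrixField.{u} q)}
    (hG : ∀ g ∈ G, AsymptoticallyConvergent (fieldProj q) (fieldTrace q) F g)
    (h1 : (1 : MatrixField.{u} q) ∈ Submodule.span ℂ G)
    (hmul : ∀ s ∈ S, ∀ g ∈ G, ∃ y ∈ Submodule.span ℂ G, ∀ᶠ z in F, (s * g) z = y z)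
    {x : MatrixField.{u} q} (hx : x ∈ Algebra.adjoin ℂ S) :
    AsymptoticallyConvergent (fieldProj q) (fieldTrace q) F x := by
  have hspan : ∀ y ∈ Submodule.span ℂ G,
      AsymptoticallyConvergent (fieldProj q) (fieldTrace q) F y := by
    intro y hy
    induction hy using Submodule.span_induction with
    | mem g hg => exact hG g hg
    | zero => exact fun k => ⟨0, by rw [mul_zero, map_zero]; exact tendsto_const_nhds⟩
    | add a b _ _ ha hb =>
      intro k
      obtain ⟨c, hc⟩ := ha k
      obtain ⟨c', hc'⟩ := hb k
      exact ⟨c + c', by rw [mul_add, map_add]; exact hc.add hc'⟩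
    | smul r a _ ha =>
      intro k
      obtain ⟨c, hc⟩ := ha k
      exact ⟨r * c, by rw [mul_smul_comm, map_smul]; exact hc.const_mul r⟩
  have hmul' : ∀ s ∈ S, ∀ v ∈ Submodule.span ℂ G,
      ∃ y ∈ Submodule.span ℂ G, ∀ᶠ z in F, (s * v) z = y z := by
    intro s hs v hv
    induction hv using Submodule.span_induction with
    | mem g hg => exact hmul s hs g hg
    | zero => exact ⟨0, zero_mem _, Eventually.of_forall fun z => by rw [mul_zero]⟩
    | add a b _ _ ha hb =>
      obtain ⟨y, hy, hy'⟩ := ha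
      obtain ⟨y', hy1, hy1'⟩ := hb
      refine ⟨y + y', add_mem hy hy1, ?_⟩
      filter_upwards [hy', hy1'] with z hz hz'
      rw [mul_add, Pi.add_apply, hz, hz', Pi.add_apply]
    | smul c a _ ha =>
      obtain ⟨y, hy, hy'⟩ := ha
      refine ⟨c • y, Submodule.smul_mem _ _ hy, ?_⟩
      filter_upwards [hy'] with z hz
      rw [mul_smul_comm, Pi.smul_apply, hz, Pi.smul_apply]
  have key : ∀ v ∈ Submodule.span ℂ G,
      ∃ y ∈ Submodule.span ℂ G, ∀ᶠ z in F, (x * v) z = y z := by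
    induction hx using Algebra.adjoin_induction with
    | mem s hs => exact hmul' s hs
    | algebraMap r =>
      exact fun v hv => ⟨r • v, Submodule.smul_mem _ _ hv, Eventually.of_forall fun z => by
        rw [Algebra.smul_def]⟩
    | add a b _ _ ha hb =>
      intro v hv
      obtain ⟨y, hy, hy'⟩ := ha v hv
      obtain ⟨y', hy1, hy1'⟩ := hb v hv
      refine ⟨y + y', add_mem hy hy1, ?_⟩
      filter_upwards [hy', hy1'] with z hz hz'
      rw [add_mul, Pi.add_apply, hz, hz', Pi.add_apply]
    | mul a b _ _ ha hb =>
      intro v hv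
      obtain ⟨y, hy, hy'⟩ := hb v hv
      obtain ⟨y', hy1, hy1'⟩ := ha y hy
      -- Products of fields are pointwise, so an equality of values at `z` may be multiplied on the
      -- left by `a z`.
      refine ⟨y', hy1, ?_⟩
      filter_upwards [hy', hy1'] with z hz hz'
      rw [mul_assoc, Pi.mul_apply, hz, ← hz', Pi.mul_apply]
  obtain ⟨y, hy, hxy⟩ := key 1 h1
  rw [mul_one] at hxy
  exact (hspan y hy).congr hxy

variable (h : AsymptoticTrace (fieldProj.{u} q) (fieldTrace q) F ρ)
include h

theorem one_mem_span_of_proj {G : Set (MatrixField.{u} q)} (hG : Set.range (fieldProj q) ⊆ G) :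
    (1 : MatrixField.{u} q) ∈ Submodule.span ℂ G := by
  rw [← h.sum_eq_one]
  exact sum_mem fun k _ => Submodule.subset_span (hG ⟨k, rfl⟩)

/-- Convergence of the distribution of an element of an off diagonal corner. -/
theorem convergent_adjoin_off_diagonal {k l : Fin d} (hkl : k ≠ l) {r r' : MatrixField.{u} q}
    (hr : fieldProj q k * r = r) (hr2 : r * fieldProj q l = r)
    (hr' : fieldProj q l * r' = r') (hr2' : r' * fieldProj q k = r')
    (hlim : ∀ m : ℕ, ∃ c, Tendsto (fieldTrace q ((r' * r) ^ (m + 1))) F (𝓝 c))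
    {x : MatrixField.{u} q} (hx : x ∈ Algebra.adjoin ℂ ({r, r'} ∪ Set.range (fieldProj q))) :
    AsymptoticallyConvergent (fieldProj q) (fieldTrace q) F x := by
  refine convergent_of_mem_adjoin_of_span (G := offDiagonalSet (fieldProj q) r r')
    (fun g hg => convergent_of_mem_offDiagonalSet h hkl hr hr2 hr' hr2' hlim hg)
    (one_mem_span_of_proj h Set.subset_union_left) ?_ hx
  suffices H : ∀ s ∈ ({r, r'} ∪ Set.range (fieldProj q) : Set (MatrixField.{u} q)),
      ∀ g ∈ offDiagonalSet (fieldProj q) r r',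
        s * g = 0 ∨ s * g ∈ offDiagonalSet (fieldProj q) r r' by
    intro s hs g hg
    rcases H s hs g hg with h0 | h0
    · exact ⟨0, zero_mem _, Eventually.of_forall fun z => by rw [h0]⟩
    · exact ⟨_, Submodule.subset_span h0, Eventually.of_forall fun z => rfl⟩
  intro s hs g hg
  rcases hs with (rfl | rfl) | ⟨j, rfl⟩
  · exact mul_mem_offDiagonalSet h hkl hr hr2 hg
  · rw [offDiagonalSet_comm] at hg ⊢
    exact mul_mem_offDiagonalSet h hkl.symm hr' hr2' hg
  · obtain ⟨i, hi⟩ := left_of_mem_offDiagonalSet hr hr' hg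
    rcases eq_or_ne j i with rfl | hji
    · rcases hi with hi | rfl
      · rw [hi]; exact Or.inr hg
      · rw [h.idem]; exact Or.inr hg
    · rcases hi with hi | rfl
      · rw [← hi, ← mul_assoc, h.orth j i hji, zero_mul]; exact Or.inl rfl
      · rw [h.orth j i hji]; exact Or.inl rfl

/-- Convergence of the distribution of an element of a diagonal corner. -/
theorem convergent_adjoin_diagonal {k : Fin d} {r r' : MatrixField.{u} q}
    (hr : fieldProj q k * r = r) (hr2 : r * fieldProj q k = r)
    (hr' : fieldProj q k * r' = r') (hr2' : r' * fieldProj q k = r')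
    (hlim : ∀ m : ℕ, ∃ c, Tendsto (fieldTrace q (r ^ (m + 1))) F (𝓝 c))
    (hlim' : ∀ m : ℕ, ∃ c, Tendsto (fieldTrace q (r' ^ (m + 1))) F (𝓝 c))
    {G : Set (MatrixField.{u} q)}
    (hGdef : G = Set.range (fieldProj q) ∪ ((Set.range fun m : ℕ => r ^ (m + 1)) ∪
      Set.range fun m : ℕ => r' ^ (m + 1)))
    (hmul : ∀ m : ℕ, ∃ y ∈ G, ∀ᶠ z in F, (r * r' ^ (m + 1)) z = y z)
    (hmul' : ∀ m : ℕ, ∃ y ∈ G, ∀ᶠ z in F, (r' * r ^ (m + 1)) z = y z)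
    {x : MatrixField.{u} q} (hx : x ∈ Algebra.adjoin ℂ ({r, r'} ∪ Set.range (fieldProj q))) :
    AsymptoticallyConvergent (fieldProj q) (fieldTrace q) F x := by
  have hpow : ∀ m : ℕ, fieldProj q k * r ^ (m + 1) = r ^ (m + 1) := fun m => by
    rw [pow_succ', ← mul_assoc, hr]
  have hpow' : ∀ m : ℕ, fieldProj q k * r' ^ (m + 1) = r' ^ (m + 1) := fun m => by
    rw [pow_succ', ← mul_assoc, hr']
  refine convergent_of_mem_adjoin_of_span (G := G) (fun g hg => ?_)
    (one_mem_span_of_proj h (hGdef ▸ Set.subset_union_left)) ?_ hx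
  · rw [hGdef] at hg
    rcases hg with ⟨j, rfl⟩ | ⟨m, rfl⟩ | ⟨m, rfl⟩
    · exact h.convergent_proj j
    · exact h.convergent_of_left (hpow m) (hlim m)
    · exact h.convergent_of_left (hpow' m) (hlim' m)
  have hp : ∀ j, fieldProj q j ∈ G := fun j => hGdef ▸ Or.inl ⟨j, rfl⟩
  have hm : ∀ m : ℕ, r ^ (m + 1) ∈ G := fun m => hGdef ▸ Or.inr (Or.inl ⟨m, rfl⟩)
  have hm' : ∀ m : ℕ, r' ^ (m + 1) ∈ G := fun m => hGdef ▸ Or.inr (Or.inr ⟨m, rfl⟩)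
  suffices H : ∀ s ∈ ({r, r'} ∪ Set.range (fieldProj q) : Set (MatrixField.{u} q)),
      ∀ g ∈ G, s * g = 0 ∨ ∃ y ∈ G, ∀ᶠ z in F, (s * g) z = y z by
    intro s hs g hg
    rcases H s hs g hg with h0 | ⟨y, hy, hyz⟩
    · exact ⟨0, zero_mem _, Eventually.of_forall fun z => by rw [h0]⟩
    · exact ⟨y, Submodule.subset_span hy, hyz⟩
  have triv : ∀ {a y : MatrixField.{u} q}, a = y → y ∈ G → ∃ y ∈ G, ∀ᶠ z in F, a z = y z :=
    fun e hy => ⟨_, hy, Eventually.of_forall fun z => by rw [e]⟩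
  intro s hs g hg
  rw [hGdef] at hg
  rcases hs with (rfl | rfl) | ⟨i, rfl⟩ <;> rcases hg with ⟨j, rfl⟩ | ⟨m, rfl⟩ | ⟨m, rfl⟩
  · rcases eq_or_ne k j with rfl | hj
    · exact Or.inr (triv (by rw [hr2, zero_add, pow_one]) (hm 0))
    · exact Or.inl (by rw [← hr2, mul_assoc, h.orth k j hj, mul_zero])
  · exact Or.inr (triv (pow_succ' _ _).symm (hm (m + 1)))
  · exact Or.inr (hmul m)
  · rcases eq_or_ne k j with rfl | hj
    · exact Or.inr (triv (by rw [hr2', zero_add, pow_one]) (hm' 0))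
    · exact Or.inl (by rw [← hr2', mul_assoc, h.orth k j hj, mul_zero])
  · exact Or.inr (hmul' m)
  · exact Or.inr (triv (pow_succ' _ _).symm (hm' (m + 1)))
  · rcases eq_or_ne i j with rfl | hj
    · exact Or.inr (triv (h.idem i) (hp i))
    · exact Or.inl (h.orth i j hj)
  · rcases eq_or_ne i k with rfl | hj
    · exact Or.inr (triv (hpow m) (hm m))
    · exact Or.inl (by beta_reduce; rw [← hpow m, ← mul_assoc, h.orth i k hj, zero_mul])
  · rcases eq_or_ne i k with rfl | hj
    · exact Or.inr (triv (hpow' m) (hm' m))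
    · exact Or.inl (by beta_reduce; rw [← hpow' m, ← mul_assoc, h.orth i k hj, zero_mul])

/-- The powers of an element which is multiplied on the left along a flow are asymptotically
centered. -/
theorem tendsto_trace_pow_of_schwingerDyson {k : Fin d} {x : MatrixField.{u} q}
    (hsd : ∀ j : ℕ, Tendsto (tensorTrace (fieldProj q) (fieldTrace q) k
      ((List.range (j + 1)).map fun i => (x ^ i, x ^ (j + 1 - i)))) F (𝓝 0)) (j : ℕ) :
    Tendsto (fieldTrace q (fieldProj q k * x ^ (j + 1))) F (𝓝 0) := by
  induction j using Nat.strong_induction_on with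
  | _ j ih =>
    have h1 := hsd j
    -- In the sum of the products for `x ^ i` and `x ^ (j + 1 - i)`, all terms with `i > 0` involve
    -- two lower positive powers. They vanish by induction, leaving the term `i = 0`.
    have h2 : Tendsto (fun z => fieldTrace q (fieldProj q k) z *
        fieldTrace q (fieldProj q k * x ^ (j + 1)) z) F (𝓝 0) := by
      have h3 : Tendsto (fun z => ∑ i ∈ Finset.range j,
          fieldTrace q (fieldProj q k * x ^ (i + 1)) z *
            fieldTrace q (fieldProj q k * x ^ (j + 1 - (i + 1))) z) F
          (𝓝 (∑ _i ∈ Finset.range j, 0 * 0)) := by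
        refine tendsto_finsetSum _ fun i hi => (ih i (Finset.mem_range.1 hi)).mul ?_
        have hi' := Finset.mem_range.1 hi
        have e : j + 1 - (i + 1) = (j - 1 - i) + 1 := by omega
        rw [e]
        exact ih _ (by omega)
      simp only [mul_zero, Finset.sum_const_zero] at h3
      have h4 := h1.sub h3
      rw [sub_zero] at h4
      refine h4.congr fun z => ?_
      have e : tensorTrace (fieldProj q) (fieldTrace q) k
          ((List.range (j + 1)).map fun i => (x ^ i, x ^ (j + 1 - i))) z =
          ∑ i ∈ Finset.range (j + 1), fieldTrace q (fieldProj q k * x ^ i) z *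
            fieldTrace q (fieldProj q k * x ^ (j + 1 - i)) z := by
        have : ∀ (f : ℕ → Config.{u} q → ℂ) (m : ℕ),
            ((List.range m).map f).sum z = ∑ i ∈ Finset.range m, f i z := by
          intro f m
          induction m with
          | zero => simp
          | succ m ihm => simp [List.range_succ, Finset.sum_range_succ, ihm]
        rw [tensorTrace, List.map_map, this]
        rfl
      rw [e, Finset.sum_range_succ']
      simp
    have h5 := h2.div (h.tendsto k) (h.ne_zero k)
    rw [zero_div] at h5
    refine h5.congr' ?_
    filter_upwards [(h.tendsto k).eventually_ne (h.ne_zero k)] with z hz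
    exact mul_div_cancel_left₀ _ hz

end Marginals

/-! ### The families of matrices of the theorem -/

section Invariance

variable {Ω : Type*} [MeasurableSpace Ω] {P : Measure Ω} {d : ℕ} {r : Fin d → ℕ} {k l : Fin d}
  {R : Ω → Matrix (Fin (r k)) (Fin (r l)) ℂ}

theorem map_blockExt_congr {R' : Ω → Matrix (Fin (r k)) (Fin (r l)) ℂ} (hR : Measurable R)
    (hR' : Measurable R') (h : P.map R' = P.map R) :
    P.map (fun ω => blockExt (R' ω)) = P.map fun ω => blockExt (R ω) := by
  have hm : Measurable fun M : Matrix (Fin (r k)) (Fin (r l)) ℂ => blockExt M :=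
    measurable_id.blockExt
  have h1 := Measure.map_map (μ := P) hm hR
  have h2 := Measure.map_map (μ := P) hm hR'
  rw [h] at h2
  exact h2.symm.trans h1

theorem map_mul_blockExt_mul_star (hR : Measurable R) {U : BlockMatrix r}
    (hU : U ∈ blockUnitary r)
    (h : P.map (fun ω => blockRestrict U k * R ω * star (blockRestrict U l)) = P.map R) :
    P.map (fun ω => U * blockExt (R ω) * star U) = P.map fun ω => blockExt (R ω) := by
  simp only [mul_blockExt hU, blockExt_mul_star hU]
  exact map_blockExt_congr hR
    ((measurable_const.matrix_mul hR).matrix_mul measurable_const) h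

theorem map_mul_blockExt (hR : Measurable R) {U : BlockMatrix r} (hU : U ∈ blockUnitary r)
    (h : P.map (fun ω => blockRestrict U k * R ω) = P.map R) :
    P.map (fun ω => U * blockExt (R ω)) = P.map fun ω => blockExt (R ω) := by
  simp only [mul_blockExt hU]
  exact map_blockExt_congr hR (measurable_const.matrix_mul hR) h

end Invariance

section MatrixFields

variable {d : ℕ} {q : ℕ → Fin d → ℕ}

/-- A property of the matrix of index `t` which holds almost surely. -/
theorem eventually_randomField {Ω : ℕ → Type*} [∀ n, MeasurableSpace (Ω n)]
    {P : ∀ n, Measure (Ω n)}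
    {R : ∀ n, ℕ → ∀ k l : Fin d, Ω n → Matrix (Fin (q n k)) (Fin (q n l)) ℂ} (t : RandomIndex d)
    {S : ∀ n, BlockMatrix (q n) → Prop}
    (hS : ∀ n, ∀ᵐ ω ∂P n, S n (blockExt (R n t.1 t.2.1 t.2.2 ω))) :
    ∀ᶠ z : Config.{u} q in configFilter P (blockFamily R), S z.size (randomField q t z) := by
  refine eventually_configFilter_of_ae _ _ fun n => ?_
  simp only [randomField_blockFamily]
  exact hS n

theorem fieldTrace_star (x : MatrixField.{u} q) (z : Config.{u} q) :
    fieldTrace q (star x) z = star (fieldTrace q x z) := by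
  rw [fieldTrace_apply, fieldTrace_apply, star_mul', Pi.star_apply, Matrix.star_eq_conjTranspose,
    Matrix.trace_conjTranspose]
  simp

theorem fieldTrace_star_pow_tendsto {F : Filter (Config.{u} q)} {x : MatrixField.{u} q}
    {m : ℕ} (hx : ∃ c, Tendsto (fieldTrace q (x ^ m)) F (𝓝 c)) :
    ∃ c, Tendsto (fieldTrace q (star x ^ m)) F (𝓝 c) := by
  obtain ⟨c, hc⟩ := hx
  refine ⟨star c, hc.star.congr fun z => ?_⟩
  rw [← fieldTrace_star, star_pow]

end MatrixFields

/-- The hypotheses on the sizes of the blocks and on the random matrices. -/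
structure RandomBlocks {d : ℕ} (q : ℕ → Fin d → ℕ) (ρ : Fin d → ℝ) {Ω : ℕ → Type*}
    [∀ n, MeasurableSpace (Ω n)] (P : ∀ n, Measure (Ω n))
    (R : ∀ n, ℕ → ∀ k l : Fin d, Ω n → Matrix (Fin (q n k)) (Fin (q n l)) ℂ) (K : ℝ) : Prop where
  pos : ∀ n k, 0 < q n k
  total_pos : ∀ n, 0 < ∑ l, q n l
  total : Tendsto (fun n => ∑ l, q n l) atTop atTop
  ratio_pos : ∀ k, 0 < ρ k
  ratio : ∀ k, Tendsto (fun n => (q n k : ℝ) / ((∑ l, q n l : ℕ) : ℝ)) atTop (𝓝 (ρ k))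
  meas : ∀ n s k l, Measurable (R n s k l)
  indep : ∀ n, iIndepFun (fun t : ℕ × Fin d × Fin d => R n t.1 t.2.1 t.2.2) (P n)
  off_inv : ∀ n s k l, k ≠ l → BiUnitarilyInvariant (P n) (R n s k l)
  off_law : ∀ s k l, k ≠ l →
    ConvergesToDeterministicLaw P (fun n ω => singularLaw (R n s k l ω))
  odd : ∀ n s k, Odd s → UniformUnitary (P n) (R n s k k)
  even_herm : ∀ n s k, Even s → ∀ᵐ ω ∂(P n), (R n s k k ω).IsHermitian
  even_inv : ∀ n s k, Even s → UnitarilyInvariant (P n) (R n s k k)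
  even_law : ∀ s k, Even s →
    ConvergesToDeterministicLaw P (fun n ω => spectralLaw (R n s k k ω))
  nonneg : 0 ≤ K
  bdd : ∀ n s k l, ∀ᵐ ω ∂(P n), opNorm (R n s k l ω) ≤ K

namespace RandomBlocks

variable {d : ℕ} {q : ℕ → Fin d → ℕ} {ρ : Fin d → ℝ} {Ω : ℕ → Type*}
  [∀ n, MeasurableSpace (Ω n)] {P : ∀ n, Measure (Ω n)} [∀ n, IsProbabilityMeasure (P n)]
  {R : ∀ n, ℕ → ∀ k l : Fin d, Ω n → Matrix (Fin (q n k)) (Fin (q n l)) ℂ} {K : ℝ}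

section Family

variable (h : RandomBlocks q ρ P R K)
include h

omit [∀ n, IsProbabilityMeasure (P n)] in
theorem measurable_blockFamily (n : ℕ) : Measurable (blockFamily R n) :=
  measurable_pi_iff.2 fun t => (h.meas n t.1 t.2.1 t.2.2).blockExt

omit [∀ n, IsProbabilityMeasure (P n)] in
theorem iIndepFun_blockFamily (n : ℕ) : iIndepFun (fun t ω => blockFamily R n ω t) (P n) :=
  (h.indep n).comp (fun _ => blockExt) fun _ => measurable_id.blockExt

open scoped Matrix.Norms.L2Operator in
omit [∀ n, IsProbabilityMeasure (P n)] in
theorem ae_norm_blockFamily_le (n : ℕ) : ∀ᵐ ω ∂P n, ∀ t, ‖blockFamily R n ω t‖ ≤ K :=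
  ae_all_iff.2 fun t => (h.bdd n t.1 t.2.1 t.2.2).mono fun _ hω => (norm_blockExt_le _).trans hω

theorem map_update (n : ℕ) (t : RandomIndex d) {g : BlockMatrix (q n) → BlockMatrix (q n)}
    (hg : Measurable g)
    (hmap : (P n).map (fun ω => g (blockFamily R n ω t)) =
      (P n).map fun ω => blockFamily R n ω t) :
    (P n).map (fun ω => Function.update (blockFamily R n ω) t (g (blockFamily R n ω t))) =
      (P n).map (blockFamily R n) :=
  (h.iIndepFun_blockFamily n).map_update_eq
    (fun s => (measurable_pi_apply s).comp (h.measurable_blockFamily n)) t hg hmap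

/-- On the corner `(k, l)`, conjugation by `U` acts as `M ↦ U_k M U_l^*`. This preserves the law in
all three cases: bi-unitary invariance off the diagonal, the Haar property for odd `s`, conjugation
invariance for even `s`. -/
theorem map_conj (t : RandomIndex d) (n : ℕ) (U : BlockMatrix (q n))
    (hU : U ∈ blockUnitary (q n)) :
    (P n).map (fun ω => Function.update (blockFamily R n ω) t
      (U * blockFamily R n ω t * star U)) = (P n).map (blockFamily R n) := by
  refine h.map_update n t (g := fun x => U * x * star U)
    ((measurable_const.matrix_mul measurable_id).matrix_mul measurable_const)
    (map_mul_blockExt_mul_star (h.meas n _ _ _) hU ?_)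
  obtain ⟨s, k, l⟩ := t
  have hk := blockRestrict_mem_unitaryGroup hU
  rcases eq_or_ne k l with rfl | hkl
  · rcases Nat.even_or_odd s with hs | hs
    · exact h.even_inv n s k hs _ (hk k)
    · exact (h.odd n s k hs).unitarilyInvariant (h.meas n s k k) _ (hk k)
  · exact h.off_inv n s k l hkl _ (hk k) _ (Unitary.star_mem (hk l))

theorem map_left {s : ℕ} (hs : Odd s) (k : Fin d) (n : ℕ) (U : BlockMatrix (q n))
    (hU : U ∈ blockUnitary (q n)) :
    (P n).map (fun ω => Function.update (blockFamily R n ω) (s, k, k)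
      (U * blockFamily R n ω (s, k, k))) = (P n).map (blockFamily R n) :=
  h.map_update n (s, k, k) (g := fun x => U * x) (measurable_const.matrix_mul measurable_id)
    (map_mul_blockExt (h.meas n s k k) hU
      ((h.odd n s k hs).2 _ (blockRestrict_mem_unitaryGroup hU k)))

-- The trace of `p k` is exactly the proportion of the `k`-th block, whose limit `ρ k` is positive.
omit [∀ n, IsProbabilityMeasure (P n)] in
theorem asymptoticTrace : AsymptoticTrace (fieldProj.{u} q) (fieldTrace q)
    (configFilter P (blockFamily R)) fun k => (ρ k : ℂ) where
  idem := fieldProj_mul_self h.pos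
  orth := fieldProj_orthogonal h.pos
  sum_eq_one := fieldProj_sum h.pos
  trace_comm := fieldTrace_mul_comm
  ne_zero k := by exact_mod_cast (h.ratio_pos k).ne'
  tendsto k := by
    have h1 := (Complex.continuous_ofReal.tendsto _).comp
      (tendsto_ratio.{u} (P := P) (blockFamily R) h.ratio k)
    refine h1.congr fun z => ?_
    have h2 := fieldTrace_proj_mul h.pos k (fieldProj.{u} q k) z
    rw [fieldProj_mul_self h.pos] at h2
    rw [h2]
    have h3 : blockTrace (q z.size) k (fieldProj q k z) = 1 :=
      (blockMatrixSpace (q z.size) (h.pos _)).φ_unit k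
    rw [h3, mul_one]
    rfl

omit [∀ n, IsProbabilityMeasure (P n)] in
theorem convergent_off {s : ℕ} {k l : Fin d} (hkl : k ≠ l) {x : MatrixField.{u} q}
    (hx : x ∈ Algebra.adjoin ℂ
      ({randomField q (s, k, l), star (randomField q (s, k, l))} ∪ Set.range (fieldProj q))) :
    AsymptoticallyConvergent (fieldProj q) (fieldTrace q)
      (configFilter P (blockFamily R)) x := by
  have hc := randomField_corner.{u} (q := q) (s, k, l)
  have h1 : fieldProj q k * randomField.{u} q (s, k, l) = randomField q (s, k, l) := by
    rw [← hc, ← mul_assoc, ← mul_assoc, fieldProj_mul_self h.pos]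
  have h2 : randomField.{u} q (s, k, l) * fieldProj q l = randomField q (s, k, l) := by
    rw [← hc, mul_assoc, fieldProj_mul_self h.pos]
  refine convergent_adjoin_off_diagonal h.asymptoticTrace hkl h1 h2 ?_ ?_ (fun m => ?_) hx
  · rw [← fieldProj_star h.pos, ← star_mul, h2]
  · rw [← fieldProj_star h.pos, ← star_mul, h1]
  · exact exists_tendsto_trace_star_mul_pow h.nonneg h.ratio (s, k, l) (fun n => h.bdd n s k l)
      (h.off_law s k l hkl) m

-- The adjoint agrees with the matrix only almost surely, hence only eventually along the filter; up
-- to that equality every mixed word is a power of one element.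
omit [∀ n, IsProbabilityMeasure (P n)] in
theorem convergent_even {s : ℕ} (hs : Even s) {k : Fin d} {x : MatrixField.{u} q}
    (hx : x ∈ Algebra.adjoin ℂ
      ({randomField q (s, k, k), star (randomField q (s, k, k))} ∪ Set.range (fieldProj q))) :
    AsymptoticallyConvergent (fieldProj q) (fieldTrace q)
      (configFilter P (blockFamily R)) x := by
  have hc := randomField_corner.{u} (q := q) (s, k, k)
  set r := randomField.{u} q (s, k, k) with hr
  have h1 : fieldProj q k * r = r := by
    rw [← hc, ← mul_assoc, ← mul_assoc, fieldProj_mul_self h.pos]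
  have h2 : r * fieldProj q k = r := by rw [← hc, mul_assoc, fieldProj_mul_self h.pos]
  have hlim : ∀ m : ℕ, ∃ c, Tendsto (fieldTrace q (r ^ (m + 1)))
      (configFilter P (blockFamily R)) (𝓝 c) := fun m =>
    exists_tendsto_trace_pow h.nonneg h.ratio s k (fun n => h.bdd n s k k)
      (fun n => h.even_herm n s k hs) (h.even_law s k hs) m
  have he : ∀ᶠ z in configFilter P (blockFamily R), star (r z) = r z :=
    eventually_randomField (s, k, k) (S := fun _ M => star M = M) fun n =>
      (h.even_herm n s k hs).mono fun ω hω => by rw [star_blockExt, hω.eq]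
  refine convergent_adjoin_diagonal h.asymptoticTrace h1 h2 ?_ ?_ hlim
    (fun m => fieldTrace_star_pow_tendsto (hlim m)) rfl (fun m => ?_) (fun m => ?_) hx
  · rw [← fieldProj_star h.pos, ← star_mul, h2]
  · rw [← fieldProj_star h.pos, ← star_mul, h1]
  · refine ⟨_, Or.inr (Or.inl ⟨m + 1, rfl⟩), he.mono fun z hz => ?_⟩
    rw [Pi.mul_apply, Pi.pow_apply, Pi.star_apply, hz, ← pow_succ']
    rfl
  · refine ⟨_, Or.inr (Or.inl ⟨m + 1, rfl⟩), he.mono fun z hz => ?_⟩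
    rw [Pi.mul_apply, Pi.pow_apply, Pi.star_apply, hz, ← pow_succ']
    rfl

/-- The moments of a uniform unitary matrix tend to zero. -/
theorem tendsto_trace_pow_odd {s : ℕ} (hs : Odd s) (k : Fin d) (m : ℕ) :
    Tendsto (fieldTrace q (randomField.{u} q (s, k, k) ^ (m + 1)))
      (configFilter P (blockFamily R)) (𝓝 0) := by
  set r := randomField.{u} q (s, k, k) with hr
  let γ : UnitaryFlow P (blockFamily R) K := leftFlow (s, k, k) (h.map_left hs k)
  have hd : HasFlowDeriv γ r [(1, r)] := HasFlowDeriv.of_left fun n U hU v =>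
    leftFlow_randomField hU v
  have hnice : r ∈ niceAlgebra q K := randomField_mem_niceAlgebra K _
  have hsm : FlowSmooth γ r := ⟨hnice, _, by simp [hnice, one_mem], hd⟩
  have hpow : ∀ i, FlowSmooth γ (r ^ i) := by
    intro i
    induction i with
    | zero => rw [pow_zero]; exact FlowSmooth.one
    | succ i ih => rw [pow_succ]; exact ih.mul hsm
  have key := tendsto_trace_pow_of_schwingerDyson h.asymptoticTrace (k := k) (x := r) (fun j =>
    (hasFlowDeriv_pow hd j).tendsto_tensorTrace h.measurable_blockFamily
      h.ae_norm_blockFamily_le h.total h.total_pos (pow_mem hnice _) (fun ab hab => by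
        obtain ⟨i, -, rfl⟩ := List.mem_map.1 hab
        exact ⟨hpow _, hpow _⟩) k) m
  have h1 : fieldProj q k * r = r := by
    rw [hr, ← randomField_corner (s, k, k), ← mul_assoc, ← mul_assoc, fieldProj_mul_self h.pos]
  rwa [pow_succ', ← mul_assoc, h1, ← pow_succ'] at key

/-- Eventually `r * star r = star r * r = p k`, so mixed words collapse to powers of `r` or of `star
r`. The former have traces tending to zero, the latter have the conjugate traces. -/
theorem convergent_odd {s : ℕ} (hs : Odd s) {k : Fin d} {x : MatrixField.{u} q}
    (hx : x ∈ Algebra.adjoin ℂ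
      ({randomField q (s, k, k), star (randomField q (s, k, k))} ∪ Set.range (fieldProj q))) :
    AsymptoticallyConvergent (fieldProj q) (fieldTrace q)
      (configFilter P (blockFamily R)) x := by
  have hc := randomField_corner.{u} (q := q) (s, k, k)
  have hlim : ∀ m : ℕ, ∃ c, Tendsto (fieldTrace q (randomField.{u} q (s, k, k) ^ (m + 1)))
      (configFilter P (blockFamily R)) (𝓝 c) := fun m => ⟨0, h.tendsto_trace_pow_odd hs k m⟩
  set r := randomField.{u} q (s, k, k) with hr
  have h1 : fieldProj q k * r = r := by
    rw [← hc, ← mul_assoc, ← mul_assoc, fieldProj_mul_self h.pos]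
  have h2 : r * fieldProj q k = r := by rw [← hc, mul_assoc, fieldProj_mul_self h.pos]
  have h1' : fieldProj q k * star r = star r := by
    rw [← fieldProj_star h.pos, ← star_mul, h2]
  have h2' : star r * fieldProj q k = star r := by
    rw [← fieldProj_star h.pos, ← star_mul, h1]
  have hU : ∀ᶠ z : Config.{u} q in configFilter P (blockFamily R),
      r z * star (r z) = blockProj (q z.size) k ∧ star (r z) * r z = blockProj (q z.size) k :=
    eventually_randomField (s, k, k)
      (S := fun n M => M * star M = blockProj (q n) k ∧ star M * M = blockProj (q n) k) fun n =>
      (h.odd n s k hs).1.mono fun ω hω => by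
        have e1 := Matrix.mem_unitaryGroup_iff.1 hω
        have e2 := Matrix.mem_unitaryGroup_iff'.1 hω
        rw [Matrix.star_eq_conjTranspose] at e1 e2
        rw [star_blockExt, blockExt_mul, blockExt_mul, e1, e2, blockExt_one]
        exact ⟨rfl, rfl⟩
  -- One cancellation of `a` against `b`, stated once so as to serve for `(r, star r)` and for
  -- `(star r, r)`; the first power gives the projection itself.
  have key : ∀ (a b : MatrixField.{u} q) (G : Set (MatrixField.{u} q)),
      (∀ᶠ z in configFilter P (blockFamily R), (a * b) z = fieldProj q k z) →
      fieldProj q k * b = b → fieldProj q k ∈ G → (∀ m : ℕ, b ^ (m + 1) ∈ G) → ∀ m : ℕ,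
        ∃ y ∈ G, ∀ᶠ z in configFilter P (blockFamily R), (a * b ^ (m + 1)) z = y z := by
    intro a b G hab hb hp hG m
    rcases m with _ | m
    · exact ⟨_, hp, hab.mono fun z hz => by rw [zero_add, pow_one, hz]⟩
    · refine ⟨_, hG m, hab.mono fun z hz => ?_⟩
      rw [pow_succ', ← mul_assoc, Pi.mul_apply, hz, ← Pi.mul_apply, pow_succ', ← mul_assoc, hb]
  refine convergent_adjoin_diagonal h.asymptoticTrace h1 h2 h1' h2' hlim
    (fun m => fieldTrace_star_pow_tendsto (hlim m)) rfl
    (key _ _ _ (hU.mono fun z hz => hz.1) h1' (Or.inl ⟨k, rfl⟩) fun m => Or.inr (Or.inr ⟨m, rfl⟩))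
    (key _ _ _ (hU.mono fun z hz => hz.2) h1 (Or.inl ⟨k, rfl⟩) fun m => Or.inr (Or.inl ⟨m, rfl⟩)) hx

/-- Convergence of the distribution of one random matrix. -/
theorem convergent_randomField (t : RandomIndex d) {x : MatrixField.{u} q}
    (hx : x ∈ Algebra.adjoin ℂ
      ({randomField q t, star (randomField q t)} ∪ Set.range (fieldProj q))) :
    AsymptoticallyConvergent (fieldProj q) (fieldTrace q)
      (configFilter P (blockFamily R)) x := by
  obtain ⟨s, k, l⟩ := t
  rcases eq_or_ne k l with rfl | hkl
  · rcases Nat.even_or_odd s with hs | hs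
    · exact h.convergent_even hs hx
    · exact h.convergent_odd hs hx
  · exact h.convergent_off hkl hx

end Family

end RandomBlocks

/-! ### The algebras whose freeness is to be proved -/

section Factors

variable {d : ℕ} {q : ℕ → Fin d → ℕ} {I : Type u} {κ lam : I → Fin d}
  {C : ∀ (n : ℕ) (i : I), Matrix (Fin (q n (κ i))) (Fin (q n (lam i))) ℂ}

/-- The hypotheses on the deterministic matrices. -/
structure DeterministicBlocks (q : ℕ → Fin d → ℕ) (κ lam : I → Fin d)
    (C : ∀ (n : ℕ) (i : I), Matrix (Fin (q n (κ i))) (Fin (q n (lam i))) ℂ) (K : ℝ) : Prop where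
  proj : ∀ k, ∃ i, κ i = k ∧ lam i = k ∧ ∀ n, blockExt (C n i) = blockProj (q n) k
  prod : ∀ i j, lam i = κ j → ∃ m, κ m = κ i ∧ lam m = lam j ∧
    ∀ n, blockExt (C n m) = blockExt (C n i) * blockExt (C n j)
  adjoint : ∀ i, ∃ m, κ m = lam i ∧ lam m = κ i ∧
    ∀ n, blockExt (C n m) = star (blockExt (C n i))
  lim : ∀ i, κ i = lam i → ∃ c : ℂ,
    Tendsto (fun n => blockTrace (q n) (κ i) (blockExt (C n i))) atTop (𝓝 c)
  bdd : ∀ n i, opNorm (C n i) ≤ K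

/-- The deterministic matrix of index `i`. -/
noncomputable def constField
    (C : ∀ (n : ℕ) (i : I), Matrix (Fin (q n (κ i))) (Fin (q n (lam i))) ℂ) (i : I) :
    MatrixField.{u} q :=
  fun z => blockExt (C z.size i)

theorem constField_corner (i : I) :
    fieldProj q (κ i) * constField C i * fieldProj q (lam i) = constField C i :=
  funext fun _ => blockProj_mul_blockExt_mul _

theorem constField_mem_fixedAlgebra {Ω : ℕ → Type*} [∀ n, MeasurableSpace (Ω n)]
    {P : ∀ n, Measure (Ω n)} {Y : ∀ n, Ω n → RandomIndex d → BlockMatrix (q n)} {K : ℝ}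
    {γ : UnitaryFlow P Y K} (i : I) : constField C i ∈ fixedAlgebra γ :=
  fun _ _ _ _ => rfl

/-- The generators of the free algebras: a random matrix or the deterministic matrices, together
with the projections onto the blocks. -/
noncomputable def factorSet
    (C : ∀ (n : ℕ) (i : I), Matrix (Fin (q n (κ i))) (Fin (q n (lam i))) ℂ)
    (α : Option (RandomIndex d)) : Set (MatrixField.{u} q) :=
  α.elim (Set.range (constField C)) (fun t => {randomField q t}) ∪ Set.range (fieldProj q)

/-- The algebras generated by a random matrix or by the deterministic matrices, and by the
projections onto the blocks. -/
noncomputable def factor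
    (C : ∀ (n : ℕ) (i : I), Matrix (Fin (q n (κ i))) (Fin (q n (lam i))) ℂ)
    (α : Option (RandomIndex d)) : StarSubalgebra ℂ (MatrixField.{u} q) :=
  StarAlgebra.adjoin ℂ (factorSet C α)

theorem fieldProj_mem_factor (α : Option (RandomIndex d)) (k : Fin d) :
    fieldProj q k ∈ factor C α :=
  StarAlgebra.subset_adjoin ℂ _ (Or.inr ⟨k, rfl⟩)

theorem factor_none_le {S : StarSubalgebra ℂ (MatrixField.{u} q)}
    (hc : ∀ i, constField C i ∈ S) (hp : ∀ k, fieldProj q k ∈ S) : factor C none ≤ S := by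
  refine StarAlgebra.adjoin_le ?_
  rintro x (⟨i, rfl⟩ | ⟨k, rfl⟩)
  exacts [hc i, hp k]

theorem factor_some_le {S : StarSubalgebra ℂ (MatrixField.{u} q)} {t : RandomIndex d}
    (ht : randomField q t ∈ S) (hp : ∀ k, fieldProj q k ∈ S) : factor C (some t) ≤ S := by
  refine StarAlgebra.adjoin_le ?_
  rintro x (rfl | ⟨k, rfl⟩)
  exacts [ht, hp k]

/-- The algebra generated by all the matrices. -/
noncomputable def jointAlgebra
    (C : ∀ (n : ℕ) (i : I), Matrix (Fin (q n (κ i))) (Fin (q n (lam i))) ℂ) :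
    StarSubalgebra ℂ (MatrixField.{u} q) :=
  StarAlgebra.adjoin ℂ (⋃ α, factorSet C α)

theorem factorSet_subset_jointAlgebra (α : Option (RandomIndex d)) :
    factorSet C α ⊆ jointAlgebra C :=
  (Set.subset_iUnion _ α).trans (StarAlgebra.subset_adjoin ℂ _)

/-- Each factor is closed under adjoints, so the factors already generate the joint algebra without
adjoining stars, the form used by the abstract convergence theorem. -/
theorem mem_adjoin_of_mem_jointAlgebra {x : MatrixField.{u} q} (hx : x ∈ jointAlgebra C) :
    x ∈ Algebra.adjoin ℂ (⋃ α, ((factor C α).toSubalgebra : Set (MatrixField.{u} q))) := by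
  refine Algebra.adjoin_mono ?_ (show x ∈ Algebra.adjoin ℂ _ from hx)
  rintro y (hy | hy)
  · obtain ⟨α, hα⟩ := Set.mem_iUnion.1 hy
    exact Set.mem_iUnion.2 ⟨α, StarAlgebra.subset_adjoin ℂ _ hα⟩
  · obtain ⟨α, hα⟩ := Set.mem_iUnion.1 (Set.mem_star.1 hy)
    refine Set.mem_iUnion.2 ⟨α, ?_⟩
    have : star (star y) ∈ factor C α := star_mem (StarAlgebra.subset_adjoin ℂ _ hα)
    rwa [star_star] at this

variable {ρ : Fin d → ℝ} {Ω : ℕ → Type*}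
  [∀ n, MeasurableSpace (Ω n)] {P : ∀ n, Measure (Ω n)} [∀ n, IsProbabilityMeasure (P n)]
  {R : ∀ n, ℕ → ∀ k l : Fin d, Ω n → Matrix (Fin (q n k)) (Fin (q n l)) ℂ} {K : ℝ}
  (h : RandomBlocks q ρ P R K) (hC : DeterministicBlocks q κ lam C K)

namespace DeterministicBlocks

include hC

theorem exists_constField_eq_fieldProj (k : Fin d) : ∃ i, constField C i = fieldProj.{u} q k := by
  obtain ⟨i, -, -, hi⟩ := hC.proj k
  exact ⟨i, funext fun z => hi z.size⟩

theorem constField_mem_niceAlgebra (i : I) : constField C i ∈ niceAlgebra q K :=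
  ⟨fun n a b => (measurable_const : Measurable fun _ => blockExt (C n i) a b), K,
    fun z _ => (norm_blockExt_le _).trans (hC.bdd z.size i)⟩

include h

omit [∀ n, IsProbabilityMeasure (P n)] in
theorem convergent_constField (i : I) : AsymptoticallyConvergent (fieldProj q) (fieldTrace q)
    (configFilter P (blockFamily R)) (constField C i) := by
  have hc := constField_corner (C := C) i
  have h1 : fieldProj q (κ i) * constField C i = constField C i := by
    rw [← hc, ← mul_assoc, ← mul_assoc, fieldProj_mul_self h.pos]
  have h2 : constField C i * fieldProj q (lam i) = constField C i := by
    rw [← hc, mul_assoc, fieldProj_mul_self h.pos]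
  rcases eq_or_ne (κ i) (lam i) with hi | hi
  · refine h.asymptoticTrace.convergent_of_left h1 ?_
    obtain ⟨c, hc⟩ := hC.lim i hi
    have h3 := (Complex.continuous_ofReal.tendsto _).comp
      (tendsto_ratio.{u} (P := P) (blockFamily R) h.ratio (κ i))
    refine ⟨_, (h3.mul (hc.comp (tendsto_size_configFilter P (blockFamily R)))).congr fun z => ?_⟩
    rw [← h1, fieldTrace_proj_mul h.pos]
    rfl
  · exact h.asymptoticTrace.convergent_of_off_diagonal hi h1 h2

-- The linear span of the family is already a `*`-algebra: composable products and adjoints stay in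
-- the family, and products with mismatched blocks vanish. Limits of the traces of its members are
-- therefore enough.
omit [∀ n, IsProbabilityMeasure (P n)] in
theorem convergent_factor_none {x : MatrixField.{u} q} (hx : x ∈ factor C none) :
    AsymptoticallyConvergent (fieldProj q) (fieldTrace q)
      (configFilter P (blockFamily R)) x := by
  have hS : ∀ s ∈ factorSet C none ∪ star (factorSet C none), ∃ i, constField C i = s := by
    have key : ∀ s ∈ factorSet C none, ∃ i, constField C i = s := by
      rintro s (⟨i, rfl⟩ | ⟨k, rfl⟩)
      · exact ⟨i, rfl⟩
      · exact hC.exists_constField_eq_fieldProj k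
    rintro s (hs | hs)
    · exact key s hs
    · obtain ⟨i, hi⟩ := key _ (Set.mem_star.1 hs)
      obtain ⟨m, -, -, hm⟩ := hC.adjoint i
      refine ⟨m, funext fun z => ?_⟩
      have := congrFun hi z
      change blockExt (C z.size m) = s z
      rw [hm, ← star_star (s z)]
      exact congrArg star this
  refine convergent_of_mem_adjoin_of_span (G := Set.range (constField C)) ?_
    (one_mem_span_of_proj h.asymptoticTrace ?_) ?_ (show x ∈ Algebra.adjoin ℂ _ from hx)
  · rintro _ ⟨i, rfl⟩
    exact hC.convergent_constField h i
  · rintro _ ⟨k, rfl⟩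
    exact hC.exists_constField_eq_fieldProj k
  · rintro s hs _ ⟨j, rfl⟩
    obtain ⟨i, rfl⟩ := hS s hs
    rcases eq_or_ne (lam i) (κ j) with hij | hij
    · obtain ⟨m, -, -, hm⟩ := hC.prod i j hij
      exact ⟨_, Submodule.subset_span ⟨m, rfl⟩, Eventually.of_forall fun z => (hm z.size).symm⟩
    · suffices h0 : constField C i * constField C j = 0 from
        ⟨0, zero_mem _, Eventually.of_forall fun z => by rw [h0]⟩
      rw [← constField_corner (C := C) i, ← constField_corner (C := C) j, mul_assoc,
        ← mul_assoc (fieldProj q (lam i)), ← mul_assoc (fieldProj q (lam i)),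
        fieldProj_orthogonal h.pos _ _ hij, zero_mul, zero_mul, mul_zero]

theorem convergent_factor (α : Option (RandomIndex d)) {x : MatrixField.{u} q}
    (hx : x ∈ factor C α) : AsymptoticallyConvergent (fieldProj q) (fieldTrace q)
      (configFilter P (blockFamily R)) x := by
  rcases α with _ | t
  · exact hC.convergent_factor_none h hx
  · refine h.convergent_randomField t
      (Algebra.adjoin_mono ?_ (show x ∈ Algebra.adjoin ℂ _ from hx))
    rintro y ((rfl | ⟨k, rfl⟩) | hy)
    · exact Or.inl (Or.inl rfl)
    · exact Or.inr ⟨k, rfl⟩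
    · rcases Set.mem_star.1 hy with hy | ⟨k, hk⟩
      · exact Or.inl (Or.inr ((star_star y).symm.trans (congrArg star hy)))
      · refine Or.inr ⟨k, ?_⟩
        rw [← star_star y, ← hk, fieldProj_star h.pos]

/-- The flow conjugates the matrix of index `t` alone; the other random matrices and the
deterministic family are fixed by it. -/
theorem tendsto_liberationTerms_factor (t : RandomIndex d) (k : Fin d)
    (l : List (Option (RandomIndex d) × MatrixField.{u} q))
    (hl : ∀ y ∈ l, y.2 ∈ (factor C y.1).toSubalgebra) :
    Tendsto (tensorTrace (fieldProj q) (fieldTrace q) k (liberationTerms t l))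
      (configFilter P (blockFamily R)) (𝓝 0) := by
  refine tendsto_liberationTerms (γ := conjFlow (K := K) t (h.map_conj t))
    (T := fun α => (factor C α).toSubalgebra)
    h.measurable_blockFamily h.ae_norm_blockFamily_le h.total h.total_pos ?_ ?_ ?_ k l hl
  · rintro (_ | s) x hx
    · exact factor_none_le hC.constField_mem_niceAlgebra (fieldProj_mem_niceAlgebra K) hx
    · exact factor_some_le (randomField_mem_niceAlgebra K s) (fieldProj_mem_niceAlgebra K) hx
  · exact fun x hx =>
      factor_some_le randomField_mem_conjAlgebra fieldProj_mem_conjAlgebra hx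
  · rintro (_ | s) hs x hx
    · exact factor_none_le (fun i => constField_mem_fixedAlgebra i) fieldProj_mem_fixedAlgebra hx
    · exact factor_some_le (randomField_mem_fixedAlgebra fun e => hs (by rw [e]))
        fieldProj_mem_fixedAlgebra hx

theorem convergent_jointAlgebra {x : MatrixField.{u} q} (hx : x ∈ jointAlgebra C) :
    AsymptoticallyConvergent (fieldProj q) (fieldTrace q)
      (configFilter P (blockFamily R)) x :=
  h.asymptoticTrace.convergent_of_mem_adjoin (T := fun α => (factor C α).toSubalgebra)
    fieldProj_mem_factor
    (fun α _ hx => hC.convergent_factor h α hx) (hC.tendsto_liberationTerms_factor h)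
    (mem_adjoin_of_mem_jointAlgebra hx)

end DeterministicBlocks

end Factors

/-! ### The limit space -/

/-- Multiplying `E x` by `p k` isolates `φ k x • p k`, and `p k` is nonzero. -/
theorem RectProbSpace.condExp_eq_zero_iff {d : ℕ} {ρ : Fin d → ℝ} {A : Type u} [Ring A]
    [StarRing A] [Algebra ℂ A] [StarModule ℂ A] (X : RectProbSpace ρ A) (x : A) :
    X.condExp x = 0 ↔ ∀ k, X.φ k x = 0 := by
  have e : X.condExp x = ∑ k, X.φ k x • X.p k := by simp [RectProbSpace.condExp]
  rw [e]
  refine ⟨fun hx k => ?_, fun hx => by simp [hx]⟩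
  have h1 : X.p k * ∑ l, X.φ l x • X.p l = X.φ k x • X.p k := by
    rw [Finset.mul_sum, Finset.sum_eq_single k]
    · rw [mul_smul_comm, X.p_mul_self]
    · intro l _ hl
      rw [mul_smul_comm, X.p_orthogonal k l hl.symm, smul_zero]
    · simp
  rw [hx, mul_zero] at h1
  exact (smul_eq_zero.1 h1.symm).resolve_right (X.p_ne_zero k)

section LimitSpace

variable {d : ℕ} {q : ℕ → Fin d → ℕ} {ρ : Fin d → ℝ} {F : Filter (Config.{u} q)} [F.NeBot]
  {𝔅 : StarSubalgebra ℂ (MatrixField.{u} q)}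

/-- The limits of the normalized traces of the diagonal blocks. -/
noncomputable def limitTrace
    (hconv : ∀ (k : Fin d) (x : 𝔅), ∃ c, Tendsto (fun z => blockTrace (q z.size) k (x.1 z)) F (𝓝 c))
    (k : Fin d) : 𝔅 →ₗ[ℂ] ℂ where
  toFun x := (hconv k x).choose
  map_add' x y := by
    refine tendsto_nhds_unique (hconv k (x + y)).choose_spec ?_
    refine ((hconv k x).choose_spec.add (hconv k y).choose_spec).congr fun z => ?_
    exact (map_add (blockTrace (q z.size) k) (x.1 z) (y.1 z)).symm
  map_smul' c x := by
    refine tendsto_nhds_unique (hconv k (c • x)).choose_spec ?_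
    refine ((hconv k x).choose_spec.const_mul c).congr fun z => ?_
    exact (map_smul (blockTrace (q z.size) k) c (x.1 z)).symm

variable
  (hconv : ∀ (k : Fin d) (x : 𝔅), ∃ c, Tendsto (fun z => blockTrace (q z.size) k (x.1 z)) F (𝓝 c))

theorem tendsto_limitTrace (k : Fin d) (x : 𝔅) :
    Tendsto (fun z => blockTrace (q z.size) k (x.1 z)) F (𝓝 (limitTrace hconv k x)) :=
  (hconv k x).choose_spec

theorem limitTrace_eq {k : Fin d} {x : 𝔅} {c : ℂ}
    (hx : Tendsto (fun z => blockTrace (q z.size) k (x.1 z)) F (𝓝 c)) :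
    limitTrace hconv k x = c :=
  tendsto_nhds_unique (tendsto_limitTrace hconv k x) hx

/-- The limit of the spaces of block matrices. -/
noncomputable def limitSpace (hq : ∀ n k, 0 < q n k)
    (hratio : ∀ k, Tendsto (fun z : Config.{u} q =>
      (q z.size k : ℝ) / ((∑ l, q z.size l : ℕ) : ℝ)) F (𝓝 (ρ k)))
    (hp : ∀ k, fieldProj q k ∈ 𝔅) : RectProbSpace ρ 𝔅 where
  p k := ⟨fieldProj q k, hp k⟩
  -- Fields are not identified when they agree eventually, so nonvanishing can be checked at one
  -- configuration.
  p_ne_zero k h0 :=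
    (blockMatrixSpace (q 0) (hq 0)).p_ne_zero k (congrFun (congrArg Subtype.val h0) ⟨0, 0⟩)
  p_star k := Subtype.ext (fieldProj_star hq k)
  p_mul_self k := Subtype.ext (fieldProj_mul_self hq k)
  p_orthogonal k l hkl := Subtype.ext (fieldProj_orthogonal hq k l hkl)
  p_sum := Subtype.ext (by
    refine Eq.trans ?_ (fieldProj_sum hq)
    exact map_sum 𝔅.subtype _ _)
  φ := limitTrace hconv
  φ_compress k x := limitTrace_eq hconv ((tendsto_limitTrace hconv k x).congr fun z =>
    ((blockMatrixSpace (q z.size) (hq _)).φ_compress k (x.1 z)).symm)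
  φ_unit k := limitTrace_eq hconv (tendsto_const_nhds.congr fun z =>
    ((blockMatrixSpace (q z.size) (hq _)).φ_unit k).symm)
  φ_nonneg k x hx := by
    have h1 := tendsto_limitTrace hconv k (star x * x)
    have h2 := fun z => (blockMatrixSpace (q z.size) (hq _)).φ_nonneg k (x.1 z)
      (congrFun (congrArg Subtype.val hx) z)
    refine ⟨ge_of_tendsto ((Complex.continuous_re.tendsto _).comp h1)
      (Eventually.of_forall fun z => (h2 z).1), ?_⟩
    exact tendsto_nhds_unique ((Complex.continuous_im.tendsto _).comp h1)
      (tendsto_const_nhds.congr fun z => (h2 z).2.symm)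
  φ_tracial k x y hx hy := limitTrace_eq hconv
    ((tendsto_limitTrace hconv k (y * x)).congr fun z =>
      ((blockMatrixSpace (q z.size) (hq _)).φ_tracial k (x.1 z) (y.1 z)
        (congrFun (congrArg Subtype.val hx) z) (congrFun (congrArg Subtype.val hy) z)).symm)
  φ_swap k l x y hx hy := by
    have hr := fun k => (Complex.continuous_ofReal.tendsto _).comp (hratio k)
    refine tendsto_nhds_unique ((hr k).mul (tendsto_limitTrace hconv k (x * y)))
      (((hr l).mul (tendsto_limitTrace hconv l (y * x))).congr fun z => ?_)
    exact ((blockMatrixSpace (q z.size) (hq _)).φ_swap k l (x.1 z) (y.1 z)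
      (congrFun (congrArg Subtype.val hx) z) (congrFun (congrArg Subtype.val hy) z)).symm

variable (hq : ∀ n k, 0 < q n k)
  (hratio : ∀ k, Tendsto (fun z : Config.{u} q =>
    (q z.size k : ℝ) / ((∑ l, q z.size l : ℕ) : ℝ)) F (𝓝 (ρ k)))
  (hp : ∀ k, fieldProj q k ∈ 𝔅)

/-- Evaluation at a configuration is an algebra morphism, so it suffices to compare the generators.
Convergence in `𝒟`-distribution then reduces to the convergence of the block traces of one field. -/
theorem limitSpace_eval {J : Type*} (a : J → 𝔅) (Q : DPolynomial d J) (z : Config.{u} q) :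
    ((limitSpace hconv hq hratio hp).eval a Q).1 z =
      (blockMatrixSpace (q z.size) (hq _)).eval (fun j => (a j).1 z) Q := by
  have e : (((Pi.evalAlgHom ℂ (fun z : Config.{u} q => BlockMatrix (q z.size)) z).comp
      𝔅.subtype.toAlgHom).comp ((limitSpace hconv hq hratio hp).eval a)) =
      (blockMatrixSpace (q z.size) (hq _)).eval fun j => (a j).1 z := by
    refine FreeAlgebra.hom_ext (funext fun v => ?_)
    rcases v with k | j | j <;>
    · simp only [RectProbSpace.eval, Function.comp_apply, AlgHom.comp_apply,
        FreeAlgebra.lift_ι_apply]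
      rfl
  exact DFunLike.congr_fun e Q

omit [F.NeBot] in
theorem AsymptoticallyConvergent.tendsto_blockTrace {x : MatrixField.{u} q} (hρ : ∀ k, 0 < ρ k)
    (hq : ∀ n k, 0 < q n k)
    (hratio : ∀ k, Tendsto (fun z : Config.{u} q =>
      (q z.size k : ℝ) / ((∑ l, q z.size l : ℕ) : ℝ)) F (𝓝 (ρ k)))
    (hx : AsymptoticallyConvergent (fieldProj q) (fieldTrace q) F x) (k : Fin d) :
    ∃ c, Tendsto (fun z => blockTrace (q z.size) k (x z)) F (𝓝 c) := by
  obtain ⟨c, hc⟩ := hx k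
  have h0 : (ρ k : ℂ) ≠ 0 := by exact_mod_cast (hρ k).ne'
  have hr := (Complex.continuous_ofReal.tendsto _).comp (hratio k)
  refine ⟨_, (hc.div hr h0).congr' ?_⟩
  filter_upwards [hr.eventually_ne h0] with z hz
  rw [Pi.div_apply, fieldTrace_proj_mul hq]
  exact mul_div_cancel_left₀ _ hz

/-- The limit of `τ (p k * x)` is `ρ k * φ k x` with `ρ k ≠ 0`: the two normalizations of the trace
detect the same centered elements. -/
theorem asymptoticallyCentered_iff (hρ : ∀ k, 0 < ρ k) (x : 𝔅) :
    AsymptoticallyCentered (fieldProj q) (fieldTrace q) F x.1 ↔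
      (limitSpace hconv hq hratio hp).condExp x = 0 := by
  rw [RectProbSpace.condExp_eq_zero_iff]
  refine forall_congr' fun k => ?_
  have hr := (Complex.continuous_ofReal.tendsto _).comp (hratio k)
  have h1 : Tendsto (fieldTrace q (fieldProj q k * x.1)) F
      (𝓝 ((ρ k : ℂ) * limitTrace hconv k x)) :=
    (hr.mul (tendsto_limitTrace hconv k x)).congr fun z =>
      (fieldTrace_proj_mul hq k x.1 z).symm
  have h0 : (ρ k : ℂ) ≠ 0 := by exact_mod_cast (hρ k).ne'
  constructor
  · exact fun h2 => (mul_eq_zero.1 (tendsto_nhds_unique h1 h2)).resolve_left h0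
  · intro h2
    change limitTrace hconv k x = 0 at h2
    rwa [h2, mul_zero] at h1

end LimitSpace

/-! ### From asymptotic freeness to freeness in the limit space -/

section Freeness

variable {d : ℕ} {q : ℕ → Fin d → ℕ} {ρ : Fin d → ℝ} {F : Filter (Config.{u} q)} [F.NeBot]
  {𝔅 : StarSubalgebra ℂ (MatrixField.{u} q)}

/-- Asymptotic freeness along the filter gives freeness in the limit space. -/
theorem subalgebrasFree_limitSpace
    (hconv : ∀ (k : Fin d) (x : 𝔅), ∃ c, Tendsto (fun z => blockTrace (q z.size) k (x.1 z)) F (𝓝 c))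
    (hq : ∀ n k, 0 < q n k)
    (hratio : ∀ k, Tendsto (fun z : Config.{u} q =>
      (q z.size k : ℝ) / ((∑ l, q z.size l : ℕ) : ℝ)) F (𝓝 (ρ k)))
    (hp : ∀ k, fieldProj q k ∈ 𝔅) (hρ : ∀ k, 0 < ρ k)
    {κ : Type*} {T : Option κ → StarSubalgebra ℂ (MatrixField.{u} q)}
    (hfree : ∀ l : List (Option κ × MatrixField.{u} q), l ≠ [] →
      AsymptoticTrace.Alternating (fieldProj q) (fieldTrace q) F (fun α => (T α).toSubalgebra) l →
      AsymptoticallyCentered (fieldProj q) (fieldTrace q) F (l.map Prod.snd).prod) :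
    SubalgebrasFree (limitSpace hconv hq hratio hp).condExp fun α => (T α).comap 𝔅.subtype := by
  intro m α x hα hx hE
  rw [← asymptoticallyCentered_iff hconv hq hratio hp hρ]
  have e : (List.ofFn x).prod.1 =
      ((List.ofFn fun i => (α i, (x i).1)).map Prod.snd).prod := by
    rw [List.map_ofFn]
    refine (map_list_prod 𝔅.subtype _).trans ?_
    rw [List.map_ofFn]
    rfl
  rw [e]
  refine hfree _ (by simp) ⟨fun y hy => ?_, ?_⟩
  · obtain ⟨i, rfl⟩ := List.mem_ofFn.1 hy
    exact ⟨hx i, (asymptoticallyCentered_iff hconv hq hratio hp hρ _).2 (hE i)⟩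
  · rw [List.isChain_ofFn]
    intro i hi
    exact hα ⟨i, by omega⟩

end Freeness

/-! ### Assembly of the theorem -/

theorem theorem14p1p05p1 {d : ℕ} (hd : 0 < d)
    -- sizes of the blocks; the total size of the `n`-th block matrices is `∑ k, q n k`
    (q : ℕ → Fin d → ℕ) (hq : ∀ n k, 0 < q n k)
    (hq_top : ∀ k, Tendsto (fun n => q n k) atTop atTop)
    (ρ : Fin d → ℝ) (hρ : ∀ k, 0 < ρ k)
    (hq_lim : ∀ k,
      Tendsto (fun n => (q n k : ℝ) / ((∑ l, q n l : ℕ) : ℝ)) atTop (𝓝 (ρ k)))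
    -- the random matrices `R n s k l`
    {Ω : ℕ → Type*} [∀ n, MeasurableSpace (Ω n)]
    (P : ∀ n, Measure (Ω n)) [∀ n, IsProbabilityMeasure (P n)]
    (R : ∀ n, ℕ → ∀ k l : Fin d, Ω n → Matrix (Fin (q n k)) (Fin (q n l)) ℂ)
    (hR_meas : ∀ n s k l, Measurable (R n s k l))
    (hR_indep : ∀ n,
      iIndepFun (fun t : ℕ × Fin d × Fin d => R n t.1 t.2.1 t.2.2) (P n))
    (hR_off_inv : ∀ n s k l, k ≠ l → BiUnitarilyInvariant (P n) (R n s k l))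
    (hR_off_law : ∀ s k l, k ≠ l →
      ConvergesToDeterministicLaw P (fun n ω => singularLaw (R n s k l ω)))
    (hR_odd : ∀ n s k, Odd s → UniformUnitary (P n) (R n s k k))
    (hR_even_herm : ∀ n s k, Even s → ∀ᵐ ω ∂(P n), (R n s k k ω).IsHermitian)
    (hR_even_inv : ∀ n s k, Even s → UnitarilyInvariant (P n) (R n s k k))
    (hR_even_law : ∀ s k, Even s →
      ConvergesToDeterministicLaw P (fun n ω => spectralLaw (R n s k k ω)))
    -- the deterministic diagonal matrices `C n i`, of size `q n (κ i) × q n (lam i)`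
    {I : Type u} (κ lam : I → Fin d)
    (C : ∀ (n : ℕ) (i : I), Matrix (Fin (q n (κ i))) (Fin (q n (lam i))) ℂ)
    (hC_diag : ∀ n i, IsRectDiagonal (C n i))
    (hC_proj : ∀ k, ∃ i, κ i = k ∧ lam i = k ∧ ∀ n, blockExt (C n i) = blockProj (q n) k)
    (hC_mul : ∀ i j, lam i = κ j → ∃ m, κ m = κ i ∧ lam m = lam j ∧
      ∀ n, blockExt (C n m) = blockExt (C n i) * blockExt (C n j))
    (hC_star : ∀ i, ∃ m, κ m = lam i ∧ lam m = κ i ∧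
      ∀ n, blockExt (C n m) = star (blockExt (C n i)))
    (hC_lim : ∀ i, κ i = lam i → ∃ c : ℂ,
      Tendsto (fun n => blockTrace (q n) (κ i) (blockExt (C n i))) atTop (𝓝 c))
    -- uniform boundedness
    (h_bdd : ∃ K : ℝ, (∀ n s k l, ∀ᵐ ω ∂(P n), opNorm (R n s k l ω) ≤ K) ∧
      ∀ n i, opNorm (C n i) ≤ K) :
    ∃ (A : Type u) (_ : Ring A) (_ : StarRing A) (_ : Algebra ℂ A) (_ : StarModule ℂ A)
      (X : RectProbSpace ρ A) (a : ℕ × Fin d × Fin d → A) (c : I → A),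
      (∀ t, a t ∈ X.corner t.2.1 t.2.2) ∧
      (∀ i, c i ∈ X.corner (κ i) (lam i)) ∧
      (∀ Q : DPolynomial d ((ℕ × Fin d × Fin d) ⊕ I),
        TendstoInProb P
          (fun n ω => (blockMatrixSpace (q n) (hq n)).dDistribution
            (Sum.elim (fun t => blockExt (R n t.1 t.2.1 t.2.2 ω)) fun i => blockExt (C n i)) Q)
          (X.dDistribution (Sum.elim a c) Q)) ∧
      FreeWithAmalgamation X.diag X.condExp
        (fun α : Option (ℕ × Fin d × Fin d) =>
          α.elim (Set.range c) fun t => {a t}) := by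
  obtain ⟨K, hK1, hK2⟩ := h_bdd
  have hN0 : ∀ n, 0 < ∑ l, q n l := fun n =>
    Finset.sum_pos (fun l _ => hq n l) ⟨⟨0, hd⟩, Finset.mem_univ _⟩
  have hN : Tendsto (fun n => ∑ l, q n l) atTop atTop :=
    tendsto_atTop_mono (fun n => Finset.single_le_sum (f := q n) (fun _ _ => Nat.zero_le _)
      (Finset.mem_univ (⟨0, hd⟩ : Fin d))) (hq_top ⟨0, hd⟩)
  -- The bound is enlarged to a nonnegative one, as required by the truncation of powers.
  have h : RandomBlocks q ρ P R (max K 0) :=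
    ⟨hq, hN0, hN, hρ, hq_lim, hR_meas, hR_indep, hR_off_inv, hR_off_law, hR_odd, hR_even_herm,
      hR_even_inv, hR_even_law, le_max_right _ _,
      fun n s k l => (hK1 n s k l).mono fun _ hω => hω.trans (le_max_left _ _)⟩
  have hC : DeterministicBlocks q κ lam C (max K 0) :=
    ⟨hC_proj, hC_mul, hC_star, hC_lim, fun n i => (hK2 n i).trans (le_max_left _ _)⟩
  have : (configFilter.{u} P (blockFamily R)).NeBot := configFilter_neBot _ _
  have hratio := fun k => tendsto_ratio.{u} (P := P) (blockFamily R) hq_lim k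
  have hconv : ∀ (k : Fin d) (x : jointAlgebra C), ∃ c,
      Tendsto (fun z => blockTrace (q z.size) k (x.1 z)) (configFilter P (blockFamily R)) (𝓝 c) :=
    fun k x => (hC.convergent_jointAlgebra h x.2).tendsto_blockTrace hρ hq hratio k
  have hp : ∀ k, fieldProj q k ∈ jointAlgebra C :=
    fun k => factorSet_subset_jointAlgebra none (Or.inr ⟨k, rfl⟩)
  let X := limitSpace hconv hq hratio hp
  let a : ℕ × Fin d × Fin d → jointAlgebra C := fun t =>
    ⟨randomField q t, factorSet_subset_jointAlgebra (some t) (Or.inl rfl)⟩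
  let c : I → jointAlgebra C := fun i =>
    ⟨constField C i, factorSet_subset_jointAlgebra none (Or.inl ⟨i, rfl⟩)⟩
  refine ⟨jointAlgebra C, inferInstance, inferInstance, inferInstance, inferInstance, X, a, c,
    fun t => Subtype.ext (randomField_corner t), fun i => Subtype.ext (constField_corner i),
    fun Q => ?_, fun α => (factor C α).comap (jointAlgebra C).subtype, fun α => ?_, fun α => ?_, ?_⟩
  -- Convergence holds by construction of the limit traces; it is read back as convergence in
  -- probability through the filter.
  · have hQ : Tendsto (fun (z : Config.{u} q) k =>
        blockTrace (q z.size) k ((X.eval (Sum.elim a c) Q).1 z))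
        (configFilter P (blockFamily R)) (𝓝 (X.dDistribution (Sum.elim a c) Q)) :=
      tendsto_pi_nhds.2 fun k => tendsto_limitTrace hconv k _
    rw [tendsto_configFilter] at hQ
    convert hQ using 5 with n ω k
    rw [limitSpace_eval]
    refine congrArg (fun b => (blockMatrixSpace (q n) (hq n)).dDistribution b Q k)
      (funext fun j => ?_)
    rcases j with t | i
    · exact (randomField_blockFamily.{u} t n ω).symm
    · rfl
  · rintro _ ⟨w, rfl⟩
    exact sum_mem fun k _ => (StarSubalgebra.toSubalgebra _).smul_mem (fieldProj_mem_factor α k) _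
  · rcases α with _ | t
    · rintro _ ⟨i, rfl⟩
      exact StarAlgebra.subset_adjoin ℂ _ (Or.inl ⟨i, rfl⟩)
    · rintro _ rfl
      exact StarAlgebra.subset_adjoin ℂ _ (Or.inl rfl)
  · exact subalgebrasFree_limitSpace hconv hq hratio hp hρ fun l hl hl' =>
      AsymptoticTrace.Alternating.centered_prod h.asymptoticTrace fieldProj_mem_factor
        (fun α _ hx => hC.convergent_factor h α hx) (hC.tendsto_liberationTerms_factor h) _ l
        le_rfl hl hl'
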